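/- Let $n\ge 1$. For $i\in\{1,2\}$ and $j=3-i$ let $\varphi_i:\mathbb{R}^n\to[0,\infty)$ be continuous and bounded with $$\lim_{\|x\|\to\infty}\varphi_i(x)=\|\varphi_i\|_u>0,\qquad \|f\|_u:=\sup_{x\in\mathbb{R}^n}|f(x)|,$$ let $h_i,k_i:[0,\infty)\to(0,\infty)$ be continuous, and let $p_{11},p_{12},p_{21},p_{22}\ge 0$ be real numbers (with the convention $0^0=1$). Consider the system $$\partial_t u_i(t,x)=k_i(t)\,\Delta u_i(t,x)+h_i(t)\,u_i(t,x)^{p_{ii}}\,u_j(t,x)^{p_{ij}},\quad t>0,\ x\in\mathbb{R}^n,\qquad u_i(0,x)=\varphi_i(x),\quad x\in\mathbb{R}^n, \tag{1}$$ and the corresponding integral system $$u_i(t,x)=\big(U_i(0,t)\varphi_i\big)(x)+\int_0^t h_i(s)\,\Big(U_i(s,t)\big(u_i(s,\cdot)^{p_{ii}}u_j(s,\cdot)^{p_{ij}}\big)\Big)(x)\,ds, \tag{2}$$ where $U_i(s,t)=T_{K_i(s,t)}$, $K_i(s,t)=\int_s^t k_i(r)\,dr$, $T_0g=g$ and, for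 $t>0$, $$T_tg(x)=\int_{\mathbb{R}^n}(4\pi t)^{-n/2}e^{-\|x-y\|^2/(4t)}g(y)\,dy .$$ For $T>0$, a *classical solution on $[0,T]$* is a pair $(u_1,u_2)$ of non-negative bounded continuous functions on $[0,T]\times\mathbb{R}^n$ that are of class $C^{1,2}$ on $(0,T]\times\mathbb{R}^n$ (that is, the derivative $\partial_tu_i$, one-sided at $t=T$, and the derivatives of $u_i$ of order at most two in $x$ exist and are jointly continuous there), satisfy the differential equations in (1) on $(0,T]\times\mathbb{R}^n$, and satisfy the initial conditions. A *mild solution on $[0,T]$* is a pair of non-negative bounded measurable functions on $[0,T]\times\mathbb{R}^n$ that satisfies (2) for all $(t,x)\in[0,T]\times\mathbb{R}^n$. Then there exist $T>0$ and a pair $(u_1,u_2)$ that is both a classical solution and a mild solution on $[0,T]$, with $u_i(t,x)>0$ for all $t\in(0,T]$, $x\in\mathbb{R}^n$ and $i\in\{1,2\}$. Moreover, $(u_1,u_2)$ is the only classical solution on $[0,T]$ and the only mild solution on $[0,T]$. -/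

import Mathlib

open Set Filter Topology MeasureTheory
open scoped InnerProductSpace

namespace HeatSystem

noncomputable section

/-- The uniform norm `sup {|f x| : x ∈ ℝⁿ}` (used for bounded functions only). -/
def supNorm {n : ℕ} (f : EuclideanSpace ℝ (Fin n) → ℝ) : ℝ := ⨆ x, |f x|

/-- The Gaussian density `(4 π t) ^ (-n/2) * exp (-‖x‖² / (4 t))`, meant for `t > 0`. -/
def heatKernel {n : ℕ} (t : ℝ) (x : EuclideanSpace ℝ (Fin n)) : ℝ :=
  1 / (4 * Real.pi * t) ^ ((n : ℝ) / 2) * Real.exp (-‖x‖ ^ 2 / (4 * t))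

/-- The heat semigroup: `T_t g = p(t, ·) * g` for `t > 0`, and `T_0 g = g`. -/
def heatSemigroup {n : ℕ} (t : ℝ) (g : EuclideanSpace ℝ (Fin n) → ℝ)
    (x : EuclideanSpace ℝ (Fin n)) : ℝ :=
  if t = 0 then g x else ∫ y, heatKernel t (x - y) * g y

/-- The evolution system `U(s,t) = T_{K(s,t)}` with `K(s,t) = ∫_s^t k(r) dr`. -/
def evolution {n : ℕ} (k : ℝ → ℝ) (s t : ℝ) (g : EuclideanSpace ℝ (Fin n) → ℝ) :
    EuclideanSpace ℝ (Fin n) → ℝ :=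
  heatSemigroup (∫ r in s..t, k r) g

/-- The power part `u_i ^ p_ii * u_j ^ p_ij` of the reaction term in the `i`-th equation, where
`j = 1 - i` is the other index of `Fin 2`. -/
def reaction {n : ℕ} (p : Fin 2 → Fin 2 → ℝ) (u : Fin 2 → ℝ → EuclideanSpace ℝ (Fin n) → ℝ)
    (i : Fin 2) (t : ℝ) (x : EuclideanSpace ℝ (Fin n)) : ℝ :=
  u i t x ^ p i i * u (1 - i) t x ^ p i (1 - i)

/-- `w` is of class `C^{1,2}` on `(0,T] × ℝⁿ`: the derivative of order one in `t` (one-sided at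
`t = T`) and those of order at most two in `x` exist and are jointly continuous there. -/
structure IsC12 {n : ℕ} (T : ℝ) (w : ℝ → EuclideanSpace ℝ (Fin n) → ℝ) : Prop where
  differentiable_time : ∀ t ∈ Ioc 0 T, ∀ x,
    DifferentiableWithinAt ℝ (fun s => w s x) (Ioc 0 T) t
  continuousOn_time : ContinuousOn
    (fun z : ℝ × EuclideanSpace ℝ (Fin n) => derivWithin (fun s => w s z.2) (Ioc 0 T) z.1)
    (Ioc 0 T ×ˢ univ)
  contDiff_space : ∀ t ∈ Ioc 0 T, ContDiff ℝ 2 (w t)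
  continuousOn_space : ∀ m : ℕ, m ≤ 2 → ContinuousOn
    (fun z : ℝ × EuclideanSpace ℝ (Fin n) => iteratedFDeriv ℝ m (w z.1) z.2)
    (Ioc 0 T ×ˢ univ)

/-- `u = (u_1, u_2)` is non-negative and bounded on `[0,T] × ℝⁿ`. -/
def IsNonnegBounded {n : ℕ} (T : ℝ) (u : Fin 2 → ℝ → EuclideanSpace ℝ (Fin n) → ℝ) : Prop :=
  ∃ M : ℝ, ∀ i, ∀ t ∈ Icc 0 T, ∀ x, 0 ≤ u i t x ∧ u i t x ≤ M

/-- Bounded non-negative classical solutions on `[0,T]` of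
`∂_t u_i = k_i(t) Δ u_i + h_i(t) u_i ^ p_ii u_j ^ p_ij`, `u_i(0, ·) = φ_i`. -/
structure IsClassicalSolution {n : ℕ} (k h : Fin 2 → ℝ → ℝ) (p : Fin 2 → Fin 2 → ℝ)
    (φ : Fin 2 → EuclideanSpace ℝ (Fin n) → ℝ) (T : ℝ)
    (u : Fin 2 → ℝ → EuclideanSpace ℝ (Fin n) → ℝ) : Prop where
  nonnegBounded : IsNonnegBounded T u
  continuousOn : ∀ i, ContinuousOn
    (fun z : ℝ × EuclideanSpace ℝ (Fin n) => u i z.1 z.2) (Icc 0 T ×ˢ univ)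
  isC12 : ∀ i, IsC12 T (u i)
  equation : ∀ i, ∀ t ∈ Ioc 0 T, ∀ x,
    derivWithin (fun s => u i s x) (Ioc 0 T) t =
      k i t * Laplacian.laplacian (u i t) x + h i t * reaction p u i t x
  initial : ∀ i x, u i 0 x = φ i x

/-- Bounded non-negative measurable solutions on `[0,T]` of the integral system
`u_i(t) = U_i(0,t) φ_i + ∫_0^t h_i(s) U_i(s,t) (u_i(s) ^ p_ii u_j(s) ^ p_ij) ds`. -/
structure IsMildSolution {n : ℕ} (k h : Fin 2 → ℝ → ℝ) (p : Fin 2 → Fin 2 → ℝ)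
    (φ : Fin 2 → EuclideanSpace ℝ (Fin n) → ℝ) (T : ℝ)
    (u : Fin 2 → ℝ → EuclideanSpace ℝ (Fin n) → ℝ) : Prop where
  nonnegBounded : IsNonnegBounded T u
  measurable : ∀ i, Measurable
    (fun z : Icc (0 : ℝ) T × EuclideanSpace ℝ (Fin n) => u i z.1 z.2)
  equation : ∀ i, ∀ t ∈ Icc 0 T, ∀ x,
    u i t x = evolution (k i) 0 t (φ i) x +
      ∫ s in (0 : ℝ)..t, h i s * evolution (k i) s t (reaction p u i s) x

end

end HeatSystem

/-!
The system is solved in the mild sense by monotone iteration, mild solutions are shown to be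
classical, and uniqueness is proved in the classical class by comparison. Uniqueness is the delicate
point: the powers `p_ij` may be less than one, so the reaction is not Lipschitz at zero, and the
initial data may vanish somewhere.

*Linear theory.* The heat semigroup is written as a Gaussian average
`heatMean σ g x = ∫ γ(z) g(x - √σ z) dz`, and the integral equation as `u = evolve K 0 φ f`, a heat
flow plus a Duhamel integral with `f` the reaction term. For bounded measurable `f` this is
differentiable in space at positive times; if `f` is `C¹` in space, restarting at a positive time
lets one derivative fall on the data, and `evolve` is a classical solution (`isC12_evolve`).

*Existence and regularity.* A large constant is a supersolution on a short time interval, and its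
iterates decrease to a mild solution (`exists_evolve_fixedPoint`). Since `φ_i` is bounded
below by a positive constant far out, its heat flow, and with it every mild or classical solution,
is bounded away from zero at positive times (`exists_pos_le_heatMean`,
`IsClassicalSolution.positiveBelow`). The reaction term is therefore smooth in `u` there, and mild
solutions are classical (`isClassicalSolution_evolve`).

*Uniqueness.* For two classical solutions `u`, `v` with the same data, `v` is compared with
`(u_i ^ α_i + e_i(t)) ^ (1 / α_i)`, `0 < α_i ≤ 1`, a concave function of `u_i`
(`le_rpow_add_of_increment`). It is a supersolution as soon as `e_i` absorbs the increment of the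
reaction terms written in the variables `u_i ^ α_i`. With `A_i = 1 - p_ii` and `b_i = p_ij` there
are two cases.

* Unless `A_i, b_i > 0` and `b_1 b_2 < A_1 A_2`, suitable `α_i` make these increments linearly
  bounded (`exists_exponents_linear`); then `e_i = ε exp (λ t)` works, and `ε → 0` gives `v ≤ u`.
* In the strictly sublinear case the system has spatially constant subsolutions `(c t) ^ g_i`
  leaving zero, where `A_i g_i = 1 + b_i g_j`. Suitable `α_i` make the transformed reaction
  subadditive (`exists_exponents_subadditive`), so that `e_i = (H t) ^ (α_i g_i)` works; as `u_i`
  itself grows at least like `t ^ g_i` (`rpow_le_of_sublinear`), this yields `v_i ≤ λ ^ g_i u_i` for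
  some `λ`. By homogeneity such a bound improves to `v_i ≤ λ ^ (g_i - 1) u_i`
  (`le_rpow_sub_one_mul`), and iterating drives `λ` to one.
-/

namespace HeatSystem

noncomputable section

variable {n : ℕ}

local notation "𝔼" => EuclideanSpace ℝ (Fin n)

/-! ### Gaussian kernel and Gaussian means -/

section Kernel

/-- The heat kernel at time `1`, the Gaussian density from which all heat kernels are obtained by
scaling. -/
def unitKernel (z : 𝔼) : ℝ := heatKernel 1 z

lemma heatKernel_nonneg {σ : ℝ} (hσ : 0 ≤ σ) (z : 𝔼) : 0 ≤ heatKernel σ z := by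
  unfold heatKernel; positivity

lemma unitKernel_pos (z : 𝔼) : 0 < unitKernel z := by
  unfold unitKernel heatKernel; positivity

lemma unitKernel_neg (z : 𝔼) : unitKernel (-z) = unitKernel z := by
  simp [unitKernel, heatKernel]

lemma unitKernel_eq (z : 𝔼) :
    unitKernel z = 1 / (4 * Real.pi) ^ ((n : ℝ) / 2) * Real.exp (-(1 / 4) * ‖z‖ ^ 2) := by
  unfold unitKernel heatKernel
  congr 2 <;> ring_nf

lemma continuous_unitKernel : Continuous (unitKernel : 𝔼 → ℝ) := by
  unfold unitKernel heatKernel; fun_prop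

lemma integrable_exp_neg_mul_sq_norm {b : ℝ} (hb : 0 < b) :
    Integrable (fun z : 𝔼 => Real.exp (-b * ‖z‖ ^ 2)) := by
  have := GaussianFourier.integrable_cexp_neg_mul_sq_norm_add (V := 𝔼) (b := (b : ℂ))
    (by simpa using hb) 0 0
  refine this.re.congr (ae_of_all _ fun z => ?_)
  have : (-(b : ℂ) * (‖z‖ : ℂ) ^ 2 + 0 * ((inner ℝ (0 : 𝔼) z : ℝ) : ℂ))
      = ((-b * ‖z‖ ^ 2 : ℝ) : ℂ) := by push_cast; ring
  simp only [this]
  exact Complex.exp_ofReal_re _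

/-- Polynomial factors are absorbed by half of a Gaussian exponent. -/
lemma one_add_sq_mul_exp_le {b : ℝ} (hb : 0 < b) (r : ℝ) :
    (1 + r ^ 2) * Real.exp (-b * r ^ 2) ≤ (1 + 2 / b) * Real.exp (-(b / 2) * r ^ 2) := by
  have h1 : Real.exp (-b * r ^ 2) = Real.exp (-(b / 2) * r ^ 2) * Real.exp (-(b / 2) * r ^ 2) := by
    rw [← Real.exp_add]; ring_nf
  have h2 : 1 + b / 2 * r ^ 2 ≤ Real.exp (b / 2 * r ^ 2) := by
    linarith [Real.add_one_le_exp (b / 2 * r ^ 2)]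
  have h3 : (1 + r ^ 2) ≤ (1 + 2 / b) * Real.exp (b / 2 * r ^ 2) := by
    calc (1 + r ^ 2) ≤ (1 + 2 / b) * (1 + b / 2 * r ^ 2) := by
          have : (1 + 2 / b) * (1 + b / 2 * r ^ 2) = 1 + r ^ 2 + 2 / b + b / 2 * r ^ 2 := by
            field_simp; ring
          rw [this]
          have : 0 ≤ 2 / b + b / 2 * r ^ 2 := by positivity
          linarith
      _ ≤ _ := by gcongr
  calc (1 + r ^ 2) * Real.exp (-b * r ^ 2)
      ≤ (1 + 2 / b) * Real.exp (b / 2 * r ^ 2) * Real.exp (-b * r ^ 2) := by gcongr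
    _ = _ := by rw [mul_assoc, ← Real.exp_add]; ring_nf

lemma integrable_one_add_sq_mul_unitKernel :
    Integrable (fun z : 𝔼 => (1 + ‖z‖ ^ 2) * unitKernel z) := by
  refine ((integrable_exp_neg_mul_sq_norm (n := n) (b := 1 / 4 / 2) (by norm_num)).const_mul
    (1 / (4 * Real.pi) ^ ((n : ℝ) / 2) * (1 + 2 / (1 / 4)))).mono'
    (by have := continuous_unitKernel (n := n); fun_prop) (ae_of_all _ fun z => ?_)
  rw [Real.norm_of_nonneg (by have := unitKernel_pos z; positivity), unitKernel_eq]
  have := one_add_sq_mul_exp_le (b := 1 / 4) (by norm_num) ‖z‖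
  calc _ = 1 / (4 * Real.pi) ^ ((n : ℝ) / 2) *
        ((1 + ‖z‖ ^ 2) * Real.exp (-(1 / 4) * ‖z‖ ^ 2)) := by ring
    _ ≤ 1 / (4 * Real.pi) ^ ((n : ℝ) / 2) *
        ((1 + 2 / (1 / 4)) * Real.exp (-(1 / 4 / 2) * ‖z‖ ^ 2)) := by gcongr
    _ = _ := by ring

lemma integrable_unitKernel : Integrable (unitKernel : 𝔼 → ℝ) := by
  refine integrable_one_add_sq_mul_unitKernel.mono' continuous_unitKernel.aestronglyMeasurable
    (ae_of_all _ fun z => ?_)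
  rw [Real.norm_of_nonneg (unitKernel_pos z).le]
  nlinarith [unitKernel_pos z, sq_nonneg ‖z‖]

lemma integrable_sq_mul_unitKernel : Integrable (fun z : 𝔼 => ‖z‖ ^ 2 * unitKernel z) := by
  refine (integrable_one_add_sq_mul_unitKernel.sub integrable_unitKernel).congr
    (ae_of_all _ fun z => ?_)
  simp; ring

lemma integrable_norm_mul_unitKernel : Integrable (fun z : 𝔼 => ‖z‖ * unitKernel z) := by
  refine integrable_one_add_sq_mul_unitKernel.mono'
    (by have := continuous_unitKernel (n := n); fun_prop) (ae_of_all _ fun z => ?_)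
  have := unitKernel_pos z
  rw [Real.norm_of_nonneg (by positivity)]
  gcongr
  nlinarith [sq_nonneg (‖z‖ - 1), norm_nonneg z]

lemma integral_unitKernel : ∫ z : 𝔼, unitKernel z = 1 := by
  simp_rw [unitKernel_eq]
  rw [integral_const_mul, GaussianFourier.integral_rexp_neg_mul_sq_norm (by norm_num)]
  simp only [finrank_euclideanSpace, Fintype.card_fin]
  rw [show Real.pi / (1 / 4) = 4 * Real.pi by ring, one_div, inv_mul_cancel₀]
  positivity

lemma heatKernel_smul {σ : ℝ} (hσ : 0 < σ) (z : 𝔼) :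
    heatKernel σ (√σ • z) = (√σ ^ n)⁻¹ * unitKernel z := by
  unfold unitKernel heatKernel
  have h1 : √σ ^ n = σ ^ ((n : ℝ) / 2) := by
    rw [Real.sqrt_eq_rpow, ← Real.rpow_natCast, ← Real.rpow_mul hσ.le]; congr 1; ring
  rw [h1, norm_smul, mul_pow, Real.norm_of_nonneg (Real.sqrt_nonneg _), Real.sq_sqrt hσ.le,
    Real.mul_rpow (by positivity) hσ.le]
  have : -(σ * ‖z‖ ^ 2) / (4 * σ) = -‖z‖ ^ 2 / (4 * 1) := by field_simp
  rw [this, mul_one]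
  field_simp

lemma continuousOn_heatKernel :
    ContinuousOn (fun q : ℝ × 𝔼 => heatKernel q.1 q.2) (Ioi 0 ×ˢ univ) := by
  unfold heatKernel
  refine ContinuousOn.mul (ContinuousOn.div continuousOn_const ?_ ?_) ?_
  · exact ContinuousOn.rpow_const (by fun_prop) (fun q hq => Or.inl (by
      have : 0 < q.1 := hq.1
      positivity))
  · intro q hq
    have : 0 < q.1 := hq.1
    positivity
  · refine Real.continuous_exp.comp_continuousOn (ContinuousOn.div (by fun_prop) (by fun_prop) ?_)
    intro q hq
    have : 0 < q.1 := hq.1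
    positivity

variable {F : Type*} [NormedAddCommGroup F] [NormedSpace ℝ F]

/-- Change of variables between the kernel at time `σ` and the unit kernel. -/
lemma integral_heatKernel_smul {σ : ℝ} (hσ : 0 < σ) (x : 𝔼) (H : 𝔼 → 𝔼 → F) :
    ∫ y, heatKernel σ (x - y) • H (x - y) y =
      ∫ z, unitKernel z • H (√σ • z) (x - √σ • z) := by
  have hs : 0 < √σ := Real.sqrt_pos.2 hσ
  have h1 := integral_sub_left_eq_self (fun w => heatKernel σ w • H w (x - w)) volume x
  simp only [sub_sub_cancel] at h1
  have h2 := Measure.integral_comp_smul (volume : Measure 𝔼)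
    (fun w => heatKernel σ w • H w (x - w)) (√σ)
  rw [finrank_euclideanSpace, Fintype.card_fin, abs_of_pos (by positivity)] at h2
  rw [h1, ← inv_smul_smul₀ (a := (√σ ^ n)⁻¹) (by positivity)
    (∫ w, heatKernel σ w • H w (x - w)), ← h2, inv_inv, ← integral_smul]
  refine integral_congr_ae (ae_of_all _ fun z => ?_)
  simp only [heatKernel_smul hσ]
  rw [smul_smul, ← mul_assoc, mul_inv_cancel₀ (by positivity), one_mul]

/-- The heat semigroup written as a Gaussian average, `∫ γ(z) g(x - √σ z) dz`. This form makes
sense for vector-valued `g` and is continuous up to `σ = 0`. -/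
def heatMean (σ : ℝ) (g : 𝔼 → F) (x : 𝔼) : F := ∫ z, unitKernel z • g (x - √σ • z)

/-- The spatial derivative of `heatMean σ g`, with the derivative falling on the kernel; it makes
sense for `g` bounded and measurable. -/
def heatGrad (σ : ℝ) (g : 𝔼 → F) (x : 𝔼) : 𝔼 →L[ℝ] F :=
  -(1 / (2 * √σ)) • ∫ z, unitKernel z • (innerSL ℝ z).smulRight (g (x - √σ • z))

lemma heatMean_eq_integral_heatKernel {σ : ℝ} (hσ : 0 < σ) (g : 𝔼 → F) (x : 𝔼) :
    heatMean σ g x = ∫ y, heatKernel σ (x - y) • g y :=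
  (integral_heatKernel_smul hσ x fun _ y => g y).symm

lemma heatMean_zero [CompleteSpace F] (g : 𝔼 → F) : heatMean 0 g = g := by
  ext x
  simp [heatMean, integral_smul_const, integral_unitKernel]

lemma heatSemigroup_eq_heatMean {σ : ℝ} (hσ : 0 ≤ σ) (g : 𝔼 → ℝ) :
    heatSemigroup σ g = heatMean σ g := by
  ext x
  rcases hσ.eq_or_lt with rfl | h
  · simp [heatSemigroup, heatMean_zero]
  · simp [heatSemigroup, h.ne', heatMean_eq_integral_heatKernel h]

lemma heatGrad_eq_integral_heatKernel {σ : ℝ} (hσ : 0 < σ) (g : 𝔼 → F) (x : 𝔼) :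
    heatGrad σ g x =
      ∫ y, (-(1 / (2 * σ)) * heatKernel σ (x - y)) • (innerSL ℝ (x - y)).smulRight (g y) := by
  have h := integral_heatKernel_smul hσ x
    fun w y => (-(1 / (2 * σ))) • (innerSL ℝ w).smulRight (g y)
  have hs : 0 < √σ := Real.sqrt_pos.2 hσ
  have e : ∀ y, (-(1 / (2 * σ)) * heatKernel σ (x - y)) • (innerSL ℝ (x - y)).smulRight (g y) =
      heatKernel σ (x - y) • ((-(1 / (2 * σ))) • (innerSL ℝ (x - y)).smulRight (g y)) := fun y => by
    rw [smul_smul, mul_comm]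
  simp_rw [e]
  rw [h, heatGrad, ← integral_smul]
  refine integral_congr_ae (ae_of_all _ fun z => ?_)
  ext w
  simp only [smul_apply, ContinuousLinearMap.smulRight_apply, innerSL_apply_apply, smul_smul,
    map_smul]
  congr 1
  have : σ = √σ * √σ := (Real.mul_self_sqrt hσ.le).symm
  field_simp
  rw [smul_eq_mul]
  nth_rw 1 [this]
  ring

end Kernel

/-! ### Bounds, measurability and spatial derivatives of Gaussian means -/

section MeanBounds

variable {F : Type*} [NormedAddCommGroup F] [NormedSpace ℝ F]

lemma norm_unitKernel_smul_le {M : ℝ} {w : F} (hw : ‖w‖ ≤ M) (z : 𝔼) :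
    ‖unitKernel z • w‖ ≤ unitKernel z * M := by
  rw [norm_smul, Real.norm_of_nonneg (unitKernel_pos z).le]
  exact mul_le_mul_of_nonneg_left hw (unitKernel_pos z).le

lemma norm_heatMean_le {g : 𝔼 → F} {M : ℝ} (hg : ∀ x, ‖g x‖ ≤ M) (σ : ℝ) (x : 𝔼) :
    ‖heatMean σ g x‖ ≤ M := by
  have := norm_integral_le_of_norm_le (integrable_unitKernel.mul_const M)
    (ae_of_all _ fun z => norm_unitKernel_smul_le (hg (x - √σ • z)) z)
  rwa [integral_mul_const, integral_unitKernel, one_mul] at this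

/-- Half of the first absolute moment of the unit kernel. -/
def gradConst (n : ℕ) : ℝ := (∫ z : EuclideanSpace ℝ (Fin n), ‖z‖ * unitKernel z) / 2

lemma gradConst_nonneg : 0 ≤ gradConst n :=
  div_nonneg (integral_nonneg fun z => mul_nonneg (norm_nonneg _) (unitKernel_pos z).le) two_pos.le

lemma norm_heatGrad_le {g : 𝔼 → F} {M : ℝ} (hg : ∀ x, ‖g x‖ ≤ M) (σ : ℝ) (x : 𝔼) :
    ‖heatGrad σ g x‖ ≤ gradConst n * M / √σ := by
  have := norm_integral_le_of_norm_le (f := fun z => unitKernel z •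
      (innerSL ℝ z).smulRight (g (x - √σ • z))) (integrable_norm_mul_unitKernel.mul_const M)
    (ae_of_all _ fun z => by
      rw [norm_smul, Real.norm_of_nonneg (unitKernel_pos z).le,
        ContinuousLinearMap.norm_smulRight_apply, innerSL_apply_norm]
      have := unitKernel_pos z
      calc unitKernel z * (‖z‖ * ‖g (x - √σ • z)‖) ≤ unitKernel z * (‖z‖ * M) := by
            gcongr; exact hg _
        _ = _ := by ring)
  rw [integral_mul_const] at this
  rw [heatGrad, norm_smul, norm_neg, Real.norm_of_nonneg (by positivity)]
  calc _ ≤ 1 / (2 * √σ) * ((∫ z : 𝔼, ‖z‖ * unitKernel z) * M) := by gcongr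
    _ = _ := by unfold gradConst; ring

lemma measurable_sub_sqrt_smul {α : Type*} [MeasurableSpace α] {σ : α → ℝ} {X : α → 𝔼}
    (hσ : Measurable σ) (hX : Measurable X) :
    Measurable fun q : α × 𝔼 => X q.1 - √(σ q.1) • q.2 :=
  (hX.comp measurable_fst).sub ((hσ.comp measurable_fst).sqrt.smul measurable_snd)

section Measurability

variable {α : Type*} [MeasurableSpace α] {σ : α → ℝ} {X : α → EuclideanSpace ℝ (Fin n)}
  {f : α → EuclideanSpace ℝ (Fin n) → F}

lemma stronglyMeasurable_heatMean_integrand (hf : StronglyMeasurable (Function.uncurry f))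
    (hσ : Measurable σ) (hX : Measurable X) :
    StronglyMeasurable fun q : α × 𝔼 => unitKernel q.2 • f q.1 (X q.1 - √(σ q.1) • q.2) :=
  (continuous_unitKernel.measurable.comp measurable_snd).stronglyMeasurable.smul
    (hf.comp_measurable (measurable_fst.prodMk (measurable_sub_sqrt_smul hσ hX)))

lemma stronglyMeasurable_heatMean (hf : StronglyMeasurable (Function.uncurry f))
    (hσ : Measurable σ) (hX : Measurable X) :
    StronglyMeasurable fun a => heatMean (σ a) (f a) (X a) :=
  (stronglyMeasurable_heatMean_integrand hf hσ hX).integral_prod_right'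

lemma continuous_smulRight_innerSL :
    Continuous fun q : 𝔼 × F => (innerSL ℝ q.1).smulRight q.2 := by
  change Continuous fun q : 𝔼 × F => ContinuousLinearMap.smulRightL ℝ 𝔼 F (innerSL ℝ q.1) q.2
  fun_prop

lemma stronglyMeasurable_smulRight {β : Type*} [MeasurableSpace β] {Z : β → 𝔼} {g : β → F}
    (hZ : Measurable Z) (hg : StronglyMeasurable g) :
    StronglyMeasurable fun b => (innerSL ℝ (Z b)).smulRight (g b) := by
  have h1 : StronglyMeasurable fun b => (Z b, g b) := hZ.stronglyMeasurable.prodMk hg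
  have h2 := (continuous_smulRight_innerSL (n := n) (F := F)).comp_stronglyMeasurable h1
  simpa only [Function.comp_def] using h2

lemma stronglyMeasurable_heatGrad (hf : StronglyMeasurable (Function.uncurry f))
    (hσ : Measurable σ) (hX : Measurable X) :
    StronglyMeasurable fun a => heatGrad (σ a) (f a) (X a) := by
  have h : StronglyMeasurable fun q : α × 𝔼 => unitKernel q.2 •
      (innerSL ℝ q.2).smulRight (f q.1 (X q.1 - √(σ q.1) • q.2)) :=
    (continuous_unitKernel.measurable.comp measurable_snd).stronglyMeasurable.smul
      (stronglyMeasurable_smulRight measurable_snd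
        (hf.comp_measurable (measurable_fst.prodMk (measurable_sub_sqrt_smul hσ hX))))
  have hc : Measurable fun a => -(1 / (2 * √(σ a))) := by
    have := hσ.sqrt
    fun_prop
  have hi : StronglyMeasurable fun a => ∫ z, unitKernel z •
      (innerSL ℝ z).smulRight (f a (X a - √(σ a) • z)) := h.integral_prod_right'
  exact hc.stronglyMeasurable.smul hi

end Measurability

lemma integrable_unitKernel_smul {g : 𝔼 → F} (hg : StronglyMeasurable g) {M : ℝ}
    (hM : ∀ x, ‖g x‖ ≤ M) : Integrable fun z : 𝔼 => unitKernel z • g z :=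
  (integrable_unitKernel.mul_const M).mono'
    (continuous_unitKernel.aestronglyMeasurable.smul hg.aestronglyMeasurable)
    (ae_of_all _ fun z => norm_unitKernel_smul_le (hM z) z)

/-- Locally uniformly in `(σ, x)` with `σ > 0`, the heat kernel and its first moment density are
dominated by one integrable function. -/
lemma exists_integrable_heatKernel_bound {σ₀ : ℝ} (hσ₀ : 0 < σ₀) (x₀ : 𝔼) :
    ∃ B : 𝔼 → ℝ, Integrable B ∧ ∀ σ ∈ Ioo (σ₀ / 2) (2 * σ₀), ∀ x ∈ Metric.ball x₀ 1, ∀ y,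
      (1 + ‖x - y‖ ^ 2) * heatKernel σ (x - y) ≤ B y := by
  set b : ℝ := 1 / (8 * σ₀)
  have hb : 0 < b := by positivity
  set c : ℝ := 1 / (2 * Real.pi * σ₀) ^ ((n : ℝ) / 2)
  have hc : 0 < c := by positivity
  refine ⟨fun y => c * ((1 + 2 / b) * Real.exp (b / 2)) * Real.exp (-(b / 4) * ‖y - x₀‖ ^ 2),
    ((integrable_exp_neg_mul_sq_norm (by positivity)).comp_sub_right x₀).const_mul _, ?_⟩
  intro σ hσ x hx y
  have hσ0 : 0 < σ := by linarith [hσ.1]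
  have hk : heatKernel σ (x - y) ≤ c * Real.exp (-b * ‖x - y‖ ^ 2) := by
    unfold heatKernel
    have h1 : -‖x - y‖ ^ 2 / (4 * σ) ≤ -b * ‖x - y‖ ^ 2 := by
      have : b ≤ 1 / (4 * σ) := by
        simp only [b]
        exact one_div_le_one_div_of_le (by positivity) (by linarith [hσ.2])
      calc -‖x - y‖ ^ 2 / (4 * σ) = -(1 / (4 * σ) * ‖x - y‖ ^ 2) := by ring
        _ ≤ -(b * ‖x - y‖ ^ 2) := by gcongr
        _ = _ := by ring
    have h2 : 2 * Real.pi * σ₀ ≤ 4 * Real.pi * σ := by nlinarith [Real.pi_pos, hσ.1]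
    have h3 : 1 / (4 * Real.pi * σ) ^ ((n : ℝ) / 2) ≤ c := by simp only [c]; gcongr
    gcongr
  have hd : -(b / 2) * ‖x - y‖ ^ 2 ≤ b / 2 + -(b / 4) * ‖y - x₀‖ ^ 2 := by
    have h1 : ‖y - x₀‖ ≤ ‖x - y‖ + 1 := by
      have : y - x₀ = -(x - y) + (x - x₀) := by abel
      rw [this]
      refine (norm_add_le _ _).trans ?_
      rw [norm_neg]
      have := (mem_ball_iff_norm.1 hx).le
      linarith
    have h2 : ‖y - x₀‖ ^ 2 ≤ 2 * ‖x - y‖ ^ 2 + 2 := by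
      nlinarith [norm_nonneg (y - x₀), norm_nonneg (x - y), sq_nonneg (‖x - y‖ - 1)]
    nlinarith
  calc (1 + ‖x - y‖ ^ 2) * heatKernel σ (x - y)
      ≤ (1 + ‖x - y‖ ^ 2) * (c * Real.exp (-b * ‖x - y‖ ^ 2)) := by gcongr
    _ = c * ((1 + ‖x - y‖ ^ 2) * Real.exp (-b * ‖x - y‖ ^ 2)) := by ring
    _ ≤ c * ((1 + 2 / b) * Real.exp (-(b / 2) * ‖x - y‖ ^ 2)) := by
        exact mul_le_mul_of_nonneg_left (one_add_sq_mul_exp_le hb _) hc.le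
    _ ≤ c * ((1 + 2 / b) * Real.exp (b / 2 + -(b / 4) * ‖y - x₀‖ ^ 2)) := by gcongr
    _ = _ := by rw [Real.exp_add]; ring

lemma heatKernel_le_of_bound {σ : ℝ} (hσ : 0 < σ) {z : 𝔼} {B : ℝ}
    (h : (1 + ‖z‖ ^ 2) * heatKernel σ z ≤ B) :
    heatKernel σ z ≤ B ∧ ‖z‖ * heatKernel σ z ≤ B := by
  have hk := heatKernel_nonneg hσ.le z
  constructor
  · nlinarith [mul_nonneg (sq_nonneg ‖z‖) hk]
  · refine le_trans ?_ h
    gcongr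
    nlinarith [sq_nonneg (‖z‖ - 1), norm_nonneg z]

lemma hasFDerivAt_heatKernel {σ : ℝ} (x : 𝔼) :
    HasFDerivAt (heatKernel σ) ((-(1 / (2 * σ)) * heatKernel σ x) • innerSL ℝ x) x := by
  have h1 : HasFDerivAt (fun z : 𝔼 => ‖z‖ ^ 2) (2 • innerSL ℝ x) x :=
    (hasStrictFDerivAt_norm_sq x).hasFDerivAt
  have h2 := ((h1.const_mul (-(1 / (4 * σ)))).exp).const_mul (1 / (4 * Real.pi * σ) ^ ((n : ℝ) / 2))
  have e : (heatKernel σ : 𝔼 → ℝ) = fun z => 1 / (4 * Real.pi * σ) ^ ((n : ℝ) / 2) *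
      Real.exp (-(1 / (4 * σ)) * ‖z‖ ^ 2) := by
    ext z; unfold heatKernel; congr 2; ring
  rw [e]
  refine h2.congr_fderiv ?_
  ext w
  simp
  ring

lemma measurable_heatKernel_sub (σ : ℝ) (x : 𝔼) : Measurable fun y => heatKernel σ (x - y) := by
  unfold heatKernel; fun_prop

lemma stronglyMeasurable_grad_integrand {g : 𝔼 → F} (hg : StronglyMeasurable g) (σ : ℝ) (x : 𝔼) :
    StronglyMeasurable fun y => (-(1 / (2 * σ)) * heatKernel σ (x - y)) •
      (innerSL ℝ (x - y)).smulRight (g y) :=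
  ((measurable_heatKernel_sub σ x).const_mul _).stronglyMeasurable.smul
    (stronglyMeasurable_smulRight (by fun_prop) hg)

lemma norm_grad_integrand_le {g : 𝔼 → F} {M : ℝ} (hM : ∀ x, ‖g x‖ ≤ M) {σ c B : ℝ} (hσ : 0 < σ)
    (hc : c ≤ σ) (hc0 : 0 < c) {x y : 𝔼} (h : (1 + ‖x - y‖ ^ 2) * heatKernel σ (x - y) ≤ B) :
    ‖(-(1 / (2 * σ)) * heatKernel σ (x - y)) • (innerSL ℝ (x - y)).smulRight (g y)‖ ≤
      1 / (2 * c) * B * M := by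
  have hk := heatKernel_nonneg hσ.le (x - y)
  have hM0 : 0 ≤ M := (norm_nonneg _).trans (hM x)
  have hB := (heatKernel_le_of_bound hσ h).2
  have hB0 : 0 ≤ B := le_trans (by positivity) hB
  rw [norm_smul, ContinuousLinearMap.norm_smulRight_apply, innerSL_apply_norm, norm_mul, norm_neg,
    Real.norm_of_nonneg hk, Real.norm_of_nonneg (by positivity)]
  calc 1 / (2 * σ) * heatKernel σ (x - y) * (‖x - y‖ * ‖g y‖)
      = 1 / (2 * σ) * (‖x - y‖ * heatKernel σ (x - y)) * ‖g y‖ := by ring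
    _ ≤ 1 / (2 * c) * B * M := by gcongr; exact hM y

/-- The heat semigroup is smoothing: `heatMean σ g` is differentiable for bounded measurable `g`. -/
lemma hasFDerivAt_heatMean {g : 𝔼 → F} (hg : StronglyMeasurable g) {M : ℝ} (hM : ∀ x, ‖g x‖ ≤ M)
    {σ : ℝ} (hσ : 0 < σ) (x : 𝔼) : HasFDerivAt (heatMean σ g) (heatGrad σ g x) x := by
  obtain ⟨B, hB, hBk⟩ := exists_integrable_heatKernel_bound hσ x
  have hσI : σ ∈ Ioo (σ / 2) (2 * σ) := ⟨by linarith, by linarith⟩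
  have e : heatMean σ g = fun x => ∫ y, heatKernel σ (x - y) • g y := by
    ext x; exact heatMean_eq_integral_heatKernel hσ g x
  rw [e, heatGrad_eq_integral_heatKernel hσ]
  refine hasFDerivAt_integral_of_dominated_of_fderiv_le (𝕜 := ℝ)
    (bound := fun y => 1 / (2 * σ) * B y * M)
    (F := fun x y => heatKernel σ (x - y) • g y)
    (F' := fun x y => (-(1 / (2 * σ)) * heatKernel σ (x - y)) • (innerSL ℝ (x - y)).smulRight (g y))
    (Metric.ball_mem_nhds x one_pos) (Eventually.of_forall fun x' => ?_) ?_ ?_ ?_ ?_ ?_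
  · exact ((measurable_heatKernel_sub σ x').stronglyMeasurable.smul hg).aestronglyMeasurable
  · refine (hB.mul_const M).mono'
      ((measurable_heatKernel_sub σ x).stronglyMeasurable.smul hg).aestronglyMeasurable
      (ae_of_all _ fun y => ?_)
    have := heatKernel_le_of_bound hσ (hBk σ hσI x (Metric.mem_ball_self one_pos) y)
    have hk := heatKernel_nonneg hσ.le (x - y)
    rw [norm_smul, Real.norm_of_nonneg hk]
    have := hM y
    have h0 : 0 ≤ B y := by linarith
    gcongr
    linarith
  · exact (stronglyMeasurable_grad_integrand hg σ x).aestronglyMeasurable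
  · exact ae_of_all _ fun y x' hx' => norm_grad_integrand_le hM hσ le_rfl hσ (hBk σ hσI x' hx' y)
  · exact (hB.const_mul _).mul_const M
  · refine ae_of_all _ fun y x' _ => ?_
    have h1 := (hasFDerivAt_comp_sub y).2 (hasFDerivAt_heatKernel (σ := σ) (x' - y))
    refine (h1.smul_const (g y)).congr_fderiv ?_
    ext w
    simp [smul_smul]

lemma tendsto_heatKernel_sub {σ₀ : ℝ} (hσ₀ : 0 < σ₀) (x₀ y : 𝔼) :
    ContinuousAt (fun q : ℝ × 𝔼 => heatKernel q.1 (q.2 - y)) (σ₀, x₀) := by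
  have h := (continuousOn_heatKernel (n := n)).continuousAt (x := (σ₀, x₀ - y))
    ((isOpen_Ioi.prod isOpen_univ).mem_nhds ⟨hσ₀, trivial⟩)
  exact ContinuousAt.comp (x := (σ₀, x₀)) (f := fun q : ℝ × 𝔼 => (q.1, q.2 - y)) h (by fun_prop)

lemma eventually_mem_Ioo_ball {σ₀ : ℝ} (hσ₀ : 0 < σ₀) (x₀ : 𝔼) :
    ∀ᶠ q : ℝ × 𝔼 in 𝓝 (σ₀, x₀), q.1 ∈ Ioo (σ₀ / 2) (2 * σ₀) ∧ q.2 ∈ Metric.ball x₀ 1 := by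
  have h1 : Ioo (σ₀ / 2) (2 * σ₀) ∈ 𝓝 σ₀ := Ioo_mem_nhds (by linarith) (by linarith)
  exact prod_mem_nhds h1 (Metric.ball_mem_nhds x₀ one_pos)

lemma continuousOn_heatMean_of_measurable {g : 𝔼 → F} (hg : StronglyMeasurable g) {M : ℝ}
    (hM : ∀ x, ‖g x‖ ≤ M) :
    ContinuousOn (fun q : ℝ × 𝔼 => heatMean q.1 g q.2) (Ioi 0 ×ˢ univ) := by
  rintro ⟨σ₀, x₀⟩ ⟨hσ₀ : 0 < σ₀, -⟩
  apply ContinuousAt.continuousWithinAt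
  obtain ⟨B, hB, hBk⟩ := exists_integrable_heatKernel_bound hσ₀ x₀
  have hev := eventually_mem_Ioo_ball hσ₀ x₀
  have hpos : ∀ {σ}, σ ∈ Ioo (σ₀ / 2) (2 * σ₀) → 0 < σ := fun h => by linarith [h.1]
  refine ContinuousAt.congr_of_eventuallyEq
    (f := fun q : ℝ × 𝔼 => ∫ y, heatKernel q.1 (q.2 - y) • g y) ?_
    (hev.mono fun q hq => heatMean_eq_integral_heatKernel (hpos hq.1) g q.2)
  refine continuousAt_of_dominated (bound := fun y => B y * M)
    (Eventually.of_forall fun q =>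
      ((measurable_heatKernel_sub q.1 q.2).stronglyMeasurable.smul hg).aestronglyMeasurable)
    (hev.mono fun q hq => ae_of_all _ fun y => ?_) (hB.mul_const M)
    (ae_of_all _ fun y => (tendsto_heatKernel_sub hσ₀ x₀ y).smul_const _)
  have := (heatKernel_le_of_bound (hpos hq.1) (hBk q.1 hq.1 q.2 hq.2 y)).1
  have hk := heatKernel_nonneg (hpos hq.1).le (q.2 - y)
  rw [norm_smul, Real.norm_of_nonneg hk]
  have := hM y
  have h0 : 0 ≤ B y := by linarith
  gcongr

lemma continuousOn_heatGrad {g : 𝔼 → F} (hg : StronglyMeasurable g) {M : ℝ}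
    (hM : ∀ x, ‖g x‖ ≤ M) :
    ContinuousOn (fun q : ℝ × 𝔼 => heatGrad q.1 g q.2) (Ioi 0 ×ˢ univ) := by
  rintro ⟨σ₀, x₀⟩ ⟨hσ₀ : 0 < σ₀, -⟩
  apply ContinuousAt.continuousWithinAt
  obtain ⟨B, hB, hBk⟩ := exists_integrable_heatKernel_bound hσ₀ x₀
  have hev := eventually_mem_Ioo_ball hσ₀ x₀
  have hpos : ∀ {σ}, σ ∈ Ioo (σ₀ / 2) (2 * σ₀) → 0 < σ := fun h => by linarith [h.1]
  refine ContinuousAt.congr_of_eventuallyEq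
    (f := fun q : ℝ × 𝔼 => ∫ y, (-(1 / (2 * q.1)) * heatKernel q.1 (q.2 - y)) •
      (innerSL ℝ (q.2 - y)).smulRight (g y)) ?_
    (hev.mono fun q hq => heatGrad_eq_integral_heatKernel (hpos hq.1) g q.2)
  refine continuousAt_of_dominated (bound := fun y => 1 / (2 * (σ₀ / 2)) * B y * M)
    (Eventually.of_forall fun q =>
      (stronglyMeasurable_grad_integrand hg q.1 q.2).aestronglyMeasurable)
    (hev.mono fun q hq => ae_of_all _ fun y => norm_grad_integrand_le hM (hpos hq.1) hq.1.1.le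
      (by positivity) (hBk q.1 hq.1 q.2 hq.2 y))
    ((hB.const_mul _).mul_const M) (ae_of_all _ fun y => ?_)
  have h1 : ContinuousAt (fun q : ℝ × 𝔼 => -(1 / (2 * q.1))) (σ₀, x₀) := by
    have : (2 * (σ₀, x₀).1) ≠ 0 := by simpa using hσ₀.ne'
    fun_prop (disch := assumption)
  exact (h1.mul (tendsto_heatKernel_sub hσ₀ x₀ y)).smul
    (continuous_smulRight_innerSL.comp (f := fun q : ℝ × 𝔼 => (q.2 - y, g y))
      (by fun_prop)).continuousAt

end MeanBounds

/-! ### Order, continuity and semigroup property -/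

section MeanOrder

variable {F : Type*} [NormedAddCommGroup F] [NormedSpace ℝ F]

lemma heatMean_mono {g₁ g₂ : 𝔼 → ℝ} (h₁ : StronglyMeasurable g₁) (h₂ : StronglyMeasurable g₂)
    {M : ℝ} (hM₁ : ∀ x, ‖g₁ x‖ ≤ M) (hM₂ : ∀ x, ‖g₂ x‖ ≤ M) (h : ∀ x, g₁ x ≤ g₂ x) (σ : ℝ)
    (x : 𝔼) : heatMean σ g₁ x ≤ heatMean σ g₂ x := by
  refine integral_mono
    (integrable_unitKernel_smul (h₁.comp_measurable (by fun_prop)) fun z => hM₁ (x - √σ • z))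
    (integrable_unitKernel_smul (h₂.comp_measurable (by fun_prop)) fun z => hM₂ (x - √σ • z))
    fun z => ?_
  exact mul_le_mul_of_nonneg_left (h _) (unitKernel_pos z).le

lemma heatMean_nonneg {g : 𝔼 → ℝ} (h : ∀ x, 0 ≤ g x) (σ : ℝ) (x : 𝔼) : 0 ≤ heatMean σ g x :=
  integral_nonneg fun z => mul_nonneg (unitKernel_pos z).le (h _)

/-- `heatMean` is jointly continuous in all its arguments on continuous bounded data, up to and
including `σ = 0`. -/
lemma continuousAt_heatMean {α : Type*} [TopologicalSpace α] [FirstCountableTopology α]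
    {σ : α → ℝ} {X : α → EuclideanSpace ℝ (Fin n)} {f : α → EuclideanSpace ℝ (Fin n) → F} {a₀ : α}
    (hf : ∀ x, ContinuousAt (Function.uncurry f) (a₀, x)) (hσ : ContinuousAt σ a₀)
    (hX : ContinuousAt X a₀) (hfm : ∀ a, StronglyMeasurable (f a)) {M : ℝ}
    (hM : ∀ a x, ‖f a x‖ ≤ M) : ContinuousAt (fun a => heatMean (σ a) (f a) (X a)) a₀ := by
  refine continuousAt_of_dominated (bound := fun z => unitKernel z * M)
    (Eventually.of_forall fun a => ?_) (Eventually.of_forall fun a => ae_of_all _ fun z => ?_)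
    (integrable_unitKernel.mul_const M) (ae_of_all _ fun z => ?_)
  · exact continuous_unitKernel.aestronglyMeasurable.smul
      ((hfm a).comp_measurable (by fun_prop)).aestronglyMeasurable
  · exact norm_unitKernel_smul_le (hM _ _) z
  · refine continuousAt_const.smul ?_
    have h : ContinuousAt (fun a => (a, X a - √(σ a) • z)) a₀ :=
      continuousAt_id.prodMk (hX.sub (hσ.sqrt.smul continuousAt_const))
    exact ContinuousAt.comp (f := fun a => (a, X a - √(σ a) • z)) (hf _) h

lemma continuous_heatMean {g : 𝔼 → F} (hg : Continuous g) {M : ℝ} (hM : ∀ x, ‖g x‖ ≤ M) :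
    Continuous fun q : ℝ × 𝔼 => heatMean q.1 g q.2 :=
  continuous_iff_continuousAt.2 fun _ =>
    continuousAt_heatMean (f := fun (_ : ℝ × 𝔼) => g)
      (fun _ => (hg.comp continuous_snd).continuousAt) continuousAt_fst continuousAt_snd
      (fun _ => hg.stronglyMeasurable) (fun _ => hM)

/-- On differentiable data with bounded derivative, the derivative may fall on the data. -/
lemma hasFDerivAt_heatMean_of_hasFDerivAt {g : 𝔼 → F} {g' : 𝔼 → 𝔼 →L[ℝ] F}
    (hg : StronglyMeasurable g) (hg' : StronglyMeasurable g') {M M' : ℝ} (hM : ∀ x, ‖g x‖ ≤ M)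
    (hM' : ∀ x, ‖g' x‖ ≤ M') (hd : ∀ x, HasFDerivAt g (g' x) x) (σ : ℝ) (x : 𝔼) :
    HasFDerivAt (heatMean σ g) (heatMean σ g' x) x := by
  refine hasFDerivAt_integral_of_dominated_of_fderiv_le (𝕜 := ℝ) (s := univ)
    (bound := fun z => unitKernel z * M')
    (F := fun x z => unitKernel z • g (x - √σ • z)) (F' := fun x z => unitKernel z •
      g' (x - √σ • z)) univ_mem (Eventually.of_forall fun x' => ?_) ?_ ?_
      (ae_of_all _ fun z x' _ => norm_unitKernel_smul_le (hM' _) z)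
      (integrable_unitKernel.mul_const M') (ae_of_all _ fun z x' _ => ?_)
  · exact continuous_unitKernel.aestronglyMeasurable.smul
      (hg.comp_measurable (by fun_prop)).aestronglyMeasurable
  · exact integrable_unitKernel_smul (hg.comp_measurable (by fun_prop)) fun z => hM (x - √σ • z)
  · exact continuous_unitKernel.aestronglyMeasurable.smul
      (hg'.comp_measurable (by fun_prop)).aestronglyMeasurable
  · exact ((hasFDerivAt_comp_sub (√σ • z)).2 (hd _)).const_smul (unitKernel z)

lemma integral_heatKernel_mul_heatKernel {a b : ℝ} (ha : 0 < a) (hb : 0 < b) (x y : 𝔼) :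
    ∫ z, heatKernel a (x - z) * heatKernel b (z - y) = heatKernel (a + b) (x - y) := by
  have h0 : ∀ w : 𝔼, heatKernel a (x - y - w) * heatKernel b w = heatKernel (a + b) (x - y) *
      ((4 * Real.pi * (a * b / (a + b))) ^ ((n : ℝ) / 2))⁻¹ *
        Real.exp (-((a + b) / (4 * a * b)) * ‖w - (b / (a + b)) • (x - y)‖ ^ 2) := by
    intro w
    generalize x - y = v
    unfold heatKernel
    have h1 : -‖v - w‖ ^ 2 / (4 * a) + -‖w‖ ^ 2 / (4 * b) = -‖v‖ ^ 2 / (4 * (a + b)) +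
        -((a + b) / (4 * a * b)) * ‖w - (b / (a + b)) • v‖ ^ 2 := by
      rw [norm_sub_sq_real, norm_sub_sq_real, inner_smul_right, norm_smul,
        Real.norm_of_nonneg (by positivity), real_inner_comm w v]
      field_simp
      ring
    have h2 : (4 * Real.pi * a) ^ ((n : ℝ) / 2) * (4 * Real.pi * b) ^ ((n : ℝ) / 2) =
        (4 * Real.pi * (a + b)) ^ ((n : ℝ) / 2) *
          (4 * Real.pi * (a * b / (a + b))) ^ ((n : ℝ) / 2) := by
      rw [← Real.mul_rpow (by positivity) (by positivity),
        ← Real.mul_rpow (by positivity) (by positivity)]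
      congr 1
      field_simp
    calc _ = 1 / ((4 * Real.pi * a) ^ ((n : ℝ) / 2) * (4 * Real.pi * b) ^ ((n : ℝ) / 2)) *
          Real.exp (-‖v - w‖ ^ 2 / (4 * a) + -‖w‖ ^ 2 / (4 * b)) := by
            rw [Real.exp_add]; field_simp
      _ = _ := by rw [h1, h2, Real.exp_add]; field_simp
  have h1 := integral_add_right_eq_self
    (fun z => heatKernel a (x - z) * heatKernel b (z - y)) y (μ := volume)
  rw [← h1]
  have e : ∀ w, x - (w + y) = x - y - w := fun w => by abel
  simp_rw [add_sub_cancel_right, e, h0]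
  rw [integral_const_mul, integral_sub_right_eq_self
    (fun w : 𝔼 => Real.exp (-((a + b) / (4 * a * b)) * ‖w‖ ^ 2)),
    GaussianFourier.integral_rexp_neg_mul_sq_norm (by positivity), finrank_euclideanSpace,
    Fintype.card_fin, show Real.pi / ((a + b) / (4 * a * b)) = 4 * Real.pi * (a * b / (a + b)) by
      field_simp, mul_assoc, inv_mul_cancel₀ (by positivity), mul_one]

lemma integrable_heatKernel_sub {σ : ℝ} (hσ : 0 < σ) (x : 𝔼) :
    Integrable fun y => heatKernel σ (x - y) := by
  obtain ⟨B, hB, hBk⟩ := exists_integrable_heatKernel_bound hσ x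
  refine hB.mono' (measurable_heatKernel_sub σ x).aestronglyMeasurable (ae_of_all _ fun y => ?_)
  rw [Real.norm_of_nonneg (heatKernel_nonneg hσ.le _)]
  exact (heatKernel_le_of_bound hσ (hBk σ ⟨by linarith, by linarith⟩ x
    (Metric.mem_ball_self one_pos) y)).1

/-- The semigroup property. -/
lemma heatMean_heatMean [CompleteSpace F] {g : 𝔼 → F} (hg : StronglyMeasurable g) {M : ℝ}
    (hM : ∀ x, ‖g x‖ ≤ M) {a b : ℝ} (ha : 0 ≤ a) (hb : 0 ≤ b) :
    heatMean a (heatMean b g) = heatMean (a + b) g := by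
  rcases ha.eq_or_lt with rfl | ha
  · rw [heatMean_zero, zero_add]
  rcases hb.eq_or_lt with rfl | hb
  · rw [heatMean_zero, add_zero]
  ext x
  have hm : StronglyMeasurable fun q : 𝔼 × 𝔼 =>
      heatKernel a (x - q.1) • heatKernel b (q.1 - q.2) • g q.2 := by
    have h1 : Measurable fun q : 𝔼 × 𝔼 => heatKernel a (x - q.1) := by
      unfold heatKernel; fun_prop
    have h2 : Measurable fun q : 𝔼 × 𝔼 => heatKernel b (q.1 - q.2) := by
      unfold heatKernel; fun_prop
    exact h1.stronglyMeasurable.smul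
      (h2.stronglyMeasurable.smul (hg.comp_measurable measurable_snd))
  have hint : Integrable (Function.uncurry fun z y : 𝔼 =>
      heatKernel a (x - z) • heatKernel b (z - y) • g y) (volume.prod volume) := by
    have hin : ∀ z : 𝔼, Integrable fun y => heatKernel b (z - y) • g y := fun z =>
      ((integrable_heatKernel_sub hb z).mul_const M).mono'
        ((measurable_heatKernel_sub b z).stronglyMeasurable.smul hg).aestronglyMeasurable
        (ae_of_all _ fun y => by
          rw [norm_smul, Real.norm_of_nonneg (heatKernel_nonneg hb.le _)]
          exact mul_le_mul_of_nonneg_left (hM y) (heatKernel_nonneg hb.le _))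
    refine (integrable_prod_iff hm.aestronglyMeasurable).2
      ⟨ae_of_all _ fun z => (hin z).smul (heatKernel a (x - z)), ?_⟩
    refine ((integrable_heatKernel_sub ha x).mul_const M).mono'
      hm.norm.integral_prod_right'.aestronglyMeasurable (ae_of_all _ fun z => ?_)
    have hk := heatKernel_nonneg ha.le (x - z)
    rw [Real.norm_of_nonneg (integral_nonneg fun _ => norm_nonneg _)]
    simp only [norm_smul _ (_ • _), Real.norm_of_nonneg hk]
    rw [integral_const_mul]
    refine mul_le_mul_of_nonneg_left ?_ hk
    have h1 := norm_heatMean_le (g := fun y => ‖g y‖) (M := M) (by simpa using hM) b z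
    rw [heatMean_eq_integral_heatKernel hb] at h1
    refine le_trans (le_of_eq ?_) ((le_abs_self _).trans h1)
    refine integral_congr_ae (ae_of_all _ fun y => ?_)
    simp [norm_smul, abs_of_nonneg (heatKernel_nonneg hb.le (z - y))]
  rw [heatMean_eq_integral_heatKernel ha, heatMean_eq_integral_heatKernel (add_pos ha hb)]
  simp_rw [heatMean_eq_integral_heatKernel hb, ← integral_smul]
  rw [integral_integral_swap hint]
  refine integral_congr_ae (ae_of_all _ fun y => ?_)
  simp only [smul_smul]
  rw [integral_smul_const, integral_heatKernel_mul_heatKernel ha hb]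

lemma integrable_unitKernel_mul_of_le_sq {f : 𝔼 → ℝ} (hf : Continuous f) {C : ℝ}
    (hC : ∀ z, ‖f z‖ ≤ C * (1 + ‖z‖ ^ 2)) : Integrable fun z => unitKernel z * f z := by
  refine (integrable_one_add_sq_mul_unitKernel.const_mul C).mono'
    (continuous_unitKernel.mul hf).aestronglyMeasurable (ae_of_all _ fun z => ?_)
  rw [norm_mul, Real.norm_of_nonneg (unitKernel_pos z).le]
  nlinarith [mul_le_mul_of_nonneg_left (hC z) (unitKernel_pos z).le]

/-- Second moments of the unit kernel, by integration by parts. -/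
lemma integral_unitKernel_mul_inner_mul (ℓ : 𝔼 →L[ℝ] ℝ) (v : 𝔼) :
    ∫ z : 𝔼, unitKernel z * (⟪z, v⟫_ℝ * ℓ z) = 2 * ℓ v := by
  have hγ : ∀ z : 𝔼, HasLineDerivAt ℝ unitKernel (-(1 / 2) * (unitKernel z * ⟪z, v⟫_ℝ)) z v := by
    intro z
    have h := (hasFDerivAt_heatKernel (σ := 1) z).hasLineDerivAt v
    convert! h using 1
    simp [unitKernel]; ring
  have hℓ : ∀ z : 𝔼, HasLineDerivAt ℝ ℓ (ℓ v) z v := fun z => ℓ.hasFDerivAt.hasLineDerivAt v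
  have hb1 : ∀ z : 𝔼, ‖ℓ z‖ ≤ ‖ℓ‖ * (1 + ‖z‖ ^ 2) := fun z =>
    (ℓ.le_opNorm z).trans (by gcongr; nlinarith [sq_nonneg (‖z‖ - 1), norm_nonneg z])
  have hb2 : ∀ z : 𝔼, ‖⟪z, v⟫_ℝ * ℓ z‖ ≤ ‖v‖ * ‖ℓ‖ * (1 + ‖z‖ ^ 2) := fun z => by
    rw [norm_mul]
    calc ‖⟪z, v⟫_ℝ‖ * ‖ℓ z‖ ≤ (‖z‖ * ‖v‖) * (‖ℓ‖ * ‖z‖) := by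
          gcongr
          · exact norm_inner_le_norm z v
          · exact ℓ.le_opNorm z
      _ = ‖v‖ * ‖ℓ‖ * ‖z‖ ^ 2 := by ring
      _ ≤ _ := by gcongr; linarith
  have i2 := integrable_unitKernel_mul_of_le_sq (f := fun z => ⟪z, v⟫_ℝ * ℓ z) (by fun_prop) hb2
  have h := integral_bilinear_hasLineDerivAt_right_eq_neg_left_of_integrable (μ := volume)
    (B := ContinuousLinearMap.mul ℝ ℝ) (f := unitKernel)
    (f' := fun z => -(1 / 2) * (unitKernel z * ⟪z, v⟫_ℝ)) (g := ℓ) (g' := fun _ => ℓ v) (v := v)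
    ((i2.const_mul (-(1 / 2))).congr (ae_of_all _ fun z => by simp; ring))
    (integrable_unitKernel.mul_const _) (integrable_unitKernel_mul_of_le_sq ℓ.continuous hb1)
    (fun z _ => hγ z) (fun z _ => hℓ z)
  simp only [ContinuousLinearMap.mul_apply'] at h
  rw [integral_mul_const, integral_unitKernel, one_mul] at h
  have e : ∀ z : 𝔼, -(1 / 2) * (unitKernel z * ⟪z, v⟫_ℝ) * ℓ z =
      -(1 / 2) * (unitKernel z * (⟪z, v⟫_ℝ * ℓ z)) := fun z => by ring
  simp_rw [e] at h
  rw [integral_const_mul] at h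
  linarith

lemma integral_unitKernel_mul_quadratic (B : 𝔼 →L[ℝ] 𝔼 →L[ℝ] ℝ) :
    ∫ z : 𝔼, unitKernel z * B z z =
      2 * ∑ i, B (EuclideanSpace.basisFun (Fin n) ℝ i) (EuclideanSpace.basisFun (Fin n) ℝ i) := by
  set e := EuclideanSpace.basisFun (Fin n) ℝ
  have h1 : ∀ z : 𝔼, unitKernel z * B z z = ∑ i, unitKernel z * (⟪z, e i⟫_ℝ * B (e i) z) := by
    intro z
    rw [← Finset.mul_sum]
    congr 1
    calc B z z = B (∑ i, ⟪e i, z⟫_ℝ • e i) z := by rw [e.sum_repr' z]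
      _ = ∑ i, ⟪z, e i⟫_ℝ * B (e i) z := by
        simp only [map_sum, map_smul, sum_apply, smul_apply, smul_eq_mul, real_inner_comm z]
  simp_rw [h1]
  rw [integral_finsetSum, Finset.mul_sum]
  · exact Finset.sum_congr rfl fun i _ => integral_unitKernel_mul_inner_mul (B (e i)) (e i)
  · intro i _
    refine integrable_unitKernel_mul_of_le_sq (C := ‖B (e i)‖) (by fun_prop) fun z => ?_
    rw [norm_mul]
    have h2 : ‖⟪z, e i⟫_ℝ‖ ≤ ‖z‖ := by
      simpa using norm_inner_le_norm (𝕜 := ℝ) z (e i)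
    calc ‖⟪z, e i⟫_ℝ‖ * ‖B (e i) z‖ ≤ ‖z‖ * (‖B (e i)‖ * ‖z‖) := by
          gcongr; exact (B (e i)).le_opNorm z
      _ = ‖B (e i)‖ * ‖z‖ ^ 2 := by ring
      _ ≤ _ := by gcongr; linarith

end MeanOrder

/-! ### Generator and positivity -/

lemma heatMean_eq_half_integral_symm {g : 𝔼 → ℝ} (hg : StronglyMeasurable g) {M : ℝ}
    (hM : ∀ x, ‖g x‖ ≤ M) (σ : ℝ) (x : 𝔼) :
    heatMean σ g x = 1 / 2 * ∫ z, unitKernel z * (g (x + √σ • z) + g (x - √σ • z)) := by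
  have h1 : heatMean σ g x = ∫ z, unitKernel z * g (x + √σ • z) := by
    rw [heatMean, ← integral_neg_eq_self]
    refine integral_congr_ae (ae_of_all _ fun z => ?_)
    simp [unitKernel_neg]
  have i1 : Integrable fun z => unitKernel z * g (x + √σ • z) :=
    integrable_unitKernel_smul (g := fun z => g (x + √σ • z))
      (hg.comp_measurable (by fun_prop)) fun z => hM _
  have i2 : Integrable fun z => unitKernel z * g (x - √σ • z) :=
    integrable_unitKernel_smul (g := fun z => g (x - √σ • z))
      (hg.comp_measurable (by fun_prop)) fun z => hM _
  simp_rw [mul_add]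
  rw [integral_add i1 i2, ← h1]
  have : ∫ z, unitKernel z * g (x - √σ • z) = heatMean σ g x := rfl
  rw [this]; ring

section SecondDifference

variable {g : EuclideanSpace ℝ (Fin n) → ℝ}
  {g' : EuclideanSpace ℝ (Fin n) → EuclideanSpace ℝ (Fin n) →L[ℝ] ℝ}
  {g'' : EuclideanSpace ℝ (Fin n) →
    EuclideanSpace ℝ (Fin n) →L[ℝ] EuclideanSpace ℝ (Fin n) →L[ℝ] ℝ}

lemma hasDerivAt_second_difference (hg : ∀ x, HasFDerivAt g (g' x) x) (x z : 𝔼) (r : ℝ) :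
    HasDerivAt (fun r : ℝ => g (x + r • z) + g (x - r • z) - 2 * g x)
      (g' (x + r • z) z - g' (x - r • z) z) r := by
  have hz : HasDerivAt (fun r : ℝ => r • z) z r := by
    simpa using (hasDerivAt_id r).smul_const z
  have h1 := (hg (x + r • z)).comp_hasDerivAt r (hz.const_add x)
  have h2 := (hg (x - r • z)).comp_hasDerivAt r (hz.const_sub x)
  convert! (h1.add h2).sub_const (2 * g x) using 1
  simp [sub_eq_add_neg]

lemma norm_deriv_second_difference_le (hg' : ∀ x, HasFDerivAt g' (g'' x) x) {C : ℝ}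
    (hC : ∀ x, ‖g'' x‖ ≤ C) (x z : 𝔼) {r : ℝ} (hr : 0 ≤ r) :
    ‖g' (x + r • z) z - g' (x - r • z) z‖ ≤ 2 * C * ‖z‖ ^ 2 * r := by
  have h1 : ‖g' (x + r • z) - g' (x - r • z)‖ ≤ C * ‖(x + r • z) - (x - r • z)‖ :=
    convex_univ.norm_image_sub_le_of_norm_hasFDerivWithin_le
      (fun y _ => (hg' y).hasFDerivWithinAt) (fun y _ => hC y) trivial trivial
  have h2 : (x + r • z) - (x - r • z) = (2 * r) • z := by module
  rw [h2, norm_smul, Real.norm_of_nonneg (by positivity)] at h1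
  calc ‖g' (x + r • z) z - g' (x - r • z) z‖ = ‖(g' (x + r • z) - g' (x - r • z)) z‖ := by simp
    _ ≤ ‖g' (x + r • z) - g' (x - r • z)‖ * ‖z‖ := ContinuousLinearMap.le_opNorm _ _
    _ ≤ C * (2 * r * ‖z‖) * ‖z‖ := by gcongr
    _ = _ := by ring

lemma norm_second_difference_le (hg : ∀ x, HasFDerivAt g (g' x) x)
    (hg' : ∀ x, HasFDerivAt g' (g'' x) x) {C : ℝ} (hC : ∀ x, ‖g'' x‖ ≤ C) (x z : 𝔼) {r : ℝ}
    (hr : 0 ≤ r) : ‖g (x + r • z) + g (x - r • z) - 2 * g x‖ ≤ 2 * C * ‖z‖ ^ 2 * r ^ 2 := by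
  have hC0 : 0 ≤ C := (g'' x).opNorm_nonneg.trans (hC x)
  have h := (convex_Icc (0 : ℝ) r).norm_image_sub_le_of_norm_hasDerivWithin_le
    (f := fun r : ℝ => g (x + r • z) + g (x - r • z) - 2 * g x) (C := 2 * C * ‖z‖ ^ 2 * r)
    (fun s _ => (hasDerivAt_second_difference hg x z s).hasDerivWithinAt)
    (fun s hs => (norm_deriv_second_difference_le hg' hC x z hs.1).trans (by gcongr; exact hs.2))
    (left_mem_Icc.2 hr) (right_mem_Icc.2 hr)
  have e : g (x + (0 : ℝ) • z) + g (x - (0 : ℝ) • z) - 2 * g x = 0 := by simp; ring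
  simp only [e, sub_zero, Real.norm_of_nonneg hr] at h
  calc _ ≤ _ := h
    _ = _ := by ring

lemma tendsto_second_difference_div (hg : ∀ x, HasFDerivAt g (g' x) x)
    (hg' : ∀ x, HasFDerivAt g' (g'' x) x) (x z : 𝔼) :
    Tendsto (fun r : ℝ => (g (x + r • z) + g (x - r • z) - 2 * g x) / r ^ 2) (𝓝[>] 0)
      (𝓝 (g'' x z z)) := by
  have hz : HasDerivAt (fun r : ℝ => r • z) z 0 := by
    simpa using (hasDerivAt_id (0 : ℝ)).smul_const z
  have hd : HasDerivAt (fun r : ℝ => g' (x + r • z) z - g' (x - r • z) z) (2 * g'' x z z) 0 := by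
    have e1 : x = x + (0 : ℝ) • z := by simp
    have e2 : x = x - (0 : ℝ) • z := by simp
    have h1 := HasFDerivAt.comp_hasDerivAt (0 : ℝ) (e1 ▸ hg' x) (hz.const_add x)
    have h2 := HasFDerivAt.comp_hasDerivAt (0 : ℝ) (e2 ▸ hg' x) (hz.const_sub x)
    convert! (h1.clm_apply (hasDerivAt_const (0 : ℝ) z)).sub
      (h2.clm_apply (hasDerivAt_const (0 : ℝ) z)) using 1
    simp; ring
  refine HasDerivAt.lhopital_zero_nhdsGT (f' := fun r => g' (x + r • z) z - g' (x - r • z) z)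
    (g' := fun r => 2 * r) ?_ ?_ ?_ ?_ ?_ ?_
  · exact Eventually.of_forall fun r => hasDerivAt_second_difference hg x z r
  · exact Eventually.of_forall fun r => by simpa using hasDerivAt_pow 2 r
  · filter_upwards [self_mem_nhdsWithin] with r hr
    have : (0 : ℝ) < r := hr
    positivity
  · have h := (hasDerivAt_second_difference hg x z 0).continuousAt.tendsto
    have e : g (x + (0 : ℝ) • z) + g (x - (0 : ℝ) • z) - 2 * g x = 0 := by simp; ring
    rw [e] at h
    exact h.mono_left nhdsWithin_le_nhds
  · have h : Tendsto (fun r : ℝ => r ^ 2) (𝓝 0) (𝓝 (0 ^ 2)) := (continuous_pow 2).tendsto 0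
    simp only [ne_eq, OfNat.ofNat_ne_zero, not_false_eq_true, zero_pow] at h
    exact h.mono_left nhdsWithin_le_nhds
  · have h := hd.tendsto_slope_zero_right
    simp only [zero_add, zero_smul, add_zero, sub_zero, sub_self, smul_eq_mul] at h
    have h2 := h.const_mul (1 / 2)
    rw [← mul_assoc, one_div, inv_mul_cancel₀ two_ne_zero, one_mul] at h2
    refine h2.congr fun r => ?_
    rw [div_eq_mul_inv, mul_inv]; ring

/-- The generator of the heat semigroup is the Laplacian. -/
lemma tendsto_heatMean_sub_div (hg : ∀ x, HasFDerivAt g (g' x) x)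
    (hg' : ∀ x, HasFDerivAt g' (g'' x) x) {M C : ℝ} (hM : ∀ x, ‖g x‖ ≤ M) (hC : ∀ x, ‖g'' x‖ ≤ C)
    (x : 𝔼) :
    Tendsto (fun σ : ℝ => σ⁻¹ * (heatMean σ g x - g x)) (𝓝[>] 0)
      (𝓝 (∑ i, g'' x (EuclideanSpace.basisFun (Fin n) ℝ i)
        (EuclideanSpace.basisFun (Fin n) ℝ i))) := by
  have hgc : Continuous g := continuous_iff_continuousAt.2 fun x => (hg x).continuousAt
  have e1 : ∀ᶠ σ : ℝ in 𝓝[>] 0, ∫ z, unitKernel z *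
      ((g (x + √σ • z) + g (x - √σ • z) - 2 * g x) / √σ ^ 2) =
        2 * (σ⁻¹ * (heatMean σ g x - g x)) := by
    filter_upwards [self_mem_nhdsWithin] with σ hσ
    have hσ' : (0 : ℝ) < σ := hσ
    have i1 : Integrable fun z => unitKernel z * (g (x + √σ • z) + g (x - √σ • z)) :=
      integrable_unitKernel_smul (g := fun z => g (x + √σ • z) + g (x - √σ • z)) (M := M + M)
        (by fun_prop : Continuous _).stronglyMeasurable
        fun z => (norm_add_le _ _).trans (add_le_add (hM _) (hM _))
    rw [Real.sq_sqrt hσ'.le]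
    have e : ∀ z, unitKernel z * ((g (x + √σ • z) + g (x - √σ • z) - 2 * g x) / σ) =
        σ⁻¹ * (unitKernel z * (g (x + √σ • z) + g (x - √σ • z)) - unitKernel z * (2 * g x)) :=
      fun z => by rw [div_eq_mul_inv]; ring
    simp_rw [e]
    rw [integral_const_mul, integral_sub i1 (integrable_unitKernel.mul_const _), integral_mul_const,
      integral_unitKernel, heatMean_eq_half_integral_symm hgc.stronglyMeasurable hM]
    ring
  have hsq : Tendsto (fun σ : ℝ => √σ) (𝓝[>] 0) (𝓝[>] 0) := by
    refine tendsto_nhdsWithin_iff.2 ⟨?_, ?_⟩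
    · have := Real.continuous_sqrt.tendsto 0
      rw [Real.sqrt_zero] at this
      exact this.mono_left nhdsWithin_le_nhds
    · filter_upwards [self_mem_nhdsWithin] with σ hσ
      exact Real.sqrt_pos.2 hσ
  have e2 : Tendsto (fun σ : ℝ => ∫ z, unitKernel z *
      ((g (x + √σ • z) + g (x - √σ • z) - 2 * g x) / √σ ^ 2)) (𝓝[>] 0)
      (𝓝 (∫ z, unitKernel z * g'' x z z)) := by
    refine tendsto_integral_filter_of_dominated_convergence
      (fun z => 2 * C * (‖z‖ ^ 2 * unitKernel z)) ?_ ?_ (integrable_sq_mul_unitKernel.const_mul _)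
      (ae_of_all _ fun z => ((tendsto_second_difference_div hg hg' x z).comp hsq).const_mul _)
    · exact Eventually.of_forall fun σ => by
        have := continuous_unitKernel (n := n)
        exact (by fun_prop : Continuous fun z => unitKernel z *
          ((g (x + √σ • z) + g (x - √σ • z) - 2 * g x) / √σ ^ 2)).aestronglyMeasurable
    · filter_upwards [self_mem_nhdsWithin] with σ hσ
      refine ae_of_all _ fun z => ?_
      have hs : 0 < √σ := Real.sqrt_pos.2 hσ
      have := norm_second_difference_le hg hg' hC x z hs.le
      have hk := unitKernel_pos z
      rw [norm_mul, norm_div, Real.norm_of_nonneg hk.le, Real.norm_of_nonneg (sq_nonneg √σ)]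
      calc unitKernel z * (‖g (x + √σ • z) + g (x - √σ • z) - 2 * g x‖ / √σ ^ 2)
          ≤ unitKernel z * (2 * C * ‖z‖ ^ 2 * √σ ^ 2 / √σ ^ 2) := by gcongr
        _ = _ := by field_simp
  rw [integral_unitKernel_mul_quadratic] at e2
  have := (e2.congr' e1).const_mul (1 / 2)
  rw [← mul_assoc, one_div, inv_mul_cancel₀ two_ne_zero, one_mul] at this
  exact this.congr fun σ => by ring

end SecondDifference

/-- Data bounded below by `m > 0` off a ball become uniformly bounded below at positive times,
because at least one of `x ± √σ z` lies off the ball as soon as `√σ ‖z‖` is large. -/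
lemma exists_pos_le_heatMean (hn : 1 ≤ n) {g : 𝔼 → ℝ} (hg : StronglyMeasurable g) {M : ℝ}
    (hM : ∀ x, ‖g x‖ ≤ M) (h0 : ∀ x, 0 ≤ g x) {m R : ℝ} (hm : 0 < m) (hR : ∀ x, R ≤ ‖x‖ → m ≤ g x)
    {σ₀ : ℝ} (hσ₀ : 0 < σ₀) : ∃ δ > 0, ∀ σ, σ₀ ≤ σ → ∀ x, δ ≤ heatMean σ g x := by
  have hs₀ : 0 < √σ₀ := Real.sqrt_pos.2 hσ₀
  set S : Set 𝔼 := {z | R / √σ₀ < ‖z‖}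
  have hSo : IsOpen S := isOpen_lt continuous_const continuous_norm
  have hSne : S.Nonempty := by
    have : Nonempty (Fin n) := ⟨⟨0, hn⟩⟩
    obtain ⟨z, hz⟩ := exists_norm_eq 𝔼 (c := |R / √σ₀| + 1) (by positivity)
    exact ⟨z, by simp only [S, mem_ofPred_eq, hz]; linarith [le_abs_self (R / √σ₀)]⟩
  have hI : 0 < ∫ z in S, unitKernel z := by
    rw [setIntegral_pos_iff_support_of_nonneg_ae (ae_of_all _ fun z => (unitKernel_pos z).le)
      integrable_unitKernel.integrableOn]
    have : Function.support (unitKernel : 𝔼 → ℝ) = univ :=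
      eq_univ_of_forall fun z => (unitKernel_pos z).ne'
    rw [this, univ_inter]
    exact hSo.measure_pos volume hSne
  refine ⟨1 / 2 * (m * ∫ z in S, unitKernel z), by positivity, fun σ hσ x => ?_⟩
  rw [heatMean_eq_half_integral_symm hg hM, ← integral_const_mul,
    ← integral_indicator hSo.measurableSet]
  refine mul_le_mul_of_nonneg_left ?_ (by norm_num)
  refine integral_mono ((integrable_unitKernel.const_mul m).indicator hSo.measurableSet)
    (integrable_unitKernel_smul (g := fun z => g (x + √σ • z) + g (x - √σ • z)) (M := M + M)
      ((hg.comp_measurable (by fun_prop)).add (hg.comp_measurable (by fun_prop)))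
      fun z => (norm_add_le _ _).trans (add_le_add (hM _) (hM _))) fun z => ?_
  have hk := unitKernel_pos z
  by_cases hz : z ∈ S
  · rw [indicator_of_mem hz, mul_comm m]
    refine mul_le_mul_of_nonneg_left ?_ hk.le
    have h1 : R ≤ √σ * ‖z‖ := by
      have h2 : R ≤ √σ₀ * ‖z‖ := by
        have : R / √σ₀ < ‖z‖ := hz
        rw [div_lt_iff₀ hs₀] at this
        linarith
      exact h2.trans (by gcongr)
    rcases le_or_gt R ‖x + √σ • z‖ with h2 | h2
    · linarith [hR _ h2, h0 (x - √σ • z)]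
    · have h3 : R ≤ ‖x - √σ • z‖ := by
        have h4 : (2 : ℝ) • (√σ • z) = (x + √σ • z) - (x - √σ • z) := by module
        have h5 := norm_sub_le (x + √σ • z) (x - √σ • z)
        rw [← h4, norm_smul, norm_smul, Real.norm_of_nonneg (Real.sqrt_nonneg σ)] at h5
        norm_num at h5
        linarith
      linarith [hR _ h3, h0 (x + √σ • z)]
  · rw [indicator_of_notMem hz]
    exact mul_nonneg hk.le (add_nonneg (h0 _) (h0 _))

/-! ### Duhamel integrals -/

section DuhamelIntegral

/-- The singularity `1 / √r` of the gradient bounds is integrable. -/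
lemma intervalIntegrable_const_div_sqrt (C a b : ℝ) :
    IntervalIntegrable (fun r => C / √r) volume a b := by
  have h := (intervalIntegral.intervalIntegrable_rpow' (r := -(1 / 2)) (by norm_num)
    (a := a) (b := b)).const_mul C
  have e : (fun r : ℝ => C * r ^ (-(1 / 2) : ℝ)) = fun r => C / √r := by
    ext r
    rcases le_or_gt 0 r with hr | hr
    · rw [Real.rpow_neg hr, ← Real.sqrt_eq_rpow, div_eq_mul_inv]
    · have : (-(1 / 2) * Real.pi) = -(Real.pi / 2) := by ring
      rw [Real.rpow_def_of_neg hr, Real.sqrt_eq_zero_of_nonpos hr.le, this, Real.cos_neg,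
        Real.cos_pi_div_two]
      simp
  rwa [e] at h

lemma stronglyMeasurable_slice {G : Type*} [TopologicalSpace G] {f : ℝ → 𝔼 → G}
    (hf : StronglyMeasurable (Function.uncurry f)) (s : ℝ) :
    StronglyMeasurable (f s) :=
  hf.comp_measurable measurable_prodMk_left

lemma intervalIntegrable_of_singular_bound {G : Type*} [NormedAddCommGroup G] {τ : ℝ} {β : ℝ → ℝ}
    (hβi : ∀ a b, IntervalIntegrable β volume a b)
    {j : ℝ → G} {t : ℝ} (hjm : StronglyMeasurable j)
    (hjb : ∀ s, τ ≤ s → s < t → ‖j s‖ ≤ β (t - s)) {a b : ℝ} (ha : τ ≤ a) (hab : a ≤ b)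
    (hb : b ≤ t) : IntervalIntegrable j volume a b := by
  have h1 := (hβi (t - a) (t - b)).comp_sub_left t
  simp only [sub_sub_cancel] at h1
  refine h1.mono_fun' hjm.aestronglyMeasurable ?_
  rw [uIoc_of_le hab]
  filter_upwards [ae_restrict_mem measurableSet_Ioc, ae_restrict_of_ae (Measure.ae_ne volume t)]
    with s hs hst
  exact hjb s (ha.trans hs.1.le) (lt_of_le_of_ne (hs.2.trans hb) hst)

section Singular

variable {G : Type*} [NormedAddCommGroup G] [NormedSpace ℝ G]
  {J : ℝ × EuclideanSpace ℝ (Fin n) → ℝ → G} {τ : ℝ} {β : ℝ → ℝ}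

/-- Continuity of `q ↦ ∫ s in τ..t, J q s` with `q = (t, x)` when the integrand is singular at
the moving endpoint `s = t`: cutting off `s ∈ (t - ε, t)` changes the integral uniformly little. -/
lemma continuousOn_integral_of_singular_bound (hβa : AntitoneOn β (Ioi 0))
    (hβ0 : ∀ r, 0 < r → 0 ≤ β r) (hβi : ∀ a b, IntervalIntegrable β volume a b)
    (hJm : ∀ q, StronglyMeasurable (J q))
    (hJc : ∀ s, τ ≤ s → ContinuousOn (fun q => J q s) (Ioi s ×ˢ univ))
    (hJb : ∀ q s, τ ≤ s → s < q.1 → ‖J q s‖ ≤ β (q.1 - s)) :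
    ContinuousOn (fun q => ∫ s in τ..q.1, J q s) (Ici τ ×ˢ univ) := by
  refine continuousOn_of_uniform_approx_of_continuousOn fun u hu => ?_
  obtain ⟨δ, hδ, hδu⟩ := Metric.mem_uniformity_dist.1 hu
  obtain ⟨ε, hε, hεδ⟩ : ∃ ε > 0, ∫ r in (0 : ℝ)..ε, β r < δ := by
    have h := (intervalIntegral.continuous_primitive hβi 0).tendsto 0
    rw [intervalIntegral.integral_same] at h
    have h2 := (h.eventually (gt_mem_nhds hδ)).filter_mono (nhdsWithin_le_nhds (s := Ioi 0))
    obtain ⟨ε, h3, h4⟩ := (h2.and self_mem_nhdsWithin).exists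
    exact ⟨ε, h4, h3⟩
  refine ⟨fun q => ∫ s, (Ioc τ (q.1 - ε)).indicator (J q) s, ?_, fun q hq => hδu ?_⟩
  · intro q₀ hq₀
    refine continuousWithinAt_of_dominated
      (bound := (Ioc τ (q₀.1 + 1)).indicator fun _ => β ε) ?_ ?_ ?_ ?_
    · exact Eventually.of_forall fun q =>
        ((hJm q).indicator measurableSet_Ioc).aestronglyMeasurable
    · have : ∀ᶠ q : ℝ × 𝔼 in 𝓝[Ici τ ×ˢ univ] q₀, q.1 < q₀.1 + 1 :=
        nhdsWithin_le_nhds ((continuous_fst.tendsto q₀).eventually (gt_mem_nhds (by linarith)))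
      filter_upwards [this] with q hq
      refine ae_of_all _ fun s => ?_
      by_cases hs : s ∈ Ioc τ (q.1 - ε)
      · have hs' : s ∈ Ioc τ (q₀.1 + 1) := ⟨hs.1, by linarith [hs.2]⟩
        rw [indicator_of_mem hs, indicator_of_mem hs']
        exact (hJb q s hs.1.le (by linarith [hs.2])).trans
          (hβa hε (by simp only [mem_Ioi]; linarith [hs.2]) (by linarith [hs.2]))
      · rw [indicator_of_notMem hs, norm_zero]
        exact indicator_nonneg (fun _ _ => hβ0 ε hε) s
    · exact (integrable_indicator_iff measurableSet_Ioc).2 (integrableOn_const (by simp))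
    · filter_upwards [Measure.ae_ne volume (q₀.1 - ε)] with s hs
      by_cases hsτ : s ∈ Ioi τ; swap
      · have : ∀ q : ℝ × 𝔼, (Ioc τ (q.1 - ε)).indicator (J q) s = 0 := fun q =>
          indicator_of_notMem (fun h => hsτ h.1) _
        simp_rw [this]
        exact continuousWithinAt_const
      apply ContinuousAt.continuousWithinAt
      have hcont : ContinuousAt (fun q : ℝ × 𝔼 => q.1 - ε) q₀ := by fun_prop
      rcases lt_or_gt_of_ne hs with h | h
      · have h1 : (fun q => J q s) =ᶠ[𝓝 q₀]
            fun q : ℝ × 𝔼 => (Ioc τ (q.1 - ε)).indicator (J q) s := by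
          filter_upwards [hcont.eventually (lt_mem_nhds h)] with q hq
          rw [indicator_of_mem (show s ∈ Ioc τ (q.1 - ε) from ⟨hsτ, hq.le⟩)]
        refine ContinuousAt.congr ?_ h1
        exact (hJc s (le_of_lt hsτ)).continuousAt ((isOpen_Ioi.prod isOpen_univ).mem_nhds
          ⟨by simp only [mem_Ioi]; linarith, trivial⟩)
      · have h1 : (fun _ => 0) =ᶠ[𝓝 q₀] fun q : ℝ × 𝔼 => (Ioc τ (q.1 - ε)).indicator (J q) s := by
          filter_upwards [hcont.eventually (gt_mem_nhds h)] with q hq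
          rw [indicator_of_notMem fun h => absurd h.2 (not_le.2 hq)]
        exact continuousAt_const.congr h1
  · have hτ : τ ≤ q.1 := hq.1
    set a := max τ (q.1 - ε)
    have ha : τ ≤ a := le_max_left _ _
    have haq : a ≤ q.1 := max_le hτ (by linarith)
    have e : ∫ s, (Ioc τ (q.1 - ε)).indicator (J q) s = ∫ s in τ..a, J q s := by
      rw [integral_indicator measurableSet_Ioc, intervalIntegral.integral_of_le ha]
      congr 2
      rcases le_total τ (q.1 - ε) with h | h
      · simp only [a, max_eq_right h]
      · simp only [a, max_eq_left h, Ioc_self, Ioc_eq_empty (not_lt.2 h)]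
    simp only [e]
    rw [dist_eq_norm, intervalIntegral.integral_interval_sub_left
      (intervalIntegrable_of_singular_bound hβi (hJm q) (hJb q) le_rfl hτ le_rfl)
      (intervalIntegrable_of_singular_bound hβi (hJm q) (hJb q) le_rfl ha haq)]
    have hβq : IntervalIntegrable (fun s => β (q.1 - s)) volume a q.1 := by
      simpa using (hβi (q.1 - a) (q.1 - q.1)).comp_sub_left q.1
    refine (intervalIntegral.norm_integral_le_of_norm_le haq ?_ hβq).trans_lt ?_
    · filter_upwards [Measure.ae_ne volume q.1] with s hs1 hs2
      exact hJb q s (ha.trans hs2.1.le) (lt_of_le_of_ne hs2.2 hs1)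
    · rw [intervalIntegral.integral_comp_sub_left (fun r => β r), sub_self]
      refine lt_of_le_of_lt ?_ hεδ
      have h1 : q.1 - a ≤ ε := by linarith [le_max_right τ (q.1 - ε)]
      have h2 := intervalIntegral.integral_add_adjacent_intervals (hβi 0 (q.1 - a))
        (hβi (q.1 - a) ε)
      have h3 : 0 ≤ ∫ r in (q.1 - a)..ε, β r := by
        rw [intervalIntegral.integral_of_le h1]
        exact setIntegral_nonneg measurableSet_Ioc fun r hr =>
          hβ0 r (lt_of_le_of_lt (sub_nonneg.2 haq) hr.1)
      linarith

end Singular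

variable {F : Type*} [NormedAddCommGroup F] [NormedSpace ℝ F]

/-- The Duhamel integral `∫_τ^t T_{K(t) - K(s)} f(s) ds`, where `K` is the time change of the
equation, so that `U(s,t) = T_{K(t) - K(s)}`. -/
def duhamel (K : ℝ → ℝ) (τ : ℝ) (f : ℝ → EuclideanSpace ℝ (Fin n) → F) (t : ℝ)
    (x : EuclideanSpace ℝ (Fin n)) : F :=
  ∫ s in τ..t, heatMean (K t - K s) (f s) x

/-- The spatial derivative of `duhamel`, with the derivative falling on the kernel. -/
def duhamelGrad (K : ℝ → ℝ) (τ : ℝ) (f : ℝ → EuclideanSpace ℝ (Fin n) → F) (t : ℝ)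
    (x : EuclideanSpace ℝ (Fin n)) : EuclideanSpace ℝ (Fin n) →L[ℝ] F :=
  ∫ s in τ..t, heatGrad (K t - K s) (f s) x

section Duhamel

variable {K : ℝ → ℝ} {m M τ : ℝ} {f : ℝ → EuclideanSpace ℝ (Fin n) → F}

lemma stronglyMeasurable_heatMean_time (hK : Continuous K)
    (hf : StronglyMeasurable (Function.uncurry f)) (c : ℝ) (x : 𝔼) :
    StronglyMeasurable fun s => heatMean (c - K s) (f s) x :=
  stronglyMeasurable_heatMean hf (hK.measurable.const_sub c) measurable_const

lemma intervalIntegrable_heatMean_time (hK : Continuous K)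
    (hf : StronglyMeasurable (Function.uncurry f)) (hM : ∀ s x, ‖f s x‖ ≤ M) (c : ℝ) (x : 𝔼)
    (a b : ℝ) : IntervalIntegrable (fun s => heatMean (c - K s) (f s) x) volume a b :=
  (intervalIntegrable_const (c := M)).mono_fun'
    (stronglyMeasurable_heatMean_time hK hf c x).aestronglyMeasurable
    (ae_of_all _ fun s => norm_heatMean_le (hM s) _ _)

lemma norm_duhamel_le (hM : ∀ s x, ‖f s x‖ ≤ M) {t : ℝ} (ht : τ ≤ t) (x : 𝔼) :
    ‖duhamel K τ f t x‖ ≤ M * (t - τ) := by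
  have := intervalIntegral.norm_integral_le_of_norm_le_const (a := τ) (b := t)
    (f := fun s => heatMean (K t - K s) (f s) x) (C := M) fun s _ => norm_heatMean_le (hM s) _ _
  rwa [abs_of_nonneg (sub_nonneg.2 ht)] at this

lemma norm_heatGrad_time_le (hm : 0 < m) (hKm : ∀ s t, s ≤ t → m * (t - s) ≤ K t - K s)
    (hM : ∀ s x, ‖f s x‖ ≤ M) {s t : ℝ} (hst : s < t) (x : 𝔼) :
    ‖heatGrad (K t - K s) (f s) x‖ ≤ gradConst n * M / √m / √(t - s) := by
  have hM0 : 0 ≤ M := (norm_nonneg _).trans (hM s x)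
  have h1 : 0 < m * (t - s) := mul_pos hm (sub_pos.2 hst)
  refine (norm_heatGrad_le (hM s) _ x).trans ?_
  rw [div_div, ← Real.sqrt_mul hm.le]
  have := gradConst_nonneg (n := n)
  have h2 := Real.sqrt_le_sqrt (hKm s t hst.le)
  have h3 := Real.sqrt_pos.2 h1
  gcongr

lemma continuousOn_duhamel (hK : Continuous K) (hm : 0 < m)
    (hKm : ∀ s t, s ≤ t → m * (t - s) ≤ K t - K s) (hf : StronglyMeasurable (Function.uncurry f))
    (hM : ∀ s x, ‖f s x‖ ≤ M) :
    ContinuousOn (fun q : ℝ × 𝔼 => duhamel K τ f q.1 q.2) (Ici τ ×ˢ univ) := by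
  have hM0 : 0 ≤ M := (norm_nonneg _).trans (hM 0 0)
  refine continuousOn_integral_of_singular_bound (β := fun _ => M) antitoneOn_const
    (fun _ _ => hM0) (fun a b => intervalIntegrable_const)
    (fun q => stronglyMeasurable_heatMean_time hK hf _ _) (fun s _ => ?_)
    (fun q s _ _ => norm_heatMean_le (hM s) _ _)
  refine (continuousOn_heatMean_of_measurable (stronglyMeasurable_slice hf s) (hM s)).comp
    (f := fun q : ℝ × 𝔼 => (K q.1 - K s, q.2)) (by fun_prop) fun q hq => ⟨?_, trivial⟩
  have : s < q.1 := hq.1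
  have h2 := hKm s q.1 this.le
  have := mul_pos hm (sub_pos.2 this)
  simp only [mem_Ioi]; linarith

lemma stronglyMeasurable_heatGrad_time (hK : Continuous K)
    (hf : StronglyMeasurable (Function.uncurry f)) (c : ℝ) (x : 𝔼) :
    StronglyMeasurable fun s => heatGrad (c - K s) (f s) x :=
  stronglyMeasurable_heatGrad hf (hK.measurable.const_sub c) measurable_const

lemma continuousOn_duhamelGrad (hK : Continuous K) (hm : 0 < m)
    (hKm : ∀ s t, s ≤ t → m * (t - s) ≤ K t - K s) (hf : StronglyMeasurable (Function.uncurry f))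
    (hM : ∀ s x, ‖f s x‖ ≤ M) :
    ContinuousOn (fun q : ℝ × 𝔼 => duhamelGrad K τ f q.1 q.2) (Ici τ ×ˢ univ) := by
  have hM0 : 0 ≤ M := (norm_nonneg _).trans (hM 0 0)
  have hc := gradConst_nonneg (n := n)
  refine continuousOn_integral_of_singular_bound (β := fun r => gradConst n * M / √m / √r)
    (fun a ha b _ hab => ?_) (fun _ _ => by positivity)
    (fun a b => intervalIntegrable_const_div_sqrt _ a b)
    (fun q => stronglyMeasurable_heatGrad_time hK hf _ _) (fun s _ => ?_)
    (fun q s _ h => norm_heatGrad_time_le hm hKm hM h _)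
  · have ha' : 0 < √a := Real.sqrt_pos.2 ha
    have hab' := Real.sqrt_le_sqrt hab
    simp only
    gcongr
  refine (continuousOn_heatGrad (stronglyMeasurable_slice hf s) (hM s)).comp
    (f := fun q : ℝ × 𝔼 => (K q.1 - K s, q.2)) (by fun_prop) fun q hq => ⟨?_, trivial⟩
  have : s < q.1 := hq.1
  have h2 := hKm s q.1 this.le
  have := mul_pos hm (sub_pos.2 this)
  simp only [mem_Ioi]; linarith

lemma norm_duhamelGrad_le (hm : 0 < m) (hKm : ∀ s t, s ≤ t → m * (t - s) ≤ K t - K s)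
    (hM : ∀ s x, ‖f s x‖ ≤ M) {t : ℝ} (ht : τ ≤ t) (x : 𝔼) :
    ‖duhamelGrad K τ f t x‖ ≤ ∫ r in (0 : ℝ)..(t - τ), gradConst n * M / √m / √r := by
  have h := intervalIntegrable_const_div_sqrt (gradConst n * M / √m) (t - τ) (t - t)
  have h1 : IntervalIntegrable (fun s => gradConst n * M / √m / √(t - s)) volume τ t := by
    simpa using h.comp_sub_left t
  have h2 := intervalIntegral.norm_integral_le_of_norm_le ht
    (f := fun s => heatGrad (K t - K s) (f s) x) (by
      filter_upwards [Measure.ae_ne volume t] with s hs1 hs2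
      exact norm_heatGrad_time_le hm hKm hM (lt_of_le_of_ne hs2.2 hs1) x) h1
  rwa [intervalIntegral.integral_comp_sub_left (fun r => gradConst n * M / √m / √r), sub_self] at h2

lemma hasFDerivAt_duhamel (hK : Continuous K) (hm : 0 < m)
    (hKm : ∀ s t, s ≤ t → m * (t - s) ≤ K t - K s) (hf : StronglyMeasurable (Function.uncurry f))
    (hM : ∀ s x, ‖f s x‖ ≤ M) {t : ℝ} (ht : τ ≤ t) (x : 𝔼) :
    HasFDerivAt (duhamel K τ f t) (duhamelGrad K τ f t x) x := by
  have h := intervalIntegrable_const_div_sqrt (gradConst n * M / √m) (t - τ) (t - t)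
  have h1 : IntervalIntegrable (fun s => gradConst n * M / √m / √(t - s)) volume τ t := by
    simpa using h.comp_sub_left t
  have hae : ∀ᵐ s ∂volume.restrict (uIoc τ t), s < t := by
    rw [uIoc_of_le ht]
    filter_upwards [ae_restrict_mem measurableSet_Ioc, ae_restrict_of_ae (Measure.ae_ne volume t)]
      with s hs hst
    exact lt_of_le_of_ne hs.2 hst
  refine hasFDerivAt_integral_of_dominated_of_fderiv_le'' (s := univ)
    (bound := fun s => gradConst n * M / √m / √(t - s))
    (F := fun x s => heatMean (K t - K s) (f s) x) (F' := fun x s => heatGrad (K t - K s) (f s) x)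
    univ_mem (Eventually.of_forall fun x' =>
      (stronglyMeasurable_heatMean_time hK hf _ x').aestronglyMeasurable)
    (intervalIntegrable_heatMean_time hK hf hM _ x _ _)
    (stronglyMeasurable_heatGrad_time hK hf _ x).aestronglyMeasurable ?_ h1 ?_
  · filter_upwards [hae] with s hs x' _
    exact norm_heatGrad_time_le hm hKm hM hs x'
  · filter_upwards [hae] with s hs x' _
    refine hasFDerivAt_heatMean (stronglyMeasurable_slice hf s) (hM s) ?_ x'
    have := mul_pos hm (sub_pos.2 hs)
    linarith [hKm s t hs.le]

lemma hasFDerivAt_duhamel_of_hasFDerivAt (hK : Continuous K) {M' : ℝ}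
    {f' : ℝ → EuclideanSpace ℝ (Fin n) → EuclideanSpace ℝ (Fin n) →L[ℝ] F}
    (hf : StronglyMeasurable (Function.uncurry f)) (hf' : StronglyMeasurable (Function.uncurry f'))
    (hM : ∀ s x, ‖f s x‖ ≤ M) (hM' : ∀ s x, ‖f' s x‖ ≤ M') (t : ℝ)
    (hd : ∀ s x, HasFDerivAt (f s) (f' s x) x) (x : 𝔼) :
    HasFDerivAt (duhamel K τ f t) (duhamel K τ f' t x) x :=
  hasFDerivAt_integral_of_dominated_of_fderiv_le'' (s := univ) (bound := fun _ => M')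
    (F := fun x s => heatMean (K t - K s) (f s) x) (F' := fun x s => heatMean (K t - K s) (f' s) x)
    univ_mem (Eventually.of_forall fun x' =>
      (stronglyMeasurable_heatMean_time hK hf _ x').aestronglyMeasurable)
    (intervalIntegrable_heatMean_time hK hf hM _ x _ _)
    (stronglyMeasurable_heatMean_time hK hf' _ x).aestronglyMeasurable
    (ae_of_all _ fun s x' _ => norm_heatMean_le (hM' s) _ x') intervalIntegrable_const
    (ae_of_all _ fun s x' _ => hasFDerivAt_heatMean_of_hasFDerivAt (stronglyMeasurable_slice hf s)
      (stronglyMeasurable_slice hf' s) (hM s) (hM' s) (hd s) _ x')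

/-- Restarting the evolution: by the semigroup property the evolution from time `b` to `t`, applied
to the Duhamel integral over `[a, b]`, is the part of the integral up to `t` over `[a, b]`. -/
lemma heatMean_duhamel [CompleteSpace F] (hK : Continuous K) (hKmono : Monotone K)
    (hf : StronglyMeasurable (Function.uncurry f)) (hM : ∀ s x, ‖f s x‖ ≤ M) {a b t : ℝ}
    (hab : a ≤ b) (hbt : b ≤ t) (x : 𝔼) :
    heatMean (K t - K b) (duhamel K a f b) x = ∫ s in a..b, heatMean (K t - K s) (f s) x := by
  set r := √(K t - K b)
  have hm1 : StronglyMeasurable fun q : 𝔼 × ℝ => heatMean (K b - K q.2) (f q.2) (x - r • q.1) :=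
    stronglyMeasurable_heatMean (f := fun q : 𝔼 × ℝ => f q.2)
      (hf.comp_measurable ((measurable_snd.comp measurable_fst).prodMk measurable_snd))
      ((hK.measurable.comp measurable_snd).const_sub _) (by fun_prop)
  have hint : Integrable (Function.uncurry fun (z : 𝔼) (s : ℝ) =>
      unitKernel z • heatMean (K b - K s) (f s) (x - r • z))
      (volume.prod (volume.restrict (Ioc a b))) := by
    have h1 : Integrable (fun q : 𝔼 × ℝ => unitKernel q.1 * M)
        (volume.prod (volume.restrict (Ioc a b))) :=
      (integrable_unitKernel.mul_const M).comp_fst _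
    refine h1.mono' ?_ (ae_of_all _ fun q =>
      norm_unitKernel_smul_le (norm_heatMean_le (hM q.2) _ _) q.1)
    exact ((continuous_unitKernel.comp continuous_fst).stronglyMeasurable.smul
      hm1).aestronglyMeasurable
  rw [intervalIntegral.integral_of_le hab]
  unfold heatMean duhamel
  simp_rw [intervalIntegral.integral_of_le hab, ← integral_smul]
  rw [integral_integral_swap hint]
  refine setIntegral_congr_fun measurableSet_Ioc fun s hs => ?_
  have h := congrFun (heatMean_heatMean (stronglyMeasurable_slice hf s) (hM s)
    (sub_nonneg.2 (hKmono hbt)) (sub_nonneg.2 (hKmono hs.2))) x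
  rw [sub_add_sub_cancel] at h
  exact h

end Duhamel

end DuhamelIntegral

/-! ### Mild evolutions and first-order regularity -/

section Evolve

variable {F : Type*} [NormedAddCommGroup F] [NormedSpace ℝ F]

/-- The mild evolution started at time `τ` from `g` with source `f`. -/
def evolve (K : ℝ → ℝ) (τ : ℝ) (g : EuclideanSpace ℝ (Fin n) → F)
    (f : ℝ → EuclideanSpace ℝ (Fin n) → F) (t : ℝ) (x : EuclideanSpace ℝ (Fin n)) : F :=
  heatMean (K t - K τ) g x + duhamel K τ f t x

/-- The spatial derivative of `evolve`. -/
def evolveGrad (K : ℝ → ℝ) (τ : ℝ) (g : EuclideanSpace ℝ (Fin n) → F)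
    (f : ℝ → EuclideanSpace ℝ (Fin n) → F) (t : ℝ) (x : EuclideanSpace ℝ (Fin n)) :
    EuclideanSpace ℝ (Fin n) →L[ℝ] F :=
  heatGrad (K t - K τ) g x + duhamelGrad K τ f t x

variable {K : ℝ → ℝ} {m M M₀ τ : ℝ} {f : ℝ → EuclideanSpace ℝ (Fin n) → F}
  {g : EuclideanSpace ℝ (Fin n) → F}

lemma evolve_self [CompleteSpace F] : evolve K τ g f τ = g := by
  ext x; simp [evolve, duhamel, heatMean_zero]

lemma norm_evolve_le (hg : ∀ x, ‖g x‖ ≤ M₀) (hM : ∀ s x, ‖f s x‖ ≤ M) {t : ℝ} (ht : τ ≤ t)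
    (x : 𝔼) : ‖evolve K τ g f t x‖ ≤ M₀ + M * (t - τ) :=
  (norm_add_le _ _).trans (add_le_add (norm_heatMean_le hg _ _) (norm_duhamel_le hM ht x))

lemma sub_pos_of_lower_slope (hm : 0 < m) (hKm : ∀ s t, s ≤ t → m * (t - s) ≤ K t - K s) {s t : ℝ}
    (h : s < t) : 0 < K t - K s :=
  (mul_pos hm (sub_pos.2 h)).trans_le (hKm s t h.le)

lemma hasFDerivAt_evolve (hK : Continuous K) (hm : 0 < m)
    (hKm : ∀ s t, s ≤ t → m * (t - s) ≤ K t - K s) (hg : StronglyMeasurable g)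
    (hM₀ : ∀ x, ‖g x‖ ≤ M₀) (hf : StronglyMeasurable (Function.uncurry f))
    (hM : ∀ s x, ‖f s x‖ ≤ M) {t : ℝ} (ht : τ < t) (x : 𝔼) :
    HasFDerivAt (evolve K τ g f t) (evolveGrad K τ g f t x) x :=
  (hasFDerivAt_heatMean hg hM₀ (sub_pos_of_lower_slope hm hKm ht) x).add
    (hasFDerivAt_duhamel hK hm hKm hf hM ht.le x)

lemma continuousOn_evolveGrad (hK : Continuous K) (hm : 0 < m)
    (hKm : ∀ s t, s ≤ t → m * (t - s) ≤ K t - K s) (hg : StronglyMeasurable g)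
    (hM₀ : ∀ x, ‖g x‖ ≤ M₀) (hf : StronglyMeasurable (Function.uncurry f))
    (hM : ∀ s x, ‖f s x‖ ≤ M) :
    ContinuousOn (fun q : ℝ × 𝔼 => evolveGrad K τ g f q.1 q.2) (Ioi τ ×ˢ univ) := by
  refine ContinuousOn.add ?_ ((continuousOn_duhamelGrad hK hm hKm hf hM).mono
    (prod_mono Ioi_subset_Ici_self subset_rfl))
  exact (continuousOn_heatGrad hg hM₀).comp (f := fun q : ℝ × 𝔼 => (K q.1 - K τ, q.2))
    (by fun_prop) fun q hq => ⟨sub_pos_of_lower_slope hm hKm hq.1, trivial⟩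

lemma exists_norm_evolveGrad_le (hm : 0 < m)
    (hKm : ∀ s t, s ≤ t → m * (t - s) ≤ K t - K s)
    (hM₀ : ∀ x, ‖g x‖ ≤ M₀) (hM : ∀ s x, ‖f s x‖ ≤ M) {τ' : ℝ} (hτ : τ < τ') (T : ℝ) :
    ∃ C, ∀ t ∈ Icc τ' T, ∀ x, ‖evolveGrad K τ g f t x‖ ≤ C := by
  have hM0 : 0 ≤ M := (norm_nonneg _).trans (hM 0 0)
  have hM00 : 0 ≤ M₀ := (norm_nonneg _).trans (hM₀ 0)
  have hc := gradConst_nonneg (n := n)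
  refine ⟨gradConst n * M₀ / √(m * (τ' - τ)) + ∫ r in (0 : ℝ)..(T - τ), gradConst n * M / √m / √r,
    fun t ht x => (norm_add_le _ _).trans (add_le_add ?_ ?_)⟩
  · refine (norm_heatGrad_le hM₀ _ x).trans ?_
    have h1 : 0 < √(m * (τ' - τ)) := Real.sqrt_pos.2 (mul_pos hm (sub_pos.2 hτ))
    have h2 : m * (τ' - τ) ≤ K t - K τ :=
      le_trans (by gcongr; exact ht.1) (hKm τ t (hτ.le.trans ht.1))
    have h3 := Real.sqrt_le_sqrt h2
    gcongr
  · refine (norm_duhamelGrad_le hm hKm hM (hτ.le.trans ht.1) x).trans ?_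
    refine intervalIntegral.integral_mono_interval le_rfl (by linarith [ht.1]) (by linarith [ht.2])
      (ae_of_all _ fun r => ?_) (intervalIntegrable_const_div_sqrt _ _ _)
    simp only [Pi.zero_apply]
    positivity

lemma continuousOn_evolve (hK : Continuous K) (hm : 0 < m)
    (hKm : ∀ s t, s ≤ t → m * (t - s) ≤ K t - K s) (hg : Continuous g)
    (hM₀ : ∀ x, ‖g x‖ ≤ M₀) (hf : StronglyMeasurable (Function.uncurry f))
    (hM : ∀ s x, ‖f s x‖ ≤ M) :
    ContinuousOn (fun q : ℝ × 𝔼 => evolve K τ g f q.1 q.2) (Ici τ ×ˢ univ) :=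
  ((continuous_heatMean hg hM₀).comp (f := fun q : ℝ × 𝔼 => (K q.1 - K τ, q.2))
    (by fun_prop)).continuousOn.add (continuousOn_duhamel hK hm hKm hf hM)

lemma evolve_congr {f₁ : ℝ → EuclideanSpace ℝ (Fin n) → F} {t : ℝ} (ht : τ ≤ t)
    (h : ∀ s ∈ Icc τ t, f s = f₁ s) : evolve K τ g f t = evolve K τ g f₁ t := by
  ext x
  unfold evolve duhamel
  congr 1
  refine intervalIntegral.integral_congr fun s hs => ?_
  rw [uIcc_of_le ht] at hs
  simp only [h s hs]

lemma evolve_restart [CompleteSpace F] (hK : Continuous K) (hKmono : Monotone K)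
    (hg : StronglyMeasurable g) (hM₀ : ∀ x, ‖g x‖ ≤ M₀)
    (hf : StronglyMeasurable (Function.uncurry f)) (hM : ∀ s x, ‖f s x‖ ≤ M) {b t : ℝ}
    (hab : τ ≤ b) (hbt : b ≤ t) :
    evolve K τ g f t = evolve K b (evolve K τ g f b) f t := by
  ext x
  have i1 : StronglyMeasurable (heatMean (K b - K τ) g) :=
    stronglyMeasurable_heatMean (f := fun _ : 𝔼 => g) (σ := fun _ => K b - K τ)
      (hg.comp_measurable measurable_snd) measurable_const measurable_id
  have i2 : StronglyMeasurable (duhamel K τ f b) := by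
    unfold duhamel
    simp_rw [intervalIntegral.integral_of_le hab]
    refine StronglyMeasurable.integral_prod_right' (f := fun q : 𝔼 × ℝ =>
      heatMean (K b - K q.2) (f q.2) q.1) ?_
    exact stronglyMeasurable_heatMean (f := fun q : 𝔼 × ℝ => f q.2)
      (hf.comp_measurable ((measurable_snd.comp measurable_fst).prodMk measurable_snd))
      ((hK.measurable.comp measurable_snd).const_sub _) measurable_fst
  have hadd : heatMean (K t - K b) (evolve K τ g f b) x =
      heatMean (K t - K b) (heatMean (K b - K τ) g) x +
        heatMean (K t - K b) (duhamel K τ f b) x := by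
    unfold heatMean
    rw [← integral_add]
    · refine integral_congr_ae (ae_of_all _ fun z => ?_)
      simp only [← smul_add]
      rfl
    · exact integrable_unitKernel_smul (i1.comp_measurable (by fun_prop)) fun z =>
        norm_heatMean_le hM₀ _ (x - √(K t - K b) • z)
    · exact integrable_unitKernel_smul (i2.comp_measurable (by fun_prop)) fun z =>
        norm_duhamel_le hM hab (x - √(K t - K b) • z)
  unfold evolve at hadd ⊢
  rw [hadd, heatMean_duhamel hK hKmono hf hM hab hbt, heatMean_heatMean hg hM₀
    (sub_nonneg.2 (hKmono hbt)) (sub_nonneg.2 (hKmono hab)), sub_add_sub_cancel, add_assoc]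
  congr 1
  exact (intervalIntegral.integral_add_adjacent_intervals
    (intervalIntegrable_heatMean_time hK hf hM _ x _ _)
    (intervalIntegrable_heatMean_time hK hf hM _ x _ _)).symm

lemma hasFDerivAt_evolve_of_hasFDerivAt (hK : Continuous K) {M' M₀' : ℝ}
    {f' : ℝ → EuclideanSpace ℝ (Fin n) → EuclideanSpace ℝ (Fin n) →L[ℝ] F}
    {g' : EuclideanSpace ℝ (Fin n) → EuclideanSpace ℝ (Fin n) →L[ℝ] F}
    (hg : StronglyMeasurable g) (hg' : StronglyMeasurable g')
    (hM₀ : ∀ x, ‖g x‖ ≤ M₀) (hM₀' : ∀ x, ‖g' x‖ ≤ M₀') (hgd : ∀ x, HasFDerivAt g (g' x) x)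
    (hf : StronglyMeasurable (Function.uncurry f)) (hf' : StronglyMeasurable (Function.uncurry f'))
    (hM : ∀ s x, ‖f s x‖ ≤ M) (hM' : ∀ s x, ‖f' s x‖ ≤ M') (t : ℝ)
    (hd : ∀ s x, HasFDerivAt (f s) (f' s x) x) (x : 𝔼) :
    HasFDerivAt (evolve K τ g f t) (evolve K τ g' f' t x) x :=
  (hasFDerivAt_heatMean_of_hasFDerivAt hg hg' hM₀ hM₀' hgd _ x).add
    (hasFDerivAt_duhamel_of_hasFDerivAt hK hf hf' hM hM' t hd x)

end Evolve

section C2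

variable {w : ℝ → EuclideanSpace ℝ (Fin n) → ℝ}
  {w' : ℝ → EuclideanSpace ℝ (Fin n) → EuclideanSpace ℝ (Fin n) →L[ℝ] ℝ}
  {w'' : ℝ → EuclideanSpace ℝ (Fin n) →
    EuclideanSpace ℝ (Fin n) →L[ℝ] EuclideanSpace ℝ (Fin n) →L[ℝ] ℝ} {S : Set ℝ}

lemma contDiff_two_of_hasFDerivAt {g : 𝔼 → ℝ} {g' : 𝔼 → 𝔼 →L[ℝ] ℝ} {g'' : 𝔼 → 𝔼 →L[ℝ] 𝔼 →L[ℝ] ℝ}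
    (h : ∀ x, HasFDerivAt g (g' x) x) (h' : ∀ x, HasFDerivAt g' (g'' x) x) (hc : Continuous g'') :
    ContDiff ℝ 2 g := by
  have e1 : fderiv ℝ g = g' := funext fun x => (h x).fderiv
  have e2 : fderiv ℝ g' = g'' := funext fun x => (h' x).fderiv
  rw [show (2 : WithTop ℕ∞) = 1 + 1 by norm_num, contDiff_succ_iff_fderiv]
  refine ⟨fun x => (h x).differentiableAt, by simp, ?_⟩
  rw [e1, contDiff_one_iff_fderiv, e2]
  exact ⟨fun x => (h' x).differentiableAt, hc⟩

lemma laplacian_eq_sum_of_hasFDerivAt {g : 𝔼 → ℝ} {g' : 𝔼 → 𝔼 →L[ℝ] ℝ}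
    {g'' : 𝔼 → 𝔼 →L[ℝ] 𝔼 →L[ℝ] ℝ}
    (h : ∀ x, HasFDerivAt g (g' x) x) (h' : ∀ x, HasFDerivAt g' (g'' x) x) (x : 𝔼) :
    Laplacian.laplacian g x = ∑ i, g'' x (EuclideanSpace.basisFun (Fin n) ℝ i)
      (EuclideanSpace.basisFun (Fin n) ℝ i) := by
  have e1 : fderiv ℝ g = g' := funext fun x => (h x).fderiv
  have e2 : fderiv ℝ g' = g'' := funext fun x => (h' x).fderiv
  rw [InnerProductSpace.laplacian_eq_iteratedFDeriv_orthonormalBasis g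
    (EuclideanSpace.basisFun (Fin n) ℝ)]
  simp only [iteratedFDeriv_two_apply, e1, e2]
  rfl

lemma continuousOn_iteratedFDeriv_of_hasFDerivAt
    (hw : ContinuousOn (fun q : ℝ × 𝔼 => w q.1 q.2) (S ×ˢ univ))
    (hw' : ContinuousOn (fun q : ℝ × 𝔼 => w' q.1 q.2) (S ×ˢ univ))
    (hw'' : ContinuousOn (fun q : ℝ × 𝔼 => w'' q.1 q.2) (S ×ˢ univ))
    (h : ∀ t ∈ S, ∀ x, HasFDerivAt (w t) (w' t x) x)
    (h' : ∀ t ∈ S, ∀ x, HasFDerivAt (w' t) (w'' t x) x) (m : ℕ) (hm : m ≤ 2) :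
    ContinuousOn (fun q : ℝ × 𝔼 => iteratedFDeriv ℝ m (w q.1) q.2) (S ×ˢ univ) := by
  have e1 : ∀ t ∈ S, fderiv ℝ (w t) = w' t := fun t ht => funext fun x => (h t ht x).fderiv
  have e2 : ∀ t ∈ S, fderiv ℝ (w' t) = w'' t := fun t ht => funext fun x => (h' t ht x).fderiv
  interval_cases m
  · simp only [iteratedFDeriv_zero_eq_comp, Function.comp_apply]
    exact (LinearIsometryEquiv.continuous _).comp_continuousOn hw
  · simp only [iteratedFDeriv_succ_eq_comp_right,
      iteratedFDeriv_zero_eq_comp, Function.comp_apply]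
    refine (LinearIsometryEquiv.continuous _).comp_continuousOn
      ((LinearIsometryEquiv.continuous _).comp_continuousOn (hw'.congr fun q hq => ?_))
    change fderiv ℝ (w q.1) q.2 = _
    rw [e1 _ hq.1]
  · simp only [iteratedFDeriv_succ_eq_comp_right,
      iteratedFDeriv_zero_eq_comp, Function.comp_apply]
    refine (LinearIsometryEquiv.continuous _).comp_continuousOn
      ((LinearIsometryEquiv.continuous _).comp_continuousOn
        ((LinearIsometryEquiv.continuous _).comp_continuousOn (hw''.congr fun q hq => ?_)))
    change fderiv ℝ (fderiv ℝ (w q.1)) q.2 = _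
    rw [e1 _ hq.1, e2 _ hq.1]

end C2

/-! ### Classical regularity of mild evolutions -/

/-- `K` is a primitive of the continuous diffusivity `k`, which is bounded below by `m > 0`. -/
structure IsTimeChange (K k : ℝ → ℝ) (m : ℝ) : Prop where
  continuous_diffusivity : Continuous k
  pos : 0 < m
  lower : ∀ t, m ≤ k t
  hasDerivAt : ∀ t, HasDerivAt K (k t) t

namespace IsTimeChange

variable {K k : ℝ → ℝ} {m : ℝ}

lemma continuous (h : IsTimeChange K k m) : Continuous K :=
  continuous_iff_continuousAt.2 fun t => (h.hasDerivAt t).continuousAt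

lemma slope_le (h : IsTimeChange K k m) (s t : ℝ) (hst : s ≤ t) : m * (t - s) ≤ K t - K s := by
  have := convex_univ.mul_sub_le_image_sub_of_le_deriv (f := K) h.continuous.continuousOn
    (fun t _ => (h.hasDerivAt t).differentiableAt.differentiableWithinAt)
    (C := m) (fun t _ => by rw [(h.hasDerivAt t).deriv]; exact h.lower t) s trivial t trivial hst
  exact this

lemma strictMono (h : IsTimeChange K k m) : StrictMono K := fun _ _ hst =>
  sub_pos.1 (sub_pos_of_lower_slope h.pos h.slope_le hst)

end IsTimeChange

/-- A bounded measurable source on `[0, T]` which is continuously differentiable in space at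
positive times, with derivative `f'` bounded away from `t = 0`. -/
structure IsRegularSource (T M : ℝ) (f : ℝ → EuclideanSpace ℝ (Fin n) → ℝ)
    (f' : ℝ → EuclideanSpace ℝ (Fin n) → EuclideanSpace ℝ (Fin n) →L[ℝ] ℝ) : Prop where
  stronglyMeasurable : StronglyMeasurable (Function.uncurry f)
  norm_le : ∀ s x, ‖f s x‖ ≤ M
  continuousOn : ContinuousOn (Function.uncurry f) (Ioc 0 T ×ˢ univ)
  hasFDerivAt : ∀ s ∈ Ioc 0 T, ∀ x, HasFDerivAt (f s) (f' s x) x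
  continuousOn_deriv : ContinuousOn (Function.uncurry f') (Ioc 0 T ×ˢ univ)
  bounded_deriv : ∀ τ ∈ Ioc 0 T, ∃ C, ∀ s ∈ Icc τ T, ∀ x, ‖f' s x‖ ≤ C

/-- Freeze the time argument of `f` outside `[τ, T]`. -/
def clampTime {G : Type*} {τ T : ℝ} (h : τ ≤ T) (f : ℝ → G) (s : ℝ) : G := f (projIcc τ T h s)

lemma clampTime_of_mem {G : Type*} {τ T : ℝ} (h : τ ≤ T) (f : ℝ → G) {s : ℝ} (hs : s ∈ Icc τ T) :
    clampTime h f s = f s := by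
  simp [clampTime, projIcc_of_mem h hs]

lemma clampTime_mem {τ T : ℝ} (h : τ ≤ T) (s : ℝ) : (projIcc τ T h s : ℝ) ∈ Icc τ T :=
  (projIcc τ T h s).2

lemma continuous_clampTime {G : Type*} [TopologicalSpace G] {τ T : ℝ} (h : τ ≤ T) (hτ : 0 < τ)
    {f : ℝ → 𝔼 → G} (hf : ContinuousOn (Function.uncurry f) (Ioc 0 T ×ˢ univ)) :
    Continuous (Function.uncurry (clampTime h f)) := by
  have h1 : Continuous fun q : ℝ × 𝔼 => ((projIcc τ T h q.1 : ℝ), q.2) := by fun_prop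
  exact hf.comp_continuous h1 fun q =>
    ⟨⟨hτ.trans_le (clampTime_mem h q.1).1, (clampTime_mem h q.1).2⟩, trivial⟩

section Regularity

variable {K k : ℝ → ℝ} {m T M M₀ : ℝ} {φ : EuclideanSpace ℝ (Fin n) → ℝ}
  {f : ℝ → EuclideanSpace ℝ (Fin n) → ℝ}
  {f' : ℝ → EuclideanSpace ℝ (Fin n) → EuclideanSpace ℝ (Fin n) →L[ℝ] ℝ}

lemma continuous_slice_evolve (hK : IsTimeChange K k m) (hφ : Continuous φ)
    (hM₀ : ∀ x, ‖φ x‖ ≤ M₀) (hf : IsRegularSource T M f f') {t : ℝ} (ht : 0 ≤ t) :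
    Continuous (evolve K 0 φ f t) := by
  have h := continuousOn_evolve (τ := 0) hK.continuous hK.pos hK.slope_le hφ hM₀
    hf.stronglyMeasurable hf.norm_le
  exact h.comp_continuous (f := fun x : 𝔼 => (t, x)) (by fun_prop) fun x => ⟨ht, trivial⟩

lemma continuous_slice_evolveGrad (hK : IsTimeChange K k m) (hφ : Continuous φ)
    (hM₀ : ∀ x, ‖φ x‖ ≤ M₀) (hf : IsRegularSource T M f f') {t : ℝ} (ht : 0 < t) :
    Continuous (evolveGrad K 0 φ f t) := by
  have h := continuousOn_evolveGrad (τ := 0) hK.continuous hK.pos hK.slope_le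
    hφ.stronglyMeasurable hM₀ hf.stronglyMeasurable hf.norm_le
  exact h.comp_continuous (f := fun x : 𝔼 => (t, x)) (by fun_prop) fun x => ⟨ht, trivial⟩

lemma evolve_eq_restart (hK : IsTimeChange K k m) (hφ : Continuous φ)
    (hM₀ : ∀ x, ‖φ x‖ ≤ M₀) (hf : IsRegularSource T M f f') {τ t : ℝ} (hτ : 0 < τ) (hτT : τ ≤ T)
    (ht : t ∈ Icc τ T) :
    evolve K 0 φ f t = evolve K τ (evolve K 0 φ f τ) (clampTime hτT f) t := by
  rw [evolve_restart hK.continuous hK.strictMono.monotone hφ.stronglyMeasurable hM₀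
    hf.stronglyMeasurable hf.norm_le hτ.le ht.1]
  exact evolve_congr ht.1 fun s hs =>
    (clampTime_of_mem hτT f ⟨hs.1, hs.2.trans ht.2⟩).symm

/-- After a restart at `τ > 0` the derivative may fall on the data, which are regular by then; so
the gradient is again a mild evolution, with bounded continuous data. -/
lemma evolveGrad_eq_restart (hK : IsTimeChange K k m) (hφ : Continuous φ)
    (hM₀ : ∀ x, ‖φ x‖ ≤ M₀) (hf : IsRegularSource T M f f') {τ t : ℝ} (hτ : 0 < τ) (hτT : τ ≤ T)
    (ht : t ∈ Icc τ T) :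
    evolveGrad K 0 φ f t = evolve K τ (evolveGrad K 0 φ f τ) (clampTime hτT f') t := by
  ext1 x
  have ht0 : 0 < t := hτ.trans_le ht.1
  have hd : ∀ {t}, 0 < t → ∀ x, HasFDerivAt (evolve K 0 φ f t) (evolveGrad K 0 φ f t x) x :=
    fun h x => hasFDerivAt_evolve hK.continuous hK.pos hK.slope_le hφ.stronglyMeasurable hM₀
      hf.stronglyMeasurable hf.norm_le h x
  obtain ⟨C, hC⟩ := exists_norm_evolveGrad_le hK.pos hK.slope_le hM₀ hf.norm_le hτ T
  obtain ⟨C', hC'⟩ := hf.bounded_deriv τ ⟨hτ, hτT⟩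
  have h1 : HasFDerivAt (evolve K 0 φ f t)
      (evolve K τ (evolveGrad K 0 φ f τ) (clampTime hτT f') t x) x := by
    rw [evolve_eq_restart hK hφ hM₀ hf hτ hτT ht]
    exact hasFDerivAt_evolve_of_hasFDerivAt hK.continuous
      (continuous_slice_evolve hK hφ hM₀ hf hτ.le).stronglyMeasurable
      (continuous_slice_evolveGrad hK hφ hM₀ hf hτ).stronglyMeasurable
      (fun x => norm_evolve_le hM₀ hf.norm_le hτ.le x) (fun x => hC τ ⟨le_rfl, hτT⟩ x)
      (hd hτ) (continuous_clampTime hτT hτ hf.continuousOn).stronglyMeasurable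
      (continuous_clampTime hτT hτ hf.continuousOn_deriv).stronglyMeasurable
      (fun s x => hf.norm_le _ x) (fun s x => hC' _ (clampTime_mem hτT s) x) t
      (fun s x => hf.hasFDerivAt _ ⟨hτ.trans_le (clampTime_mem hτT s).1, (clampTime_mem hτT s).2⟩ x)
      x
  exact (hd ht0 x).unique h1

/-- Second-order regularity of the mild evolution at positive times. -/
lemma exists_second_derivative_evolve (hK : IsTimeChange K k m) (hφ : Continuous φ)
    (hM₀ : ∀ x, ‖φ x‖ ≤ M₀) (hf : IsRegularSource T M f f') :
    ∃ W'' : ℝ → 𝔼 → 𝔼 →L[ℝ] 𝔼 →L[ℝ] ℝ,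
      (∀ t ∈ Ioc 0 T, ∀ x, HasFDerivAt (evolveGrad K 0 φ f t) (W'' t x) x) ∧
      ContinuousOn (Function.uncurry W'') (Ioc 0 T ×ˢ univ) ∧
      ∀ t ∈ Ioc 0 T, ∃ C, ∀ x, ‖W'' t x‖ ≤ C := by
  have key : ∀ τ (hτ : 0 < τ) (hτT : τ ≤ T), ∃ V : ℝ → 𝔼 → 𝔼 →L[ℝ] 𝔼 →L[ℝ] ℝ,
      (∀ t ∈ Ioc τ T, ∀ x, HasFDerivAt (evolveGrad K 0 φ f t) (V t x) x) ∧
      ContinuousOn (Function.uncurry V) (Ioc τ T ×ˢ univ) ∧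
      ∀ t ∈ Ioc τ T, ∃ C, ∀ x, ‖V t x‖ ≤ C := by
    intro τ hτ hτT
    obtain ⟨C, hC⟩ := exists_norm_evolveGrad_le hK.pos hK.slope_le hM₀ hf.norm_le hτ T
    obtain ⟨C', hC'⟩ := hf.bounded_deriv τ ⟨hτ, hτT⟩
    have m1 := (continuous_slice_evolveGrad hK hφ hM₀ hf hτ).stronglyMeasurable
    have m2 := (continuous_clampTime hτT hτ hf.continuousOn_deriv).stronglyMeasurable
    have b1 : ∀ x, ‖evolveGrad K 0 φ f τ x‖ ≤ C := fun x => hC τ ⟨le_rfl, hτT⟩ x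
    have b2 : ∀ s x, ‖clampTime hτT f' s x‖ ≤ C' := fun s x => hC' _ (clampTime_mem hτT s) x
    refine ⟨evolveGrad K τ (evolveGrad K 0 φ f τ) (clampTime hτT f'), fun t ht x => ?_, ?_,
      fun t ht => ?_⟩
    · rw [evolveGrad_eq_restart hK hφ hM₀ hf hτ hτT ⟨ht.1.le, ht.2⟩]
      exact hasFDerivAt_evolve hK.continuous hK.pos hK.slope_le m1 b1 m2 b2 ht.1 x
    · exact (continuousOn_evolveGrad hK.continuous hK.pos hK.slope_le m1 b1 m2 b2).mono
        (prod_mono Ioc_subset_Ioi_self subset_rfl)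
    · obtain ⟨C'', hC''⟩ := exists_norm_evolveGrad_le hK.pos hK.slope_le b1 b2 ht.1 T
      exact ⟨C'', hC'' t ⟨le_rfl, ht.2⟩⟩
  refine ⟨fun t x => fderiv ℝ (evolveGrad K 0 φ f t) x, fun t ht x => ?_, ?_, fun t ht => ?_⟩
  · obtain ⟨V, h, -, -⟩ := key (t / 2) (by linarith [ht.1]) (by linarith [ht.1, ht.2])
    simp only [(h t ⟨by linarith [ht.1], ht.2⟩ x).fderiv]
    exact h t ⟨by linarith [ht.1], ht.2⟩ x
  · rintro ⟨t, x⟩ ⟨ht, -⟩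
    obtain ⟨V, h, hc, -⟩ := key (t / 2) (by linarith [ht.1]) (by linarith [ht.1, ht.2])
    have h1 : ContinuousOn (Function.uncurry fun t x => fderiv ℝ (evolveGrad K 0 φ f t) x)
        (Ioc (t / 2) T ×ˢ univ) := hc.congr fun q hq => (h q.1 hq.1 q.2).fderiv
    refine (h1 (t, x) ⟨⟨by linarith [ht.1], ht.2⟩, trivial⟩).mono_of_mem_nhdsWithin ?_
    have h2 : Ioi (t / 2) ×ˢ univ ∈ 𝓝 (t, x) := (isOpen_Ioi.prod isOpen_univ).mem_nhds
      ⟨by simp only [mem_Ioi]; linarith [ht.1], trivial⟩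
    filter_upwards [mem_nhdsWithin_of_mem_nhds h2, self_mem_nhdsWithin] with q hq1 hq2
    exact ⟨⟨hq1.1, hq2.1.2⟩, trivial⟩
  · obtain ⟨V, h, -, hb⟩ := key (t / 2) (by linarith [ht.1]) (by linarith [ht.1, ht.2])
    obtain ⟨C, hC⟩ := hb t ⟨by linarith [ht.1], ht.2⟩
    refine ⟨C, fun x => ?_⟩
    simp only [(h t ⟨by linarith [ht.1], ht.2⟩ x).fderiv]
    exact hC x

/-- The source enters the right derivative of the Duhamel integral at its starting time. -/
lemma hasDerivWithinAt_duhamel_start (hK : IsTimeChange K k m)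
    (hf : Continuous (Function.uncurry f)) (hM : ∀ s x, ‖f s x‖ ≤ M) (t : ℝ) (x : 𝔼) :
    HasDerivWithinAt (fun t' => duhamel K t f t' x) (f t x) (Ici t) t := by
  have hc : ContinuousAt (fun q : ℝ × ℝ => heatMean (K q.1 - K q.2) (f q.2) x) (t, t) := by
    have hKc := hK.continuous
    refine continuousAt_heatMean (f := fun q : ℝ × ℝ => f q.2)
      (σ := fun q : ℝ × ℝ => K q.1 - K q.2) (X := fun _ => x) (fun y => ?_) (by fun_prop)
      continuousAt_const (fun q => stronglyMeasurable_slice hf.stronglyMeasurable q.2)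
      (M := M) (fun q y => hM _ _)
    exact (hf.comp (f := fun p : (ℝ × ℝ) × 𝔼 => (p.1.2, p.2)) (by fun_prop)).continuousAt
  rw [Metric.continuousAt_iff] at hc
  simp only [sub_self, heatMean_zero] at hc
  rw [hasDerivWithinAt_iff_isLittleO, Asymptotics.isLittleO_iff]
  intro c hc0
  obtain ⟨δ, hδ, hδc⟩ := hc c hc0
  have h1 : ∀ᶠ t' in 𝓝[Ici t] t, t' < t + δ :=
    nhdsWithin_le_nhds (gt_mem_nhds (by linarith))
  filter_upwards [h1, self_mem_nhdsWithin] with t' ht' htt'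
  have htt : t ≤ t' := htt'
  have h2 : duhamel K t f t' x - duhamel K t f t x - (t' - t) • f t x =
      ∫ s in t..t', (heatMean (K t' - K s) (f s) x - f t x) := by
    rw [intervalIntegral.integral_sub
      (intervalIntegrable_heatMean_time hK.continuous hf.stronglyMeasurable hM _ x _ _)
      intervalIntegrable_const]
    simp [duhamel]
  rw [h2]
  refine intervalIntegral.norm_integral_le_of_norm_le_const fun s hs => ?_
  rw [uIoc_of_le htt] at hs
  refine (dist_eq_norm (heatMean (K t' - K s) (f s) x) (f t x)) ▸ (hδc (x := (t', s)) ?_).le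
  rw [Prod.dist_eq, max_lt_iff, Real.dist_eq, Real.dist_eq]
  simp only
  rw [abs_of_nonneg (by linarith), abs_of_nonneg (by linarith [hs.1])]
  exact ⟨by linarith, by linarith [hs.2]⟩

/-- The mild evolution solves the inhomogeneous heat equation in the sense of right derivatives:
restart at `t` and use the generator of the semigroup. -/
lemma hasDerivWithinAt_evolve_right (hK : IsTimeChange K k m) (hφ : Continuous φ)
    (hM₀ : ∀ x, ‖φ x‖ ≤ M₀) (hf : IsRegularSource T M f f') {t : ℝ} (ht : t ∈ Ioo 0 T) (x : 𝔼) :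
    HasDerivWithinAt (fun t' => evolve K 0 φ f t' x)
      (k t * Laplacian.laplacian (evolve K 0 φ f t) x + f t x) (Ici t) t := by
  obtain ⟨W'', hW, -, hb⟩ := exists_second_derivative_evolve hK hφ hM₀ hf
  have htI : t ∈ Ioc 0 T := ⟨ht.1, ht.2.le⟩
  obtain ⟨C, hC⟩ := hb t htI
  have hd : ∀ x, HasFDerivAt (evolve K 0 φ f t) (evolveGrad K 0 φ f t x) x := fun x =>
    hasFDerivAt_evolve hK.continuous hK.pos hK.slope_le hφ.stronglyMeasurable hM₀
      hf.stronglyMeasurable hf.norm_le ht.1 x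
  have hgen := tendsto_heatMean_sub_div hd (hW t htI)
    (fun x => norm_evolve_le hM₀ hf.norm_le ht.1.le x) hC x
  rw [← laplacian_eq_sum_of_hasFDerivAt hd (hW t htI)] at hgen
  set w := evolve K 0 φ f t
  have h1 : HasDerivWithinAt (fun t' => heatMean (K t' - K t) w x)
      (k t * Laplacian.laplacian w x) (Ici t) t := by
    rw [← hasDerivWithinAt_Ioi_iff_Ici, hasDerivWithinAt_iff_tendsto_slope' self_notMem_Ioi]
    have hσ : Tendsto (fun t' => K t' - K t) (𝓝[>] t) (𝓝[>] 0) := by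
      refine tendsto_nhdsWithin_iff.2 ⟨?_, ?_⟩
      · have : Tendsto (fun t' => K t' - K t) (𝓝 t) (𝓝 (K t - K t)) :=
          (hK.continuous.sub continuous_const).tendsto t
        rw [sub_self] at this
        exact this.mono_left nhdsWithin_le_nhds
      · filter_upwards [self_mem_nhdsWithin] with t' ht'
        exact sub_pos.2 (hK.strictMono ht')
    have hs : Tendsto (slope K t) (𝓝[>] t) (𝓝 (k t)) :=
      (hasDerivWithinAt_iff_tendsto_slope' self_notMem_Ioi).1
        ((hK.hasDerivAt t).hasDerivWithinAt (s := Ioi t))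
    refine ((hs.mul (hgen.comp hσ))).congr' ?_
    filter_upwards [self_mem_nhdsWithin] with t' ht'
    have h2 : t' - t ≠ 0 := (sub_pos.2 ht').ne'
    have h3 : K t' - K t ≠ 0 := (sub_pos.2 (hK.strictMono ht')).ne'
    simp only [slope_def_field, Function.comp_apply, sub_self, heatMean_zero]
    field_simp
  have h2 := hasDerivWithinAt_duhamel_start hK
    (continuous_clampTime ht.2.le ht.1 hf.continuousOn) (fun s x => hf.norm_le _ x) t x
  rw [clampTime_of_mem _ _ (left_mem_Icc.2 ht.2.le)] at h2
  refine (h1.add h2).congr_of_eventuallyEq_of_mem ?_ self_mem_Ici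
  filter_upwards [self_mem_nhdsWithin, nhdsWithin_le_nhds (gt_mem_nhds ht.2)] with t' h3 h4
  rw [evolve_eq_restart hK hφ hM₀ hf ht.1 ht.2.le ⟨h3, h4.le⟩]
  rfl

/-- The mild evolution with regular source is a classical solution of the inhomogeneous heat
equation at positive times. -/
theorem isC12_evolve (hK : IsTimeChange K k m) (hφ : Continuous φ)
    (hM₀ : ∀ x, ‖φ x‖ ≤ M₀) (hf : IsRegularSource T M f f') :
    IsC12 T (evolve K 0 φ f) ∧ ∀ t ∈ Ioc 0 T, ∀ x,
      derivWithin (fun s => evolve K 0 φ f s x) (Ioc 0 T) t =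
        k t * Laplacian.laplacian (evolve K 0 φ f t) x + f t x := by
  obtain ⟨W'', hW, hWc, -⟩ := exists_second_derivative_evolve hK hφ hM₀ hf
  set w := evolve K 0 φ f with hw
  have hd : ∀ t ∈ Ioc 0 T, ∀ x, HasFDerivAt (w t) (evolveGrad K 0 φ f t x) x := fun t ht x =>
    hasFDerivAt_evolve hK.continuous hK.pos hK.slope_le hφ.stronglyMeasurable hM₀
      hf.stronglyMeasurable hf.norm_le ht.1 x
  have hwc : ContinuousOn (fun q : ℝ × 𝔼 => w q.1 q.2) (Ici 0 ×ˢ univ) :=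
    continuousOn_evolve hK.continuous hK.pos hK.slope_le hφ hM₀ hf.stronglyMeasurable hf.norm_le
  have hlap : ContinuousOn (fun q : ℝ × 𝔼 => Laplacian.laplacian (w q.1) q.2)
      (Ioc 0 T ×ˢ univ) := by
    have : ContinuousOn (fun q : ℝ × 𝔼 => ∑ i, W'' q.1 q.2 (EuclideanSpace.basisFun (Fin n) ℝ i)
        (EuclideanSpace.basisFun (Fin n) ℝ i)) (Ioc 0 T ×ˢ univ) :=
      continuousOn_finsetSum _ fun i _ => (hWc.clm_apply continuousOn_const).clm_apply
        continuousOn_const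
    exact this.congr fun q hq => laplacian_eq_sum_of_hasFDerivAt (hd q.1 hq.1) (hW q.1 hq.1) q.2
  have hRc : ContinuousOn (fun q : ℝ × 𝔼 => k q.1 * Laplacian.laplacian (w q.1) q.2 + f q.1 q.2)
      (Ioc 0 T ×ˢ univ) :=
    ((hK.continuous_diffusivity.comp continuous_fst).continuousOn.mul hlap).add hf.continuousOn
  have hder : ∀ t ∈ Ioc 0 T, ∀ x, HasDerivWithinAt (fun s => w s x)
      (k t * Laplacian.laplacian (w t) x + f t x) (Ioc 0 T) t := by
    intro t ht x
    set R : ℝ → ℝ := fun r => k r * Laplacian.laplacian (w r) x + f r x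
    have haT : t / 2 ≤ T := by linarith [ht.1, ht.2]
    have ha : 0 < t / 2 := by linarith [ht.1]
    have hRcl : Continuous (clampTime haT R) := by
      refine hRc.comp_continuous (f := fun r => ((projIcc (t / 2) T haT r : ℝ), x)) (by fun_prop)
        fun r => ⟨⟨ha.trans_le (clampTime_mem haT r).1, (clampTime_mem haT r).2⟩, trivial⟩
    have hint : ∀ r, HasDerivAt (fun r => ∫ s in (t / 2)..r, clampTime haT R s)
        (clampTime haT R r) r := fun r =>
      intervalIntegral.integral_hasDerivAt_right (hRcl.intervalIntegrable _ _)
        (hRcl.stronglyMeasurableAtFilter _ _) hRcl.continuousAt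
    have hconst : ∀ r ∈ Icc (t / 2) T, w r x - ∫ s in (t / 2)..r, clampTime haT R s =
        w (t / 2) x - ∫ s in (t / 2)..(t / 2), clampTime haT R s := by
      refine constant_of_has_deriv_right_zero ?_ fun r hr => ?_
      · refine ContinuousOn.sub ?_ fun r _ => (hint r).continuousAt.continuousWithinAt
        exact hwc.comp (f := fun r : ℝ => (r, x)) (by fun_prop)
          fun r hr => ⟨ha.le.trans hr.1, trivial⟩
      · have h1 := hasDerivWithinAt_evolve_right hK hφ hM₀ hf
          (t := r) ⟨ha.trans_le hr.1, hr.2⟩ x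
        have h2 := h1.sub (hint r).hasDerivWithinAt
        rw [clampTime_of_mem haT R ⟨hr.1, hr.2.le⟩, sub_self] at h2
        exact h2
    have h3 := ((hint t).const_add (w (t / 2) x)).hasDerivWithinAt (s := Ioc 0 T)
    rw [clampTime_of_mem haT R ⟨by linarith [ht.1], ht.2⟩] at h3
    refine h3.congr_of_eventuallyEq_of_mem ?_ ht
    have h4 : Ioi (t / 2) ∈ 𝓝 t := Ioi_mem_nhds (by linarith [ht.1])
    filter_upwards [mem_nhdsWithin_of_mem_nhds h4, self_mem_nhdsWithin] with r hr1 hr2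
    have h5 := hconst r ⟨le_of_lt hr1, hr2.2⟩
    rw [intervalIntegral.integral_same, sub_zero] at h5
    linarith
  have hu : ∀ t ∈ Ioc 0 T, UniqueDiffWithinAt ℝ (Ioc 0 T) t := fun t ht => uniqueDiffOn_Ioc 0 T t ht
  refine ⟨⟨fun t ht x => (hder t ht x).differentiableWithinAt, ?_, fun t ht => ?_, ?_⟩,
    fun t ht x => (hder t ht x).derivWithin (hu t ht)⟩
  · exact hRc.congr fun q hq => (hder q.1 hq.1 q.2).derivWithin (hu q.1 hq.1)
  · exact contDiff_two_of_hasFDerivAt (hd t ht) (hW t ht)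
      (hWc.comp_continuous (f := fun x : 𝔼 => (t, x)) (by fun_prop) fun x => ⟨ht, trivial⟩)
  · refine continuousOn_iteratedFDeriv_of_hasFDerivAt (w' := evolveGrad K 0 φ f) (w'' := W'')
      (hwc.mono (prod_mono (fun t ht => ht.1.le) subset_rfl)) ?_ hWc hd hW
    exact (continuousOn_evolveGrad hK.continuous hK.pos hK.slope_le hφ.stronglyMeasurable hM₀
      hf.stronglyMeasurable hf.norm_le).mono (prod_mono Ioc_subset_Ioi_self subset_rfl)

end Regularity

/-! ### Maximum and comparison principles -/

/-- A weakly coupled maximum principle on `[τ, T] × ℝⁿ`. The differential inequality is only used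
where the `i`-th component is positive and maximal among the components and where
`w_i - c ‖·‖²` has a spatial maximum; there it bounds the left time derivative. -/
theorem nonpos_of_maximum_principle {ι : Type*} [Finite ι] {w : ι → ℝ → 𝔼 → ℝ} {τ T A L B : ℝ}
    (hA : 0 ≤ A) (hcont : ∀ i, ContinuousOn (Function.uncurry (w i)) (Icc τ T ×ˢ univ))
    (hB : ∀ i, ∀ t ∈ Icc τ T, ∀ x, w i t x ≤ B) (h0 : ∀ i x, w i τ x ≤ 0)
    (hineq : ∀ i, ∀ t ∈ Ioc τ T, ∀ x c, 0 ≤ c → 0 < w i t x → (∀ j, w j t x ≤ w i t x) →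
      (∀ y, w i t y - c * ‖y‖ ^ 2 ≤ w i t x - c * ‖x‖ ^ 2) →
      ∃ d, HasDerivWithinAt (fun s => w i s x) d (Iic t) t ∧ d ≤ A * c + L * w i t x) :
    ∀ i, ∀ t ∈ Icc τ T, ∀ x, w i t x ≤ 0 := by
  -- The factor `E = exp (-λ (t - τ))` absorbs both `L w` and the error `A c` of the penalization.
  obtain ⟨lam, hlam⟩ : ∃ lam, lam = A + |L| + 1 := ⟨_, rfl⟩
  have hlam0 : 0 < lam := by have := abs_nonneg L; linarith
  have hlamL : A + L < lam := by have := le_abs_self L; linarith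
  obtain ⟨E, hE, hE1, hEd⟩ : ∃ E : ℝ → ℝ, (∀ t, 0 < E t) ∧ (∀ t, τ ≤ t → E t ≤ 1) ∧
      ∀ t, HasDerivAt E (-lam * E t) t := by
    refine ⟨fun t => Real.exp (-(lam * (t - τ))), fun t => Real.exp_pos _,
      fun t ht => Real.exp_le_one_iff.2 (by nlinarith), fun t => ?_⟩
    have h := ((((hasDerivAt_id t).sub_const τ).const_mul lam).neg).exp
    convert! h using 1
    simp; ring
  have hEc : Continuous E := continuous_iff_continuousAt.2 fun t => (hEd t).continuousAt
  have key : ∀ ε > 0, ∀ i, ∀ t ∈ Icc τ T, ∀ x, E t * w i t x - ε * (1 + ‖x‖ ^ 2) ≤ 0 := by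
    intro ε hε i₀ t₀ ht₀ x₀
    by_contra! hcon
    set Q : ι → ℝ × 𝔼 → ℝ := fun i q => E q.1 * w i q.1 q.2 - ε * (1 + ‖q.2‖ ^ 2)
    -- The penalization confines positive values of `Q` to a compact set.
    set R : ℝ := √(|B| / ε)
    have hout : ∀ i, ∀ t ∈ Icc τ T, ∀ x, R < ‖x‖ → Q i (t, x) ≤ 0 := by
      intro i t ht x hx
      have h1 : |B| / ε < ‖x‖ ^ 2 := (Real.sqrt_lt' (lt_of_le_of_lt (Real.sqrt_nonneg _) hx)).1 hx
      rw [div_lt_iff₀ hε] at h1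
      have h2 : E t * w i t x ≤ |B| := by
        rcases le_or_gt (w i t x) 0 with h | h
        · exact (mul_nonpos_of_nonneg_of_nonpos (hE t).le h).trans (abs_nonneg B)
        · calc E t * w i t x ≤ 1 * w i t x := by gcongr; exact hE1 t ht.1
            _ ≤ |B| := by rw [one_mul]; exact (hB i t ht x).trans (le_abs_self B)
      simp only [Q]
      nlinarith
    have hx₀ : ‖x₀‖ ≤ R := by
      by_contra! h
      exact absurd (hout i₀ t₀ ht₀ x₀ h) (not_le.2 hcon)
    have hcomp : IsCompact (Icc τ T ×ˢ Metric.closedBall (0 : 𝔼) R) :=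
      isCompact_Icc.prod (isCompact_closedBall _ _)
    have hmem : ∀ {s y}, s ∈ Icc τ T → ‖y‖ ≤ R →
        (s, y) ∈ Icc τ T ×ˢ Metric.closedBall (0 : 𝔼) R := fun hs hy =>
      ⟨hs, mem_closedBall_zero_iff.2 hy⟩
    have hne : (Icc τ T ×ˢ Metric.closedBall (0 : 𝔼) R).Nonempty := ⟨_, hmem ht₀ hx₀⟩
    have hQc : ∀ i, ContinuousOn (Q i) (Icc τ T ×ˢ Metric.closedBall (0 : 𝔼) R) := by
      intro i
      refine ContinuousOn.sub (ContinuousOn.mul ?_ ((hcont i).mono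
        (prod_mono subset_rfl (subset_univ _)))) ?_
      · exact (hEc.comp continuous_fst).continuousOn
      · exact (by fun_prop : Continuous fun q : ℝ × 𝔼 => ε * (1 + ‖q.2‖ ^ 2)).continuousOn
    choose q hq hqmax using fun i => hcomp.exists_isMaxOn hne (hQc i)
    have : Nonempty ι := ⟨i₀⟩
    obtain ⟨i, hi⟩ := Finite.exists_max fun i => Q i (q i)
    obtain ⟨⟨t, x⟩, hqi⟩ : ∃ p, p = q i := ⟨_, rfl⟩
    have htx := hq i
    rw [← hqi] at htx hi
    have hpos : 0 < Q i (t, x) :=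
      hcon.trans_le ((hqmax i₀ (hmem ht₀ hx₀)).trans (hi i₀))
    have hmax : ∀ j, ∀ s ∈ Icc τ T, ∀ y, Q j (s, y) ≤ Q i (t, x) := by
      intro j s hs y
      rcases le_or_gt ‖y‖ R with hy | hy
      · exact (hqmax j (hmem hs hy)).trans (hi j)
      · exact (hout j s hs y hy).trans hpos.le
    have ht : t ∈ Icc τ T := htx.1
    have hwpos : ε * (1 + ‖x‖ ^ 2) < E t * w i t x := by simp only [Q] at hpos; linarith
    have hw : 0 < w i t x := by
      have : 0 < E t * w i t x := lt_of_le_of_lt (by positivity) hwpos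
      exact pos_of_mul_pos_right this (hE t).le
    have hτt : τ < t := by
      rcases ht.1.eq_or_lt with h | h
      · exact absurd (h0 i x) (by rw [h]; exact not_le.2 hw)
      · exact h
    set c := ε / E t
    have hc : 0 < c := div_pos hε (hE t)
    have hcE : c * E t = ε := div_mul_cancel₀ _ (hE t).ne'
    obtain ⟨d, hd, hdle⟩ := hineq i t ⟨hτt, ht.2⟩ x c hc.le hw
      (fun j => by
        have := hmax j t ht x
        simp only [Q] at this
        exact le_of_mul_le_mul_left (by linarith) (hE t))
      (fun y => by
        have := hmax i t ht y
        simp only [Q, ← hcE] at this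
        refine le_of_mul_le_mul_left ?_ (hE t)
        linarith)
    have hdQ : HasDerivWithinAt (fun s => Q i (s, x)) (-lam * E t * w i t x + E t * d) (Iic t) t :=
      ((hEd t).hasDerivWithinAt.mul hd).sub_const (ε * (1 + ‖x‖ ^ 2))
    -- At a maximum over earlier times the left derivative is nonnegative.
    have hge : 0 ≤ -lam * E t * w i t x + E t * d := by
      rw [← hasDerivWithinAt_Iio_iff_Iic, hasDerivWithinAt_iff_tendsto_slope' self_notMem_Iio]
        at hdQ
      refine ge_of_tendsto hdQ ?_
      filter_upwards [Ioo_mem_nhdsLT hτt] with s hs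
      have := hmax i s ⟨hs.1.le, hs.2.le.trans ht.2⟩ x
      rw [slope_def_field]
      exact div_nonneg_of_nonpos (by linarith) (by linarith [hs.2])
    have h1 : lam * w i t x ≤ d := by
      refine le_of_mul_le_mul_left ?_ (hE t)
      linarith
    have h2 : c ≤ w i t x := by
      refine le_of_mul_le_mul_left ?_ (hE t)
      nlinarith [sq_nonneg ‖x‖]
    nlinarith [mul_le_mul_of_nonneg_left h2 hA, mul_lt_mul_of_pos_right hlamL hw]
  intro i t ht x
  have h1 : E t * w i t x ≤ 0 := by
    refine le_of_forall_pos_le_add fun δ hδ => ?_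
    have := key (δ / (1 + ‖x‖ ^ 2)) (by positivity) i t ht x
    rw [div_mul_cancel₀ _ (by positivity)] at this
    linarith
  exact nonpos_of_mul_nonpos_right h1 (hE t)

lemma ContDiff.hasFDerivAt_two {g : 𝔼 → ℝ} (hg : ContDiff ℝ 2 g) :
    (∀ x, HasFDerivAt g (fderiv ℝ g x) x) ∧
      ∀ x, HasFDerivAt (fderiv ℝ g) (fderiv ℝ (fderiv ℝ g) x) x := by
  refine ⟨fun x => (hg.differentiable (by norm_num) x).hasFDerivAt, fun x => ?_⟩
  have h : ContDiff ℝ 1 (fderiv ℝ g) := hg.fderiv_right (by norm_num)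
  exact (h.differentiable (by norm_num) x).hasFDerivAt

/-- Touching from above: if `v - ρ u - c ‖·‖²` has a maximum at `x` then `Δ v ≤ ρ Δ u + 2 n c`. -/
lemma laplacian_le_of_touching {v u : 𝔼 → ℝ} (hv : ContDiff ℝ 2 v) (hu : ContDiff ℝ 2 u)
    {ρ c : ℝ} {x : 𝔼}
    (h : ∀ y, v y - ρ * u y - c * ‖y‖ ^ 2 ≤ v x - ρ * u x - c * ‖x‖ ^ 2) :
    Laplacian.laplacian v x - ρ * Laplacian.laplacian u x ≤ 2 * n * c := by
  obtain ⟨hv1, hv2⟩ := ContDiff.hasFDerivAt_two hv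
  obtain ⟨hu1, hu2⟩ := ContDiff.hasFDerivAt_two hu
  rw [laplacian_eq_sum_of_hasFDerivAt hv1 hv2, laplacian_eq_sum_of_hasFDerivAt hu1 hu2,
    Finset.mul_sum, ← Finset.sum_sub_distrib]
  have hle : ∀ i ∈ (Finset.univ : Finset (Fin n)),
      fderiv ℝ (fderiv ℝ v) x (EuclideanSpace.basisFun (Fin n) ℝ i)
        (EuclideanSpace.basisFun (Fin n) ℝ i) -
      ρ * fderiv ℝ (fderiv ℝ u) x (EuclideanSpace.basisFun (Fin n) ℝ i)
        (EuclideanSpace.basisFun (Fin n) ℝ i) ≤ 2 * c := by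
    intro i _
    set e := EuclideanSpace.basisFun (Fin n) ℝ i
    refine le_of_tendsto ((tendsto_second_difference_div hv1 hv2 x e).sub
      ((tendsto_second_difference_div hu1 hu2 x e).const_mul ρ)) ?_
    filter_upwards [self_mem_nhdsWithin] with r hr
    have hr' : (0 : ℝ) < r := hr
    have h1 := h (x + r • e)
    have h2 := h (x - r • e)
    have h3 : ‖x + r • e‖ ^ 2 + ‖x - r • e‖ ^ 2 = 2 * ‖x‖ ^ 2 + 2 * r ^ 2 := by
      have h4 := parallelogram_law_with_norm ℝ x (r • e)
      have h5 : ‖e‖ = 1 := (EuclideanSpace.basisFun (Fin n) ℝ).orthonormal.1 i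
      rw [norm_smul, h5, Real.norm_of_nonneg hr'.le, mul_one] at h4
      nlinarith
    rw [mul_div_assoc', ← sub_div, div_le_iff₀ (by positivity)]
    have h6 : c * (‖x + r • e‖ ^ 2 + ‖x - r • e‖ ^ 2) = c * (2 * ‖x‖ ^ 2 + 2 * r ^ 2) := by rw [h3]
    linarith
  refine (Finset.sum_le_sum hle).trans (le_of_eq ?_)
  simp; ring

/-- Comparison of `v` with a concave function `z = ψ(t, u)` of `u`: only the tangent inequality
`z(t, y) ≤ z(t, x) + ρ(t, x) (u(t, y) - u(t, x))` enters, in place of the chain rule for `Δ`. -/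
theorem le_of_comparison {ι : Type*} [Finite ι] {v u z ρ dv dz : ι → ℝ → 𝔼 → ℝ} {k : ι → ℝ → ℝ}
    {τ T κ L B : ℝ}
    (hk0 : ∀ i, ∀ t ∈ Ioc τ T, 0 ≤ k i t) (hk : ∀ i, ∀ t ∈ Ioc τ T, k i t ≤ κ)
    (hvc : ∀ i, ContinuousOn (Function.uncurry (v i)) (Icc τ T ×ˢ univ))
    (hzc : ∀ i, ContinuousOn (Function.uncurry (z i)) (Icc τ T ×ˢ univ))
    (hB : ∀ i, ∀ t ∈ Icc τ T, ∀ x, v i t x - z i t x ≤ B) (h0 : ∀ i x, v i τ x ≤ z i τ x)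
    (hv2 : ∀ i, ∀ t ∈ Ioc τ T, ContDiff ℝ 2 (v i t))
    (hu2 : ∀ i, ∀ t ∈ Ioc τ T, ContDiff ℝ 2 (u i t))
    (hdv : ∀ i, ∀ t ∈ Ioc τ T, ∀ x, HasDerivWithinAt (fun s => v i s x) (dv i t x) (Iic t) t)
    (hdz : ∀ i, ∀ t ∈ Ioc τ T, ∀ x, HasDerivWithinAt (fun s => z i s x) (dz i t x) (Iic t) t)
    (hρ : ∀ i, ∀ t ∈ Ioc τ T, ∀ x y, z i t y ≤ z i t x + ρ i t x * (u i t y - u i t x))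
    (hineq : ∀ i, ∀ t ∈ Ioc τ T, ∀ x, z i t x < v i t x →
      (∀ j, v j t x - z j t x ≤ v i t x - z i t x) →
      (dv i t x - k i t * Laplacian.laplacian (v i t) x) -
        (dz i t x - k i t * (ρ i t x * Laplacian.laplacian (u i t) x)) ≤
          L * (v i t x - z i t x)) :
    ∀ i, ∀ t ∈ Icc τ T, ∀ x, v i t x ≤ z i t x := by
  have h := nonpos_of_maximum_principle (w := fun i t x => v i t x - z i t x) (τ := τ) (T := T)
    (A := |κ| * (2 * n)) (L := L) (B := B) (by positivity) (fun i => (hvc i).sub (hzc i)) hB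
    (fun i x => sub_nonpos.2 (h0 i x)) ?_
  · exact fun i t ht x => sub_nonpos.1 (h i t ht x)
  intro i t ht x c hc hpos hmax htouch
  refine ⟨_, (hdv i t ht x).sub (hdz i t ht x), ?_⟩
  have h1 := laplacian_le_of_touching (hv2 i t ht) (hu2 i t ht) (ρ := ρ i t x) (c := c) (x := x)
    fun y => by linarith [htouch y, hρ i t ht x y]
  have h2 := hineq i t ht x (sub_pos.1 hpos) hmax
  have h3 := mul_le_mul_of_nonneg_left h1 (hk0 i t ht)
  have h4 : k i t * (2 * n * c) ≤ |κ| * (2 * n) * c := by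
    have := (hk i t ht).trans (le_abs_self κ)
    calc k i t * (2 * n * c) ≤ |κ| * (2 * n * c) := by gcongr
      _ = _ := by ring
  linarith

/-! ### Real powers: tangents, increments and exponents -/

/-- The function `x ^ q * y ^ (1 - q)` is convex and homogeneous of degree one for `q ≥ 1`, hence
subadditive. -/
lemma rpow_mul_rpow_one_sub_subadditive {q x₁ x₂ y₁ y₂ : ℝ} (hq : 1 ≤ q) (hx₁ : 0 ≤ x₁)
    (hx₂ : 0 ≤ x₂) (hy₁ : 0 < y₁) (hy₂ : 0 < y₂) :
    (x₁ + x₂) ^ q * (y₁ + y₂) ^ (1 - q) ≤ x₁ ^ q * y₁ ^ (1 - q) + x₂ ^ q * y₂ ^ (1 - q) := by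
  have hy : 0 < y₁ + y₂ := add_pos hy₁ hy₂
  have h := (convexOn_rpow hq).2 (show x₁ / y₁ ∈ Ici 0 from div_nonneg hx₁ hy₁.le)
    (show x₂ / y₂ ∈ Ici 0 from div_nonneg hx₂ hy₂.le) (div_nonneg hy₁.le hy.le)
    (div_nonneg hy₂.le hy.le) (by field_simp)
  simp only [smul_eq_mul] at h
  have e1 : y₁ / (y₁ + y₂) * (x₁ / y₁) + y₂ / (y₁ + y₂) * (x₂ / y₂) = (x₁ + x₂) / (y₁ + y₂) := by
    field_simp
  have e2 : ∀ {x y : ℝ}, 0 ≤ x → 0 < y → x ^ q * y ^ (1 - q) = y * (x / y) ^ q := by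
    intro x y hx hy
    rw [Real.div_rpow hx hy.le, Real.rpow_sub hy, Real.rpow_one]
    ring
  rw [e1] at h
  rw [e2 (by positivity) hy, e2 hx₁ hy₁, e2 hx₂ hy₂]
  calc (y₁ + y₂) * ((x₁ + x₂) / (y₁ + y₂)) ^ q
      ≤ (y₁ + y₂) * (y₁ / (y₁ + y₂) * (x₁ / y₁) ^ q + y₂ / (y₁ + y₂) * (x₂ / y₂) ^ q) := by gcongr
    _ = _ := by field_simp

/-- Tangent inequality for the concave function `b ↦ (b ^ α + e) ^ (1 / α)`, `0 < α ≤ 1`. -/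
lemma rpow_add_rpow_inv_le_tangent {α a b e : ℝ} (hα : 0 < α) (hα1 : α ≤ 1) (ha : 0 < a)
    (hb : 0 < b) (he : 0 < e) :
    (b ^ α + e) ^ (1 / α) ≤
      (a ^ α + e) ^ (1 / α) + (a ^ α + e) ^ (1 / α - 1) * a ^ (α - 1) * (b - a) := by
  have hq : 1 ≤ 1 / α := by rw [le_div_iff₀ hα]; linarith
  have hA : 0 < a ^ α := Real.rpow_pos_of_pos ha _
  have hB : 0 < b ^ α := Real.rpow_pos_of_pos hb _
  have hX : 0 < a ^ α + e := by positivity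
  have h := rpow_mul_rpow_one_sub_subadditive hq hB.le he.le hA he
  rw [← Real.rpow_add he, add_sub_cancel, Real.rpow_one, ← Real.rpow_mul hb.le,
    ← Real.rpow_mul ha.le, mul_one_div_cancel hα.ne', Real.rpow_one, mul_sub,
    mul_one_div_cancel hα.ne', mul_one] at h
  have h2 := mul_le_mul_of_nonneg_left h (Real.rpow_nonneg hX.le (1 / α - 1))
  have e1 : (a ^ α + e) ^ (1 / α - 1) * ((b ^ α + e) ^ (1 / α) * (a ^ α + e) ^ (1 - 1 / α)) =
      (b ^ α + e) ^ (1 / α) := by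
    rw [mul_left_comm, ← Real.rpow_add hX]
    simp
  have e2 : (a ^ α + e) ^ (1 / α) = (a ^ α + e) ^ (1 / α - 1) * (a ^ α + e) := by
    conv_rhs => rw [← Real.rpow_one (a ^ α + e), ← Real.rpow_mul hX.le, one_mul,
      ← Real.rpow_add hX, sub_add_cancel]
  have e3 : a ^ α = a ^ (α - 1) * a := by
    rw [← Real.rpow_add_one ha.ne', sub_add_cancel]
  rw [e1] at h2
  rw [e2]
  refine h2.trans (le_of_eq ?_)
  have e4 : a ^ (1 - α) * a ^ (α - 1) = 1 := by rw [← Real.rpow_add ha]; simp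
  have e5 : b * a ^ (α - 1) + e = a ^ α + e + a ^ (α - 1) * (b - a) := by rw [e3]; ring
  rw [mul_comm b]
  rw [mul_comm b] at e5
  rw [mul_assoc, ← mul_add, ← e5]

lemma rpow_le_rpow_add_rpow {δ M x : ℝ} (hδ : 0 < δ) (h1 : δ ≤ x) (h2 : x ≤ M) (q : ℝ) :
    x ^ q ≤ δ ^ q + M ^ q := by
  have hx : 0 < x := hδ.trans_le h1
  have hM : 0 < M := hx.trans_le h2
  rcases le_total 0 q with hq | hq
  · have := Real.rpow_le_rpow hx.le h2 hq
    linarith [Real.rpow_nonneg hδ.le q]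
  · have := Real.rpow_le_rpow_of_nonpos hδ h1 hq
    linarith [Real.rpow_nonneg hM.le q]

lemma rpow_mul_rpow_add_sub_le {a b x y d L : ℝ} (hx : 0 < x) (hy : 0 < y) (hd : 0 ≤ d)
    (hL : ∀ s ∈ Icc 0 d, a * (x + s) ^ (a - 1) * (y + s) ^ b +
      (x + s) ^ a * (b * (y + s) ^ (b - 1)) ≤ L) :
    (x + d) ^ a * (y + d) ^ b - x ^ a * y ^ b ≤ L * d := by
  have hder : ∀ s ∈ Icc (0 : ℝ) d, HasDerivAt (fun s => (x + s) ^ a * (y + s) ^ b)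
      (a * (x + s) ^ (a - 1) * (y + s) ^ b + (x + s) ^ a * (b * (y + s) ^ (b - 1))) s := by
    intro s hs
    have h1 : HasDerivAt (fun s => x + s) 1 s := (hasDerivAt_id s).const_add x
    have h2 : HasDerivAt (fun s => y + s) 1 s := (hasDerivAt_id s).const_add y
    have h3 := h1.rpow_const (p := a) (Or.inl (by have := hs.1; positivity))
    have h4 := h2.rpow_const (p := b) (Or.inl (by have := hs.1; positivity))
    convert! h3.mul h4 using 1
    ring
  have h := (convex_Icc (0 : ℝ) d).image_sub_le_mul_sub_of_deriv_le
    (f := fun s => (x + s) ^ a * (y + s) ^ b) (C := L)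
    (fun s hs => (hder s hs).continuousAt.continuousWithinAt)
    (fun s hs => (hder s (interior_subset hs)).differentiableAt.differentiableWithinAt)
    (fun s hs => by rw [(hder s (interior_subset hs)).deriv]; exact hL s (interior_subset hs))
    0 (left_mem_Icc.2 hd) d (right_mem_Icc.2 hd) hd
  simpa using h

/-- Away from zero the reaction term is Lipschitz, from above, along the diagonal direction. -/
lemma exists_rpow_mul_rpow_lipschitz {a b δ M : ℝ} (ha : 0 ≤ a) (hb : 0 ≤ b) (hδ : 0 < δ)
    (hδM : δ ≤ M) :
    ∃ L, 0 ≤ L ∧ ∀ x y d, δ ≤ x → δ ≤ y → 0 ≤ d → x + d ≤ M → y + d ≤ M →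
      (x + d) ^ a * (y + d) ^ b ≤ x ^ a * y ^ b + L * d := by
  have hM : 0 < M := hδ.trans_le hδM
  refine ⟨a * (δ ^ (a - 1) + M ^ (a - 1)) * (δ ^ b + M ^ b) +
    (δ ^ a + M ^ a) * (b * (δ ^ (b - 1) + M ^ (b - 1))), by positivity,
    fun x y d hx hy hd hxM hyM => ?_⟩
  have h := rpow_mul_rpow_add_sub_le (a := a) (b := b) (hδ.trans_le hx) (hδ.trans_le hy) hd
    (L := a * (δ ^ (a - 1) + M ^ (a - 1)) * (δ ^ b + M ^ b) +
    (δ ^ a + M ^ a) * (b * (δ ^ (b - 1) + M ^ (b - 1)))) fun s hs => by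
      have hx1 : δ ≤ x + s := by linarith [hs.1]
      have hx2 : x + s ≤ M := by linarith [hs.2]
      have hy1 : δ ≤ y + s := by linarith [hs.1]
      have hy2 : y + s ≤ M := by linarith [hs.2]
      have p1 := rpow_le_rpow_add_rpow hδ hx1 hx2
      have p2 := rpow_le_rpow_add_rpow hδ hy1 hy2
      have hx0 : 0 < x + s := hδ.trans_le hx1
      have hy0 : 0 < y + s := hδ.trans_le hy1
      gcongr
      · exact p1 _
      · exact p2 _
      · exact p1 _
      · exact p2 _
  linarith

/-- Exponent pairs for which `U ^ P * V ^ Q` has increments bounded linearly, from above, under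
`(U, V) ↦ (U + ε, V + ε)` on bounded sets of positive `U`, `V`. -/
def LinearIncrement (P Q : ℝ) : Prop :=
  ((P = 0 ∨ 1 ≤ P) ∧ (Q = 0 ∨ 1 ≤ Q)) ∨ (P ≤ 0 ∧ Q = 1 - P) ∨ (P ≤ 0 ∧ Q = 0)

lemma LinearIncrement.exists_le {P Q R : ℝ} (h : LinearIncrement P Q) (hR : 0 < R) :
    ∃ C, 0 ≤ C ∧ ∀ U V ε, 0 < U → U ≤ R → 0 < V → V ≤ R → 0 < ε → ε ≤ 1 →
      (U + ε) ^ P * (V + ε) ^ Q - U ^ P * V ^ Q ≤ C * ε := by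
  rcases h with ⟨hP, hQ⟩ | ⟨hP, rfl⟩ | ⟨hP, rfl⟩
  · have hP0 : 0 ≤ P := by rcases hP with h | h <;> linarith
    have hQ0 : 0 ≤ Q := by rcases hQ with h | h <;> linarith
    have hb : ∀ {p x : ℝ}, (p = 0 ∨ 1 ≤ p) → 0 < x → x ≤ R + 1 →
        p * x ^ (p - 1) ≤ p * (R + 1) ^ (p - 1) := by
      intro p x hp hx hxR
      rcases hp with rfl | hp
      · simp
      · have := Real.rpow_le_rpow hx.le hxR (sub_nonneg.2 hp)
        gcongr
    refine ⟨P * (R + 1) ^ (P - 1) * (R + 1) ^ Q + (R + 1) ^ P * (Q * (R + 1) ^ (Q - 1)),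
      by positivity, fun U V ε hU hUR hV hVR hε hε1 =>
        rpow_mul_rpow_add_sub_le hU hV hε.le fun s hs => ?_⟩
    have hU0 : 0 < U + s := by linarith [hs.1]
    have hV0 : 0 < V + s := by linarith [hs.1]
    have hU1 : U + s ≤ R + 1 := by linarith [hs.2]
    have hV1 : V + s ≤ R + 1 := by linarith [hs.2]
    have := hb hP hU0 hU1
    have := hb hQ hV0 hV1
    gcongr
  · refine ⟨1, zero_le_one, fun U V ε hU hUR hV hVR hε hε1 => ?_⟩
    have h := rpow_mul_rpow_one_sub_subadditive (q := 1 - P) (by linarith) hV.le hε.le hU hε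
    rw [sub_sub_cancel, ← Real.rpow_add hε, sub_add_cancel, Real.rpow_one] at h
    rw [mul_comm ((U + ε) ^ P), mul_comm (U ^ P)]
    linarith
  · refine ⟨0, le_rfl, fun U V ε hU hUR hV hVR hε hε1 => ?_⟩
    have := Real.rpow_le_rpow_of_nonpos hU (by linarith : U ≤ U + ε) hP
    simp only [Real.rpow_zero, mul_one, zero_mul]
    linarith

/-- Exponent pairs for which `U ^ P * V ^ Q` is subadditive on positive arguments. -/
def SubadditiveIncrement (P Q : ℝ) : Prop :=
  (P = 0 ∧ 0 ≤ Q ∧ Q ≤ 1) ∨ (P ≤ 0 ∧ Q = 1 - P)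

lemma SubadditiveIncrement.le {P Q U V e f : ℝ} (h : SubadditiveIncrement P Q) (hU : 0 < U)
    (hV : 0 < V) (he : 0 < e) (hf : 0 < f) :
    (U + e) ^ P * (V + f) ^ Q - U ^ P * V ^ Q ≤ e ^ P * f ^ Q := by
  rcases h with ⟨rfl, hQ0, hQ1⟩ | ⟨hP, rfl⟩
  · have := Real.rpow_add_le_add_rpow hV.le hf.le hQ0 hQ1
    simp only [Real.rpow_zero, one_mul]
    linarith
  · have h := rpow_mul_rpow_one_sub_subadditive (q := 1 - P) (by linarith) hV.le hf.le hU he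
    rw [sub_sub_cancel] at h
    rw [mul_comm ((U + e) ^ P), mul_comm (U ^ P), mul_comm (e ^ P)]
    linarith

lemma exists_exponent_div_eq_zero_or_one_le {b c : ℝ} (hb : 0 ≤ b) (hc : 0 < c) :
    ∃ α, 0 < α ∧ α ≤ 1 ∧ α ≤ c ∧ (b / α = 0 ∨ 1 ≤ b / α) := by
  rcases hb.eq_or_lt with rfl | hb
  · exact ⟨min 1 c, by positivity, min_le_left _ _, min_le_right _ _, by simp⟩
  · refine ⟨min (min 1 c) b, by positivity, (min_le_left _ _).trans (min_le_left _ _),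
      (min_le_left _ _).trans (min_le_right _ _), Or.inr ?_⟩
    rw [le_div_iff₀ (by positivity), one_mul]
    exact min_le_right _ _

/-- Unless the system is strictly sublinear, powers `u_i ^ α_i` exist for which the transformed
reaction terms have linearly bounded increments. Here `A_i = 1 - p_ii` and `b_i = p_ij`. -/
lemma exists_exponents_linear {A₁ b₁ A₂ b₂ : ℝ} (hA₁ : A₁ ≤ 1) (hA₂ : A₂ ≤ 1) (hb₁ : 0 ≤ b₁)
    (hb₂ : 0 ≤ b₂) (h : ¬(0 < A₁ ∧ 0 < A₂ ∧ 0 < b₁ ∧ 0 < b₂ ∧ b₁ * b₂ < A₁ * A₂)) :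
    ∃ α₁ α₂, 0 < α₁ ∧ α₁ ≤ 1 ∧ 0 < α₂ ∧ α₂ ≤ 1 ∧ LinearIncrement (1 - A₁ / α₁) (b₁ / α₂) ∧
      LinearIncrement (1 - A₂ / α₂) (b₂ / α₁) := by
  have hP : ∀ {A α : ℝ}, A ≤ 0 → 0 < α → 1 ≤ 1 - A / α := fun hA hα => by
    have := div_nonpos_of_nonpos_of_nonneg hA hα.le; linarith
  have hP' : ∀ {A α : ℝ}, 0 < α → α ≤ A → 1 - A / α ≤ 0 := fun hα hA => by
    have := (one_le_div hα).2 hA; linarith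
  -- One sublinear and one superlinear diagonal exponent: `p_11 < 1 ≤ p_22`.
  have mixed : ∀ {A₁ b₁ A₂ b₂ : ℝ}, 0 < A₁ → A₂ ≤ 0 → 0 ≤ b₁ → 0 ≤ b₂ →
      ∃ α₁ α₂, 0 < α₁ ∧ α₁ ≤ 1 ∧ 0 < α₂ ∧ α₂ ≤ 1 ∧ LinearIncrement (1 - A₁ / α₁) (b₁ / α₂) ∧
        LinearIncrement (1 - A₂ / α₂) (b₂ / α₁) := by
    intro A₁ b₁ A₂ b₂ hA₁ hA₂ hb₁ hb₂
    rcases hb₁.eq_or_lt with rfl | hb₁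
    · obtain ⟨α, h1, h2, h3, h4⟩ := exists_exponent_div_eq_zero_or_one_le hb₂ hA₁
      exact ⟨α, 1, h1, h2, one_pos, le_rfl, Or.inr (Or.inr ⟨hP' h1 h3, by simp⟩),
        Or.inl ⟨Or.inr (hP hA₂ one_pos), h4⟩⟩
    · obtain ⟨α, h1, h2, h3, h4⟩ := exists_exponent_div_eq_zero_or_one_le hb₂
        (lt_min hA₁ (div_pos hA₁ hb₁))
      have h5 : 0 < b₁ * α / A₁ := by positivity
      refine ⟨α, b₁ * α / A₁, h1, h2, h5, ?_, Or.inr (Or.inl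
        ⟨hP' h1 (h3.trans (min_le_left _ _)), ?_⟩), Or.inl ⟨Or.inr (hP hA₂ h5), h4⟩⟩
      · have h6 := h3.trans (min_le_right _ _)
        rw [le_div_iff₀ hb₁] at h6
        rw [div_le_one hA₁]; linarith
      · field_simp; ring
  -- Both diagonal exponents sublinear, `b₁ b₂ ≥ A₁ A₂` and `b₁ ≥ A₂`.
  -- This choice has `U ^ P₁ * V ^ Q₁` of degree one and `P₂ = 0`.
  have coupled : ∀ {A₁ b₁ A₂ b₂ : ℝ}, 0 < A₁ → 0 < A₂ → A₁ ≤ 1 → A₂ ≤ 1 → 0 < b₁ →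
      A₁ * A₂ ≤ b₁ * b₂ → A₂ ≤ b₁ →
      ∃ α₁ α₂, 0 < α₁ ∧ α₁ ≤ 1 ∧ 0 < α₂ ∧ α₂ ≤ 1 ∧ LinearIncrement (1 - A₁ / α₁) (b₁ / α₂) ∧
        LinearIncrement (1 - A₂ / α₂) (b₂ / α₁) := by
    intro A₁ b₁ A₂ b₂ hA₁ hA₂ hA₁' hA₂' hb₁ hD hb
    have h1 : 0 < A₁ * A₂ / b₁ := by positivity
    have h2 : A₁ * A₂ / b₁ ≤ A₁ := by
      rw [div_le_iff₀ hb₁]; gcongr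
    refine ⟨A₁ * A₂ / b₁, A₂, h1, h2.trans hA₁', hA₂, hA₂', Or.inr (Or.inl ⟨hP' h1 h2, ?_⟩),
      Or.inl ⟨Or.inl ?_, Or.inr ?_⟩⟩
    · field_simp; ring
    · rw [div_self hA₂.ne', sub_self]
    · rw [one_le_div h1, div_le_iff₀ hb₁]; linarith
  -- Both diagonal exponents sublinear, and no coupling in the first equation.
  have decoupled : ∀ {A₁ A₂ b₂ : ℝ}, 0 < A₁ → 0 < A₂ → A₂ ≤ 1 → 0 ≤ b₂ →
      ∃ α₁ α₂, 0 < α₁ ∧ α₁ ≤ 1 ∧ 0 < α₂ ∧ α₂ ≤ 1 ∧ LinearIncrement (1 - A₁ / α₁) (0 / α₂) ∧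
        LinearIncrement (1 - A₂ / α₂) (b₂ / α₁) := by
    intro A₁ A₂ b₂ hA₁ hA₂ hA₂' hb₂
    obtain ⟨α, h1, h2, h3, h4⟩ := exists_exponent_div_eq_zero_or_one_le hb₂ hA₁
    refine ⟨α, A₂, h1, h2, hA₂, hA₂', Or.inr (Or.inr ⟨hP' h1 h3, by simp⟩),
      Or.inl ⟨Or.inl ?_, h4⟩⟩
    rw [div_self hA₂.ne', sub_self]
  have swap : ∀ {A₁ b₁ A₂ b₂ : ℝ}, (∃ α₁ α₂, 0 < α₁ ∧ α₁ ≤ 1 ∧ 0 < α₂ ∧ α₂ ≤ 1 ∧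
      LinearIncrement (1 - A₁ / α₁) (b₁ / α₂) ∧ LinearIncrement (1 - A₂ / α₂) (b₂ / α₁)) →
      ∃ α₂ α₁, 0 < α₂ ∧ α₂ ≤ 1 ∧ 0 < α₁ ∧ α₁ ≤ 1 ∧
      LinearIncrement (1 - A₂ / α₂) (b₂ / α₁) ∧ LinearIncrement (1 - A₁ / α₁) (b₁ / α₂) := by
    rintro _ _ _ _ ⟨α₁, α₂, h1, h2, h3, h4, h5, h6⟩
    exact ⟨α₂, α₁, h3, h4, h1, h2, h6, h5⟩
  rcases le_or_gt A₁ 0 with h₁ | h₁ <;> rcases le_or_gt A₂ 0 with h₂ | h₂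
  · obtain ⟨α₁, h1, h2, -, h4⟩ := exists_exponent_div_eq_zero_or_one_le hb₂ one_pos
    obtain ⟨α₂, h1', h2', -, h4'⟩ := exists_exponent_div_eq_zero_or_one_le hb₁ one_pos
    exact ⟨α₁, α₂, h1, h2, h1', h2', Or.inl ⟨Or.inr (hP h₁ h1), h4'⟩,
      Or.inl ⟨Or.inr (hP h₂ h1'), h4⟩⟩
  · exact swap (mixed h₂ h₁ hb₂ hb₁)
  · exact mixed h₁ h₂ hb₁ hb₂
  · rcases hb₁.eq_or_lt with rfl | hb₁
    · exact decoupled h₁ h₂ hA₂ hb₂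
    rcases hb₂.eq_or_lt with rfl | hb₂
    · exact swap (decoupled h₂ h₁ hA₁ hb₁.le)
    have hD : A₁ * A₂ ≤ b₁ * b₂ := by
      by_contra! hcon
      exact h ⟨h₁, h₂, hb₁, hb₂, hcon⟩
    rcases le_or_gt A₂ b₁ with hb | hb
    · exact coupled h₁ h₂ hA₁ hA₂ hb₁ hD hb
    · refine swap (coupled h₂ h₁ hA₂ hA₁ hb₂ (by linarith) ?_)
      by_contra! hcon
      nlinarith

/-- In the strictly sublinear case, powers exist for which the transformed reaction terms are
subadditive. -/
lemma exists_exponents_subadditive {A₁ b₁ A₂ b₂ : ℝ} (hA₁ : A₁ ≤ 1) (hA₂ : A₂ ≤ 1) (h₁ : 0 < A₁)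
    (h₂ : 0 < A₂) (hb₁ : 0 < b₁) (hb₂ : 0 < b₂) (hD : b₁ * b₂ < A₁ * A₂) :
    ∃ α₁ α₂, 0 < α₁ ∧ α₁ ≤ 1 ∧ 0 < α₂ ∧ α₂ ≤ 1 ∧ SubadditiveIncrement (1 - A₁ / α₁) (b₁ / α₂) ∧
      SubadditiveIncrement (1 - A₂ / α₂) (b₂ / α₁) := by
  -- `P₁ = 0` and `U ^ Q₂ * V ^ P₂` of degree one; then `b₁ b₂ < A₁ A₂` gives `Q₁ ≤ 1`.
  have key : ∀ {A₁ b₁ A₂ b₂ : ℝ}, A₁ ≤ 1 → A₂ ≤ 1 → 0 < A₁ → 0 < A₂ → 0 < b₁ → 0 < b₂ →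
      b₁ * b₂ < A₁ * A₂ → A₁ < b₂ →
      ∃ α₁ α₂, 0 < α₁ ∧ α₁ ≤ 1 ∧ 0 < α₂ ∧ α₂ ≤ 1 ∧
        SubadditiveIncrement (1 - A₁ / α₁) (b₁ / α₂) ∧
        SubadditiveIncrement (1 - A₂ / α₂) (b₂ / α₁) := by
    intro A₁ b₁ A₂ b₂ hA₁ hA₂ h₁ h₂ hb₁ hb₂ hD hb
    have h1 : 0 < A₁ * A₂ / b₂ := by positivity
    have h2 : A₁ * A₂ / b₂ ≤ A₂ := by
      rw [div_le_iff₀ hb₂]; nlinarith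
    refine ⟨A₁, A₁ * A₂ / b₂, h₁, hA₁, h1, h2.trans hA₂, Or.inl ⟨?_, by positivity, ?_⟩,
      Or.inr ⟨?_, ?_⟩⟩
    · rw [div_self h₁.ne', sub_self]
    · rw [div_le_one h1, le_div_iff₀ hb₂]; exact hD.le
    · have := (one_le_div h1).2 h2; linarith
    · field_simp; ring
  rcases le_or_gt b₂ A₁ with hb | hb
  · rcases le_or_gt b₁ A₂ with hb' | hb'
    · refine ⟨A₁, A₂, h₁, hA₁, h₂, hA₂, Or.inl ⟨?_, by positivity, ?_⟩,
        Or.inl ⟨?_, by positivity, ?_⟩⟩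
      · rw [div_self h₁.ne', sub_self]
      · rwa [div_le_one h₂]
      · rw [div_self h₂.ne', sub_self]
      · rwa [div_le_one h₁]
    · obtain ⟨α₂, α₁, g1, g2, g3, g4, g5, g6⟩ := key hA₂ hA₁ h₂ h₁ hb₂ hb₁ (by linarith) hb'
      exact ⟨α₁, α₂, g3, g4, g1, g2, g6, g5⟩
  · exact key hA₁ hA₂ h₁ h₂ hb₁ hb₂ hD hb

/-! ### Comparison for classical solutions -/

/-- Bounds for the coefficients on the time interval `(τ, T]`. -/
def CoeffBounds (k h : Fin 2 → ℝ → ℝ) (τ T κ m H : ℝ) : Prop :=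
  ∀ i, ∀ t ∈ Ioc τ T, (0 ≤ k i t ∧ k i t ≤ κ) ∧ (m ≤ h i t ∧ h i t ≤ H)

lemma CoeffBounds.mono {k h : Fin 2 → ℝ → ℝ} {τ τ' T κ m H : ℝ} (hc : CoeffBounds k h τ T κ m H)
    (hτ : τ ≤ τ') : CoeffBounds k h τ' T κ m H := fun i t ht => hc i t ⟨hτ.trans_lt ht.1, ht.2⟩

/-- `u` is bounded below by positive constants away from `t = 0`. -/
def PositiveBelow (T : ℝ) (u : Fin 2 → ℝ → EuclideanSpace ℝ (Fin n) → ℝ) : Prop :=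
  ∀ τ ∈ Ioc 0 T, ∃ δ > 0, ∀ i, ∀ t ∈ Icc τ T, ∀ x, δ ≤ u i t x

lemma PositiveBelow.pos {T : ℝ} {u : Fin 2 → ℝ → 𝔼 → ℝ} (hu : PositiveBelow T u) (i : Fin 2)
    {t : ℝ} (ht : t ∈ Ioc 0 T) (x : 𝔼) : 0 < u i t x := by
  obtain ⟨δ, hδ, h⟩ := hu t ht
  exact hδ.trans_le (h i t ⟨le_rfl, ht.2⟩ x)

lemma reaction_nonneg {p : Fin 2 → Fin 2 → ℝ} {u : Fin 2 → ℝ → 𝔼 → ℝ} {t : ℝ} {x : 𝔼}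
    (hu : ∀ i, 0 ≤ u i t x) (i : Fin 2) : 0 ≤ reaction p u i t x :=
  mul_nonneg (Real.rpow_nonneg (hu _) _) (Real.rpow_nonneg (hu _) _)

lemma reaction_le_reaction {p : Fin 2 → Fin 2 → ℝ} (hp : ∀ i j, 0 ≤ p i j)
    {u v : Fin 2 → ℝ → 𝔼 → ℝ} {t : ℝ} {x : 𝔼} (hu : ∀ i, 0 ≤ u i t x)
    (h : ∀ i, u i t x ≤ v i t x) (i : Fin 2) : reaction p u i t x ≤ reaction p v i t x :=
  mul_le_mul (Real.rpow_le_rpow (hu _) (h _) (hp _ _)) (Real.rpow_le_rpow (hu _) (h _) (hp _ _))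
    (Real.rpow_nonneg (hu _) _) (Real.rpow_nonneg ((hu _).trans (h _)) _)

/-- Comparison of a subsolution `v` with a supersolution `z = ψ(t, u)`, `ψ` concave in `u`, which
is bounded away from zero, so that the reaction is Lipschitz at `z`. -/
theorem le_of_subsolution_of_supersolution {k h : Fin 2 → ℝ → ℝ} {p : Fin 2 → Fin 2 → ℝ}
    {τ T κ m H δ M : ℝ} {v u z ρ dv dz : Fin 2 → ℝ → 𝔼 → ℝ} (hp : ∀ i j, 0 ≤ p i j)
    (hm : 0 ≤ m) (hc : CoeffBounds k h τ T κ m H)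
    (hvc : ∀ i, ContinuousOn (Function.uncurry (v i)) (Icc τ T ×ˢ univ))
    (hzc : ∀ i, ContinuousOn (Function.uncurry (z i)) (Icc τ T ×ˢ univ))
    (hv0 : ∀ i, ∀ t ∈ Icc τ T, ∀ x, 0 ≤ v i t x) (hvM : ∀ i, ∀ t ∈ Icc τ T, ∀ x, v i t x ≤ M)
    (hδ : 0 < δ) (hzδ : ∀ i, ∀ t ∈ Icc τ T, ∀ x, δ ≤ z i t x)
    (hzM : ∀ i, ∀ t ∈ Icc τ T, ∀ x, z i t x ≤ M) (h0 : ∀ i x, v i τ x ≤ z i τ x)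
    (hv2 : ∀ i, ∀ t ∈ Ioc τ T, ContDiff ℝ 2 (v i t))
    (hu2 : ∀ i, ∀ t ∈ Ioc τ T, ContDiff ℝ 2 (u i t))
    (hdv : ∀ i, ∀ t ∈ Ioc τ T, ∀ x, HasDerivWithinAt (fun s => v i s x) (dv i t x) (Iic t) t)
    (hdz : ∀ i, ∀ t ∈ Ioc τ T, ∀ x, HasDerivWithinAt (fun s => z i s x) (dz i t x) (Iic t) t)
    (hρ : ∀ i, ∀ t ∈ Ioc τ T, ∀ x y, z i t y ≤ z i t x + ρ i t x * (u i t y - u i t x))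
    (hsub : ∀ i, ∀ t ∈ Ioc τ T, ∀ x,
      dv i t x ≤ k i t * Laplacian.laplacian (v i t) x + h i t * reaction p v i t x)
    (hsup : ∀ i, ∀ t ∈ Ioc τ T, ∀ x,
      k i t * (ρ i t x * Laplacian.laplacian (u i t) x) + h i t * reaction p z i t x ≤ dz i t x) :
    ∀ i, ∀ t ∈ Icc τ T, ∀ x, v i t x ≤ z i t x := by
  rcases lt_or_ge T τ with hT | hT
  · intro i t ht
    exact absurd (ht.1.trans ht.2) (not_le.2 hT)
  have hδM : δ ≤ M := (hzδ 0 τ ⟨le_rfl, hT⟩ 0).trans (hzM 0 τ ⟨le_rfl, hT⟩ 0)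
  choose L hL0 hL using fun i => exists_rpow_mul_rpow_lipschitz (hp i i) (hp i (1 - i)) hδ
    (by linarith : δ ≤ 2 * M)
  have hLi : ∀ i, L i ≤ L 0 + L 1 := by
    intro i
    have := hL0 0
    have := hL0 1
    fin_cases i <;> simp <;> linarith
  have hH : 0 ≤ |H| := abs_nonneg H
  refine le_of_comparison (L := |H| * (L 0 + L 1)) (B := M) (fun i t ht => (hc i t ht).1.1)
    (fun i t ht => (hc i t ht).1.2) hvc hzc (fun i t ht x => ?_) h0 hv2 hu2 hdv hdz hρ
    (fun i t ht x hlt hmax => ?_)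
  · linarith [hvM i t ht x, hzδ i t ht x]
  have ht' : t ∈ Icc τ T := Ioc_subset_Icc_self ht
  -- `v ≤ z + d` in both components, and the reaction is Lipschitz along `(d, d)` at `z ≥ δ`.
  set d := v i t x - z i t x with hd
  have hd0 : 0 < d := sub_pos.2 hlt
  have h1 := hL i (z i t x) (z (1 - i) t x) d (hzδ i t ht' x) (hzδ _ t ht' x) hd0.le
    (by linarith [hvM i t ht' x])
    (by linarith [hvM i t ht' x, hzM (1 - i) t ht' x, hzδ i t ht' x])
  have h2 : reaction p v i t x ≤ reaction p z i t x + L i * d := by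
    refine le_trans ?_ h1
    have h3 := hmax (1 - i)
    refine mul_le_mul (Real.rpow_le_rpow (hv0 _ t ht' x) (by linarith) (hp _ _))
      (Real.rpow_le_rpow (hv0 _ t ht' x) (by linarith) (hp _ _))
      (Real.rpow_nonneg (hv0 _ t ht' x) _) (Real.rpow_nonneg ?_ _)
    linarith [hzδ i t ht' x]
  have hh0 : 0 ≤ h i t := hm.trans (hc i t ht).2.1
  have hhH : h i t ≤ |H| := (hc i t ht).2.2.trans (le_abs_self H)
  have h4 : h i t * (L i * d) ≤ |H| * (L 0 + L 1) * d := by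
    rw [mul_assoc]
    have := hLi i
    have := hL0 i
    gcongr
  have h5 := mul_le_mul_of_nonneg_left h2 hh0
  linarith [hsub i t ht x, hsup i t ht x]

section Classical

variable {k h : Fin 2 → ℝ → ℝ} {p : Fin 2 → Fin 2 → ℝ} {φ : Fin 2 → EuclideanSpace ℝ (Fin n) → ℝ}
  {T κ m H : ℝ} {u v : Fin 2 → ℝ → EuclideanSpace ℝ (Fin n) → ℝ}

lemma IsC12.hasDerivWithinAt {f : ℝ → 𝔼 → ℝ} (hf : IsC12 T f) {t : ℝ} (ht : t ∈ Ioc 0 T) (x : 𝔼) :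
    HasDerivWithinAt (fun s => f s x) (derivWithin (fun s => f s x) (Ioc 0 T) t) (Iic t) t :=
  (hf.differentiable_time t ht x).hasDerivWithinAt.mono_of_mem_nhdsWithin
    (mem_of_superset (Ioc_mem_nhdsLE ht.1) (Ioc_subset_Ioc_right ht.2))

lemma IsClassicalSolution.hasDerivWithinAt (hu : IsClassicalSolution k h p φ T u) (i : Fin 2)
    {t : ℝ} (ht : t ∈ Ioc 0 T) (x : 𝔼) :
    HasDerivWithinAt (fun s => u i s x)
      (k i t * Laplacian.laplacian (u i t) x + h i t * reaction p u i t x) (Iic t) t := by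
  rw [← hu.equation i t ht x]
  exact (hu.isC12 i).hasDerivWithinAt ht x

lemma IsClassicalSolution.exists_bound (hu : IsClassicalSolution k h p φ T u) :
    ∃ M, 0 < M ∧ ∀ i, ∀ t ∈ Icc 0 T, ∀ x, 0 ≤ u i t x ∧ u i t x ≤ M := by
  obtain ⟨M, hM⟩ := hu.nonnegBounded
  exact ⟨max M 1, by positivity, fun i t ht x =>
    ⟨(hM i t ht x).1, (hM i t ht x).2.trans (le_max_left _ _)⟩⟩

/-- The key comparison: `v_i ≤ (u_i ^ α_i + e_i) ^ (1 / α_i)`, provided that `e_i` grows fast enough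
to absorb the increment of the reaction terms, written in the variables `u_i ^ α_i`. -/
theorem le_rpow_add_of_increment (hp : ∀ i j, 0 ≤ p i j) (hm : 0 ≤ m)
    (hc : CoeffBounds k h 0 T κ m H) (hu : IsClassicalSolution k h p φ T u)
    (hv : IsClassicalSolution k h p φ T v) (hpos : PositiveBelow T u) {α : Fin 2 → ℝ}
    (hα0 : ∀ i, 0 < α i) (hα1 : ∀ i, α i ≤ 1) {e e' : Fin 2 → ℝ → ℝ} {e₀ E : ℝ} (he₀ : 0 < e₀)
    (he : ∀ i, ∀ t ∈ Icc 0 T, e₀ ≤ e i t) (heE : ∀ i, ∀ t ∈ Icc 0 T, e i t ≤ E)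
    (hec : ∀ i, ContinuousOn (e i) (Icc 0 T))
    (hed : ∀ i, ∀ t ∈ Ioc 0 T, HasDerivWithinAt (e i) (e' i t) (Iic t) t)
    (hinc : ∀ i, ∀ t ∈ Ioc 0 T, ∀ x, α i * h i t *
      ((u i t x ^ α i + e i t) ^ (1 - (1 - p i i) / α i) *
          (u (1 - i) t x ^ α (1 - i) + e (1 - i) t) ^ (p i (1 - i) / α (1 - i)) -
        (u i t x ^ α i) ^ (1 - (1 - p i i) / α i) *
          (u (1 - i) t x ^ α (1 - i)) ^ (p i (1 - i) / α (1 - i))) ≤ e' i t) :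
    ∀ i, ∀ t ∈ Icc 0 T, ∀ x, v i t x ≤ (u i t x ^ α i + e i t) ^ (1 / α i) := by
  rcases lt_or_ge T 0 with hT | hT
  · intro i t ht
    exact absurd (ht.1.trans ht.2) (not_le.2 hT)
  obtain ⟨Mu, hMu0, hMu⟩ := hu.exists_bound
  obtain ⟨Mv, hMv0, hMv⟩ := hv.exists_bound
  have hE : 0 < E := he₀.trans_le ((he 0 0 ⟨le_rfl, hT⟩).trans (heE 0 0 ⟨le_rfl, hT⟩))
  have he0 : ∀ i, ∀ t ∈ Icc 0 T, 0 < e i t := fun i t ht => he₀.trans_le (he i t ht)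
  obtain ⟨δ, hδ, hδ'⟩ : ∃ δ > 0, ∀ i, δ ≤ e₀ ^ (1 / α i) :=
    ⟨min (e₀ ^ (1 / α 0)) (e₀ ^ (1 / α 1)), by positivity, fun i => by fin_cases i <;> simp⟩
  obtain ⟨Mz, hMz0, hMz⟩ : ∃ Mz > 0, ∀ i, (Mu ^ α i + E) ^ (1 / α i) ≤ Mz := by
    refine ⟨(Mu ^ α 0 + E) ^ (1 / α 0) + (Mu ^ α 1 + E) ^ (1 / α 1), by positivity, fun i => ?_⟩
    have h0 : 0 ≤ (Mu ^ α 0 + E) ^ (1 / α 0) := by positivity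
    have h1 : 0 ≤ (Mu ^ α 1 + E) ^ (1 / α 1) := by positivity
    fin_cases i <;> simp only [Fin.zero_eta, Fin.mk_one] <;> linarith
  have hα' : ∀ i, 0 ≤ 1 / α i := fun i => (one_div_pos.2 (hα0 i)).le
  refine le_of_subsolution_of_supersolution (k := k) (h := h) (u := u) (δ := δ) (M := Mz + Mv)
    (ρ := fun i t x => (u i t x ^ α i + e i t) ^ (1 / α i - 1) * u i t x ^ (α i - 1))
    (dv := fun i t x => k i t * Laplacian.laplacian (v i t) x + h i t * reaction p v i t x)
    (dz := fun i t x => (1 / α i) * (u i t x ^ α i + e i t) ^ (1 / α i - 1) *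
      (α i * u i t x ^ (α i - 1) *
        (k i t * Laplacian.laplacian (u i t) x + h i t * reaction p u i t x) + e' i t))
    hp hm hc (fun i => hv.continuousOn i) (fun i => ?_) (fun i t ht x => (hMv i t ht x).1)
    (fun i t ht x => by linarith [(hMv i t ht x).2]) hδ (fun i t ht x => ?_)
    (fun i t ht x => ?_) (fun i x => ?_) (fun i t ht => (hv.isC12 i).contDiff_space t ht)
    (fun i t ht => (hu.isC12 i).contDiff_space t ht) (fun i t ht x => hv.hasDerivWithinAt i ht x)
    (fun i t ht x => ?_) (fun i t ht x y => ?_) (fun i t ht x => le_rfl) (fun i t ht x => ?_)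
  · have h1 : ContinuousOn (fun q : ℝ × 𝔼 => u i q.1 q.2 ^ α i) (Icc 0 T ×ˢ univ) :=
      (hu.continuousOn i).rpow_const fun _ _ => Or.inr (hα0 i).le
    have h2 : ContinuousOn (fun q : ℝ × 𝔼 => e i q.1) (Icc 0 T ×ˢ univ) :=
      (hec i).comp continuousOn_fst fun q hq => hq.1
    exact (h1.add h2).rpow_const fun _ _ => Or.inr (hα' i)
  · refine (hδ' i).trans (Real.rpow_le_rpow he₀.le ?_ (hα' i))
    have := Real.rpow_nonneg (hMu i t ht x).1 (α i)
    linarith [he i t ht]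
  · have h1 := Real.rpow_nonneg (hMu i t ht x).1 (α i)
    have h2 := Real.rpow_le_rpow (hMu i t ht x).1 (hMu i t ht x).2 (hα0 i).le
    have h3 := Real.rpow_le_rpow (by linarith [he0 i t ht])
      (add_le_add h2 (heE i t ht)) (hα' i)
    linarith [hMz i]
  · have h0 : (0 : ℝ) ∈ Icc 0 T := ⟨le_rfl, hT⟩
    have hu0 := (hMu i 0 h0 x).1
    rw [hv.initial i x, ← hu.initial i x]
    calc u i 0 x = (u i 0 x ^ α i) ^ (1 / α i) := by
          rw [← Real.rpow_mul hu0, mul_one_div_cancel (hα0 i).ne', Real.rpow_one]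
      _ ≤ _ := Real.rpow_le_rpow (Real.rpow_nonneg hu0 _) (by linarith [he0 i 0 h0]) (hα' i)
  · have hU := hpos.pos i ht x
    have h1 := (hu.hasDerivWithinAt i ht x).rpow_const (p := α i) (Or.inl hU.ne')
    have h2 := (h1.add (hed i t ht)).rpow_const (p := 1 / α i) (Or.inl (by
      have := he0 i t (Ioc_subset_Icc_self ht)
      have := Real.rpow_pos_of_pos hU (α i)
      simp only [Pi.add_apply]
      positivity))
    refine h2.congr_deriv ?_
    simp only [Pi.add_apply]
    ring
  · exact rpow_add_rpow_inv_le_tangent (hα0 i) (hα1 i) (hpos.pos i ht x) (hpos.pos i ht y)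
      (he0 i t (Ioc_subset_Icc_self ht))
  · have ht' := Ioc_subset_Icc_self ht
    have hU := hpos.pos i ht x
    have hV := hpos.pos (1 - i) ht x
    have hα := hα0 i
    have hα2 := hα0 (1 - i)
    have hUα : 0 < u i t x ^ α i := Real.rpow_pos_of_pos hU _
    have hVα : 0 < u (1 - i) t x ^ α (1 - i) := Real.rpow_pos_of_pos hV _
    have hW : 0 < u i t x ^ α i + e i t := by linarith [he0 i t ht']
    have hW2 : 0 < u (1 - i) t x ^ α (1 - i) + e (1 - i) t := by linarith [he0 (1 - i) t ht']
    have hinc' := hinc i t ht x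
    -- With `W = u_i ^ α_i + e_i` the reaction at the supersolution is `W ^ (1 / α_i - 1)` times the
    -- transformed reaction, and `∂_t z_i` carries the same factor.
    have e1 : (u i t x ^ α i) ^ (1 - (1 - p i i) / α i) =
        u i t x ^ (α i - 1) * u i t x ^ p i i := by
      rw [← Real.rpow_mul hU.le, ← Real.rpow_add hU]
      congr 1
      field_simp
      ring
    have e2 : (u (1 - i) t x ^ α (1 - i)) ^ (p i (1 - i) / α (1 - i)) =
        u (1 - i) t x ^ p i (1 - i) := by
      rw [← Real.rpow_mul hV.le, mul_div_cancel₀ _ hα2.ne']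
    have e3 : ((u i t x ^ α i + e i t) ^ (1 / α i)) ^ p i i =
        (u i t x ^ α i + e i t) ^ (1 / α i - 1) *
          (u i t x ^ α i + e i t) ^ (1 - (1 - p i i) / α i) := by
      rw [← Real.rpow_mul hW.le, ← Real.rpow_add hW]
      congr 1
      field_simp
      ring
    have e4 : ((u (1 - i) t x ^ α (1 - i) + e (1 - i) t) ^ (1 / α (1 - i))) ^ p i (1 - i) =
        (u (1 - i) t x ^ α (1 - i) + e (1 - i) t) ^ (p i (1 - i) / α (1 - i)) := by
      rw [← Real.rpow_mul hW2.le]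
      congr 1
      ring
    rw [e1, e2] at hinc'
    simp only [reaction]
    rw [e3, e4]
    set w := (u i t x ^ α i + e i t) ^ (1 / α i - 1)
    have hw : 0 < w := Real.rpow_pos_of_pos hW _
    set X := (u i t x ^ α i + e i t) ^ (1 - (1 - p i i) / α i) *
      (u (1 - i) t x ^ α (1 - i) + e (1 - i) t) ^ (p i (1 - i) / α (1 - i)) with hX
    have h6 := mul_le_mul_of_nonneg_left hinc' (by positivity : 0 ≤ 1 / α i * w)
    have e5 : 1 / α i * w * (α i * h i t * (X - u i t x ^ (α i - 1) * u i t x ^ p i i *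
        u (1 - i) t x ^ p i (1 - i))) = w * h i t * (X - u i t x ^ (α i - 1) * u i t x ^ p i i *
        u (1 - i) t x ^ p i (1 - i)) := by field_simp
    have e6 : 1 / α i * w * (α i * u i t x ^ (α i - 1) *
        (k i t * Laplacian.laplacian (u i t) x + h i t * (u i t x ^ p i i *
        u (1 - i) t x ^ p i (1 - i))) + e' i t) = w * u i t x ^ (α i - 1) *
        (k i t * Laplacian.laplacian (u i t) x + h i t * (u i t x ^ p i i *
        u (1 - i) t x ^ p i (1 - i))) + 1 / α i * w * e' i t := by field_simp
    rw [e5] at h6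
    rw [e6]
    rw [hX] at h6
    linarith

end Classical

/-! ### Uniqueness of classical solutions -/

section Uniqueness

variable {k h : Fin 2 → ℝ → ℝ} {p : Fin 2 → Fin 2 → ℝ} {φ : Fin 2 → EuclideanSpace ℝ (Fin n) → ℝ}
  {T κ m H : ℝ} {u v : Fin 2 → ℝ → EuclideanSpace ℝ (Fin n) → ℝ}

/-- If powers of the solutions turn the reaction terms into functions with linearly bounded
increments, then the comparison holds with `e = ε exp (λ t)` for every small `ε`. -/
lemma le_of_linearIncrement (hp : ∀ i j, 0 ≤ p i j) (hT : 0 < T) (hm : 0 ≤ m)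
    (hc : CoeffBounds k h 0 T κ m H) (hu : IsClassicalSolution k h p φ T u)
    (hv : IsClassicalSolution k h p φ T v) (hpos : PositiveBelow T u) {α : Fin 2 → ℝ}
    (hα0 : ∀ i, 0 < α i) (hα1 : ∀ i, α i ≤ 1)
    (hinc : ∀ i, LinearIncrement (1 - (1 - p i i) / α i) (p i (1 - i) / α (1 - i))) :
    ∀ i, ∀ t ∈ Icc 0 T, ∀ x, v i t x ≤ u i t x := by
  obtain ⟨M, hM0, hM⟩ := hu.exists_bound
  set R := max (M ^ α 0) (M ^ α 1) with hR
  have hR0 : 0 < R := lt_max_of_lt_left (by positivity)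
  have hRi : ∀ i, M ^ α i ≤ R := fun i => by fin_cases i <;> simp [hR]
  choose C hC0 hC using fun i => (hinc i).exists_le hR0
  have hCi : ∀ i, C i ≤ C 0 + C 1 := fun i => by
    have := hC0 0
    have := hC0 1
    fin_cases i <;> simp <;> linarith
  have hC01 : 0 ≤ C 0 + C 1 := add_nonneg (hC0 0) (hC0 1)
  have hH : 0 ≤ H := hm.trans
    ((hc 0 T ⟨hT, le_rfl⟩).2.1.trans (hc 0 T ⟨hT, le_rfl⟩).2.2)
  set lam := H * (C 0 + C 1) with hlam
  have hlam0 : 0 ≤ lam := by positivity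
  have key : ∀ ε, 0 < ε → ε ≤ Real.exp (-(lam * T)) → ∀ i, ∀ t ∈ Icc 0 T, ∀ x,
      v i t x ≤ (u i t x ^ α i + ε * Real.exp (lam * t)) ^ (1 / α i) := by
    intro ε hε hεle
    have he1 : ∀ t ∈ Icc 0 T, ε * Real.exp (lam * t) ≤ 1 := by
      intro t ht
      calc ε * Real.exp (lam * t) ≤ Real.exp (-(lam * T)) * Real.exp (lam * T) := by
            have := ht.2
            gcongr
        _ = 1 := by rw [← Real.exp_add]; simp
    refine le_rpow_add_of_increment hp hm hc hu hv hpos hα0 hα1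
      (e := fun _ t => ε * Real.exp (lam * t)) (e' := fun _ t => lam * (ε * Real.exp (lam * t)))
      (e₀ := ε) (E := 1) hε (fun i t ht => ?_) (fun i t ht => he1 t ht) (fun i => by fun_prop)
      (fun i t ht => ?_) (fun i t ht x => ?_)
    · exact le_mul_of_one_le_right hε.le (Real.one_le_exp (mul_nonneg hlam0 ht.1))
    · have h1 := ((((hasDerivAt_id t).const_mul lam).exp).const_mul ε).hasDerivWithinAt (s := Iic t)
      refine h1.congr_deriv ?_
      simp; ring
    · have ht' := Ioc_subset_Icc_self ht
      have hb : ∀ j, 0 < u j t x ^ α j ∧ u j t x ^ α j ≤ R := fun j =>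
        ⟨Real.rpow_pos_of_pos (hpos.pos j ht x) _,
          (Real.rpow_le_rpow (hM j t ht' x).1 (hM j t ht' x).2 (hα0 j).le).trans (hRi j)⟩
      have h1 := hC i _ _ _ (hb i).1 (hb i).2 (hb (1 - i)).1 (hb (1 - i)).2
        (by positivity) (he1 t ht')
      have hh0 : 0 ≤ h i t := hm.trans (hc i t ht).2.1
      have hα := hα0 i
      refine (mul_le_mul_of_nonneg_left h1 (by positivity)).trans ?_
      rw [← mul_assoc, hlam]
      have h2 : α i * h i t * C i ≤ 1 * H * (C 0 + C 1) := by
        have := hα1 i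
        have := (hc i t ht).2.2
        have := hCi i
        have := hC0 i
        gcongr
      rw [one_mul] at h2
      gcongr
  intro i t ht x
  have hα' : 0 ≤ 1 / α i := (one_div_pos.2 (hα0 i)).le
  have hlim : Tendsto (fun ε => (u i t x ^ α i + ε * Real.exp (lam * t)) ^ (1 / α i))
      (𝓝[>] 0) (𝓝 (u i t x)) := by
    have h1 : Continuous fun ε => (u i t x ^ α i + ε * Real.exp (lam * t)) ^ (1 / α i) :=
      (by fun_prop : Continuous fun ε => u i t x ^ α i + ε * Real.exp (lam * t)).rpow_const
        fun _ => Or.inr hα'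
    have h2 := h1.tendsto 0
    simp only [zero_mul, add_zero] at h2
    rw [← Real.rpow_mul (hM i t ht x).1, mul_one_div_cancel (hα0 i).ne', Real.rpow_one] at h2
    exact h2.mono_left nhdsWithin_le_nhds
  refine ge_of_tendsto hlim ?_
  filter_upwards [Ioc_mem_nhdsGT (Real.exp_pos (-(lam * T)))] with ε hε
  exact key ε hε.1 hε.2 i t ht x

/-- In the strictly sublinear case a positive solution grows at least like `t ^ g_i`, since
`(c t) ^ g_i` are spatially constant subsolutions which leave zero at `t = 0`. -/
lemma rpow_le_of_sublinear (hp : ∀ i j, 0 ≤ p i j) (hm : 0 < m)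
    (hc : CoeffBounds k h 0 T κ m H) (hu : IsClassicalSolution k h p φ T u)
    (hpos : PositiveBelow T u) {g : Fin 2 → ℝ} (hg1 : ∀ i, 1 ≤ g i)
    (hg : ∀ i, p i i * g i + p i (1 - i) * g (1 - i) = g i - 1) {c : ℝ} (hc0 : 0 < c)
    (hcg : ∀ i, g i * c ≤ m) :
    ∀ i, ∀ t ∈ Ioc 0 T, ∀ x, (c * t) ^ g i ≤ u i t x := by
  obtain ⟨M, hM0, hM⟩ := hu.exists_bound
  have hg0 : ∀ i, 0 < g i := fun i => one_pos.trans_le (hg1 i)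
  have key : ∀ τ ∈ Ioc 0 T, ∀ i, ∀ t ∈ Icc τ T, ∀ x, (c * (t - τ)) ^ g i ≤ u i t x := by
    intro τ hτ
    obtain ⟨δ, hδ, hδu⟩ := hpos τ hτ
    have hsub : ∀ {t}, t ∈ Icc τ T → t ∈ Icc 0 T := fun ht => ⟨hτ.1.le.trans ht.1, ht.2⟩
    have hsub' : ∀ {t}, t ∈ Ioc τ T → t ∈ Ioc 0 T := fun ht => ⟨hτ.1.trans ht.1, ht.2⟩
    have hbase : ∀ {t}, t ∈ Icc τ T → 0 ≤ c * (t - τ) := fun ht =>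
      mul_nonneg hc0.le (sub_nonneg.2 ht.1)
    obtain ⟨M', hM'⟩ : ∃ M', ∀ i, (c * (T - τ)) ^ g i ≤ M' :=
      ⟨max ((c * (T - τ)) ^ g 0) ((c * (T - τ)) ^ g 1), fun i => by fin_cases i <;> simp⟩
    refine le_of_subsolution_of_supersolution (k := k) (h := h) (p := p) (u := u) (κ := κ) (m := m)
      (H := H) (δ := δ)
      (M := max M M') (v := fun i t _ => (c * (t - τ)) ^ g i) (ρ := fun _ _ _ => 1)
      (dv := fun i t _ => g i * c * (c * (t - τ)) ^ (g i - 1))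
      (dz := fun i t x => k i t * Laplacian.laplacian (u i t) x + h i t * reaction p u i t x)
      hp hm.le (hc.mono hτ.1.le) (fun i => ?_)
      (fun i => (hu.continuousOn i).mono (prod_mono (fun t ht => hsub ht) subset_rfl))
      (fun i t ht x => Real.rpow_nonneg (hbase ht) _) (fun i t ht x => ?_) hδ
      (fun i t ht x => hδu i t ht x) (fun i t ht x => (hM i t (hsub ht) x).2.trans
        (le_max_left _ _)) (fun i x => ?_) (fun i t ht => contDiff_const)
      (fun i t ht => (hu.isC12 i).contDiff_space t (hsub' ht)) (fun i t ht x => ?_)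
      (fun i t ht x => hu.hasDerivWithinAt i (hsub' ht) x) (fun i t ht x y => by linarith)
      (fun i t ht x => ?_) (fun i t ht x => by rw [one_mul])
    · refine Continuous.continuousOn ?_
      exact (by fun_prop : Continuous fun q : ℝ × 𝔼 => c * (q.1 - τ)).rpow_const
        fun _ => Or.inr (hg0 i).le
    · refine (Real.rpow_le_rpow (hbase ht) ?_ (hg0 i).le).trans ((hM' i).trans (le_max_right _ _))
      have := ht.2
      gcongr
    · simp only [sub_self, mul_zero, Real.zero_rpow (hg0 i).ne']
      exact hδ.le.trans (hδu i τ ⟨le_rfl, hτ.2⟩ x)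
    · have h1 : HasDerivAt (fun s => c * (s - τ)) c t := by
        simpa using ((hasDerivAt_id t).sub_const τ).const_mul c
      refine ((h1.rpow_const (p := g i) (Or.inr (hg1 i))).hasDerivWithinAt).congr_deriv ?_
      ring
    · have h1 : (0 : ℝ) < c * (t - τ) := mul_pos hc0 (sub_pos.2 ht.1)
      have h2 : Laplacian.laplacian (fun _ : 𝔼 => (c * (t - τ)) ^ g i) x = 0 := by
        rw [laplacian_eq_sum_of_hasFDerivAt (g' := fun _ => 0) (g'' := fun _ => 0)
          (fun x => hasFDerivAt_const _ _) (fun x => hasFDerivAt_const _ _)]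
        simp
      have h3 : reaction p (fun i t (_ : 𝔼) => (c * (t - τ)) ^ g i) i t x =
          (c * (t - τ)) ^ (g i - 1) := by
        simp only [reaction]
        rw [← Real.rpow_mul h1.le, ← Real.rpow_mul h1.le, ← Real.rpow_add h1, ← hg i]
        congr 1; ring
      rw [h2, h3, mul_zero, zero_add]
      have := (hcg i).trans (hc i t (hsub' ht)).2.1
      gcongr
  intro i t ht x
  have hlim : Tendsto (fun τ => (c * (t - τ)) ^ g i) (𝓝[>] 0) (𝓝 ((c * t) ^ g i)) := by
    have h1 : Continuous fun τ => (c * (t - τ)) ^ g i :=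
      (by fun_prop : Continuous fun τ => c * (t - τ)).rpow_const fun _ => Or.inr (hg0 i).le
    have h2 := h1.tendsto 0
    rw [sub_zero] at h2
    exact h2.mono_left nhdsWithin_le_nhds
  refine le_of_tendsto hlim ?_
  filter_upwards [Ioc_mem_nhdsGT ht.1] with τ hτ
  exact key τ ⟨hτ.1, hτ.2.trans ht.2⟩ i t ⟨hτ.2, ht.2⟩ x

/-- In the strictly sublinear case, solutions with the same initial value differ by at most a
perturbation of the growth rate `t ^ g_i`. -/
lemma le_rpow_add_of_sublinear (hp : ∀ i j, 0 ≤ p i j) (hT : 0 < T) (hm : 0 < m)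
    (hc : CoeffBounds k h 0 T κ m H) (hu : IsClassicalSolution k h p φ T u)
    (hv : IsClassicalSolution k h p φ T v) (hpos : PositiveBelow T u) {g : Fin 2 → ℝ}
    (hg1 : ∀ i, 1 ≤ g i) (hg : ∀ i, p i i * g i + p i (1 - i) * g (1 - i) = g i - 1)
    {α : Fin 2 → ℝ} (hα0 : ∀ i, 0 < α i) (hα1 : ∀ i, α i ≤ 1)
    (hinc : ∀ i, SubadditiveIncrement (1 - (1 - p i i) / α i) (p i (1 - i) / α (1 - i))) :
    ∀ i, ∀ t ∈ Icc 0 T, ∀ x,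
      v i t x ≤ (u i t x ^ α i + (H * t) ^ (α i * g i)) ^ (1 / α i) := by
  have hH : 0 < H := hm.trans_le
    ((hc 0 T ⟨hT, le_rfl⟩).2.1.trans (hc 0 T ⟨hT, le_rfl⟩).2.2)
  have hβ : ∀ i, 0 < α i * g i := fun i => mul_pos (hα0 i) (one_pos.trans_le (hg1 i))
  have key : ∀ s, 0 < s → ∀ i, ∀ t ∈ Icc 0 T, ∀ x,
      v i t x ≤ (u i t x ^ α i + (H * (t + s)) ^ (α i * g i)) ^ (1 / α i) := by
    intro s hs
    have hb : ∀ {t}, t ∈ Icc 0 T → 0 < H * (t + s) := fun ht =>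
      mul_pos hH (by linarith [ht.1])
    refine le_rpow_add_of_increment hp hm.le hc hu hv hpos hα0 hα1
      (e := fun i t => (H * (t + s)) ^ (α i * g i))
      (e' := fun i t => α i * g i * H * (H * (t + s)) ^ (α i * g i - 1))
      (e₀ := min ((H * s) ^ (α 0 * g 0)) ((H * s) ^ (α 1 * g 1)))
      (E := max ((H * (T + s)) ^ (α 0 * g 0)) ((H * (T + s)) ^ (α 1 * g 1)))
      (by positivity) (fun i t ht => ?_) (fun i t ht => ?_) (fun i => ?_)
      (fun i t ht => ?_) (fun i t ht x => ?_)
    · have h1 : (H * s) ^ (α i * g i) ≤ (H * (t + s)) ^ (α i * g i) := by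
        have := ht.1
        have := hβ i
        gcongr
        linarith
      refine le_trans ?_ h1
      fin_cases i <;> simp
    · have h1 : (H * (t + s)) ^ (α i * g i) ≤ (H * (T + s)) ^ (α i * g i) :=
        Real.rpow_le_rpow (hb ht).le (by have := ht.2; gcongr) (hβ i).le
      refine h1.trans ?_
      fin_cases i <;> simp
    · exact ((by fun_prop : Continuous fun t => H * (t + s)).rpow_const
        fun _ => Or.inr (hβ i).le).continuousOn
    · have h1 : HasDerivAt (fun t => H * (t + s)) H t := by
        simpa using ((hasDerivAt_id t).add_const s).const_mul H
      refine ((h1.rpow_const (p := α i * g i)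
        (Or.inl (hb (Ioc_subset_Icc_self ht)).ne')).hasDerivWithinAt).congr_deriv ?_
      ring
    · have hbt := hb (Ioc_subset_Icc_self ht)
      have h1 := (hinc i).le (Real.rpow_pos_of_pos (hpos.pos i ht x) (α i))
        (Real.rpow_pos_of_pos (hpos.pos (1 - i) ht x) (α (1 - i)))
        (Real.rpow_pos_of_pos hbt (α i * g i)) (Real.rpow_pos_of_pos hbt (α (1 - i) * g (1 - i)))
      have h2 : ((H * (t + s)) ^ (α i * g i)) ^ (1 - (1 - p i i) / α i) *
          ((H * (t + s)) ^ (α (1 - i) * g (1 - i))) ^ (p i (1 - i) / α (1 - i)) =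
          (H * (t + s)) ^ (α i * g i - 1) := by
        rw [← Real.rpow_mul hbt.le, ← Real.rpow_mul hbt.le, ← Real.rpow_add hbt]
        congr 1
        have := hα0 i
        have := hα0 (1 - i)
        have := hg i
        field_simp
        linarith
      rw [h2] at h1
      have hh0 : 0 ≤ h i t := hm.le.trans (hc i t ht).2.1
      have hα := hα0 i
      refine (mul_le_mul_of_nonneg_left h1 (by positivity)).trans ?_
      have h3 : α i * h i t ≤ α i * g i * H := by
        rw [mul_assoc]
        have h4 := (hc i t ht).2.2
        have h5 := le_mul_of_one_le_left hH.le (hg1 i)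
        gcongr
        linarith
      gcongr
  intro i t ht x
  have hlim : Tendsto (fun s => (u i t x ^ α i + (H * (t + s)) ^ (α i * g i)) ^ (1 / α i))
      (𝓝[>] 0) (𝓝 ((u i t x ^ α i + (H * t) ^ (α i * g i)) ^ (1 / α i))) := by
    have h1 : Continuous fun s => (u i t x ^ α i + (H * (t + s)) ^ (α i * g i)) ^ (1 / α i) :=
      (continuous_const.add ((by fun_prop : Continuous fun s => H * (t + s)).rpow_const
        fun _ => Or.inr (hβ i).le)).rpow_const fun _ => Or.inr (one_div_pos.2 (hα0 i)).le
    have h2 := h1.tendsto 0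
    rw [add_zero] at h2
    exact h2.mono_left nhdsWithin_le_nhds
  refine ge_of_tendsto hlim ?_
  filter_upwards [self_mem_nhdsWithin] with s hs
  exact key s hs i t ht x

/-- A multiplicative bound `v_i ≤ λ ^ g_i u_i` improves: the reaction of `λ ^ g_i u_i` is
`λ ^ (g_i - 1)` times that of `u_i`, because the exponents `g_i` are homogeneous. -/
lemma le_rpow_sub_one_mul (hp : ∀ i j, 0 ≤ p i j) (hm : 0 ≤ m)
    (hc : CoeffBounds k h 0 T κ m H) (hu : IsClassicalSolution k h p φ T u)
    (hv : IsClassicalSolution k h p φ T v) {g : Fin 2 → ℝ}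
    (hg1 : ∀ i, 1 ≤ g i) (hg : ∀ i, p i i * g i + p i (1 - i) * g (1 - i) = g i - 1)
    {lam : ℝ} (hlam : 1 ≤ lam) (hle : ∀ i, ∀ t ∈ Icc 0 T, ∀ x, v i t x ≤ lam ^ g i * u i t x) :
    ∀ i, ∀ t ∈ Icc 0 T, ∀ x, v i t x ≤ lam ^ (g i - 1) * u i t x := by
  rcases lt_or_ge T 0 with hT | hT
  · intro i t ht
    exact absurd (ht.1.trans ht.2) (not_le.2 hT)
  obtain ⟨Mu, hMu0, hMu⟩ := hu.exists_bound
  obtain ⟨Mv, hMv0, hMv⟩ := hv.exists_bound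
  have hlam0 : 0 < lam := one_pos.trans_le hlam
  refine le_of_comparison (u := u) (z := fun i t x => lam ^ (g i - 1) * u i t x)
    (ρ := fun i _ _ => lam ^ (g i - 1)) (L := 0) (B := Mv)
    (dv := fun i t x => k i t * Laplacian.laplacian (v i t) x + h i t * reaction p v i t x)
    (dz := fun i t x => lam ^ (g i - 1) *
      (k i t * Laplacian.laplacian (u i t) x + h i t * reaction p u i t x))
    (fun i t ht => (hc i t ht).1.1) (fun i t ht => (hc i t ht).1.2)
    (fun i => hv.continuousOn i) (fun i => continuousOn_const.mul (hu.continuousOn i))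
    (fun i t ht x => ?_) (fun i x => ?_) (fun i t ht => (hv.isC12 i).contDiff_space t ht)
    (fun i t ht => (hu.isC12 i).contDiff_space t ht) (fun i t ht x => hv.hasDerivWithinAt i ht x)
    (fun i t ht x => (hu.hasDerivWithinAt i ht x).const_mul _)
    (fun i t ht x y => le_of_eq (by ring)) (fun i t ht x _ _ => ?_)
  · have := (hMv i t ht x).2
    have := mul_nonneg (Real.rpow_nonneg hlam0.le (g i - 1)) (hMu i t ht x).1
    linarith
  · rw [hv.initial i x, ← hu.initial i x]
    exact le_mul_of_one_le_left (hMu i 0 ⟨le_rfl, hT⟩ x).1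
      (Real.one_le_rpow hlam (sub_nonneg.2 (hg1 i)))
  · have ht' := Ioc_subset_Icc_self ht
    have h1 := reaction_le_reaction hp (u := v) (v := fun i t x => lam ^ g i * u i t x) (t := t)
      (x := x) (fun i => (hMv i t ht' x).1) (fun i => hle i t ht' x) i
    have h2 : reaction p (fun i t x => lam ^ g i * u i t x) i t x =
        lam ^ (g i - 1) * reaction p u i t x := by
      simp only [reaction]
      rw [Real.mul_rpow (Real.rpow_nonneg hlam0.le _) (hMu i t ht' x).1,
        Real.mul_rpow (Real.rpow_nonneg hlam0.le _) (hMu (1 - i) t ht' x).1,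
        ← Real.rpow_mul hlam0.le, ← Real.rpow_mul hlam0.le, ← hg i, mul_comm (p i i) (g i),
        mul_comm (p i (1 - i)) (g (1 - i)), Real.rpow_add hlam0]
      ring
    rw [h2] at h1
    have hh0 : 0 ≤ h i t := hm.trans (hc i t ht).2.1
    have h3 := mul_le_mul_of_nonneg_left h1 hh0
    rw [zero_mul]
    linarith

/-- Iterating the improvement of a multiplicative bound. -/
lemma le_of_le_rpow_mul (hp : ∀ i j, 0 ≤ p i j) (hm : 0 ≤ m)
    (hc : CoeffBounds k h 0 T κ m H) (hu : IsClassicalSolution k h p φ T u)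
    (hv : IsClassicalSolution k h p φ T v) {g : Fin 2 → ℝ}
    (hg1 : ∀ i, 1 ≤ g i) (hg : ∀ i, p i i * g i + p i (1 - i) * g (1 - i) = g i - 1)
    {lam : ℝ} (hlam : 1 ≤ lam) (hle : ∀ i, ∀ t ∈ Icc 0 T, ∀ x, v i t x ≤ lam ^ g i * u i t x) :
    ∀ i, ∀ t ∈ Icc 0 T, ∀ x, v i t x ≤ u i t x := by
  obtain ⟨M, hM0, hM⟩ := hu.exists_bound
  have hlam0 : 0 < lam := one_pos.trans_le hlam
  set G := max (g 0) (g 1) with hG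
  have hGi : ∀ i, g i ≤ G := fun i => by fin_cases i <;> simp [hG]
  have hG1 : 1 ≤ G := (hg1 0).trans (hGi 0)
  have hG0 : 0 < G := one_pos.trans_le hG1
  -- `θ` is the least number with `g i - 1 ≤ θ * g i` for both `i`.
  set θ := 1 - 1 / G with hθ
  have hθ0 : 0 ≤ θ := sub_nonneg.2 ((div_le_one hG0).2 hG1)
  have hθ1 : θ < 1 := by have := one_div_pos.2 hG0; linarith
  have key : ∀ j : ℕ, ∀ i, ∀ t ∈ Icc 0 T, ∀ x, v i t x ≤ (lam ^ θ ^ j) ^ g i * u i t x := by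
    intro j
    induction j with
    | zero => simpa using hle
    | succ j ih =>
      intro i t ht x
      have h1 : 1 ≤ lam ^ θ ^ j := Real.one_le_rpow hlam (by positivity)
      refine (le_rpow_sub_one_mul hp hm hc hu hv hg1 hg h1 ih i t ht x).trans ?_
      refine mul_le_mul_of_nonneg_right ?_ (hM i t ht x).1
      have e : (lam ^ θ ^ (j + 1)) ^ g i = (lam ^ θ ^ j) ^ (θ * g i) := by
        rw [← Real.rpow_mul hlam0.le, ← Real.rpow_mul hlam0.le]
        congr 1; ring
      rw [e]
      refine Real.rpow_le_rpow_of_exponent_le h1 ?_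
      have h2 : g i / G ≤ 1 := (div_le_one hG0).2 (hGi i)
      have h3 : θ * g i = g i - g i / G := by rw [hθ]; ring
      linarith
  intro i t ht x
  have hlim : Tendsto (fun j : ℕ => (lam ^ θ ^ j) ^ g i * u i t x) atTop (𝓝 (u i t x)) := by
    have h1 := tendsto_pow_atTop_nhds_zero_of_lt_one hθ0 hθ1
    have h2 := (Real.continuousAt_const_rpow (b := 0) hlam0.ne').tendsto.comp h1
    have h3 := (h2.rpow_const (p := g i) (Or.inl (by simp))).mul_const (u i t x)
    simpa using h3
  exact ge_of_tendsto' hlim fun j => key j i t ht x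

/-- A classical solution `v` lies below every classical solution `u` with the same initial value
which is positive at positive times. -/
theorem IsClassicalSolution.le (hp : ∀ i j, 0 ≤ p i j) (hT : 0 < T) (hm : 0 < m)
    (hc : CoeffBounds k h 0 T κ m H) (hu : IsClassicalSolution k h p φ T u)
    (hv : IsClassicalSolution k h p φ T v) (hpos : PositiveBelow T u) :
    ∀ i, ∀ t ∈ Icc 0 T, ∀ x, v i t x ≤ u i t x := by
  by_cases hsub : 0 < 1 - p 0 0 ∧ 0 < 1 - p 1 1 ∧ 0 < p 0 1 ∧ 0 < p 1 0 ∧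
      p 0 1 * p 1 0 < (1 - p 0 0) * (1 - p 1 1)
  · obtain ⟨h₁, h₂, hb₁, hb₂, hD⟩ := hsub
    obtain ⟨α₁, α₂, hα₁, hα₁', hα₂, hα₂', hs₁, hs₂⟩ := exists_exponents_subadditive
      (by linarith [hp 0 0]) (by linarith [hp 1 1]) h₁ h₂ hb₁ hb₂ hD
    set D := (1 - p 0 0) * (1 - p 1 1) - p 0 1 * p 1 0 with hDdef
    have hD0 : 0 < D := sub_pos.2 hD
    -- The solution of `A_i g_i = 1 + b_i g_j`.
    set g : Fin 2 → ℝ := ![(1 - p 1 1 + p 0 1) / D, (1 - p 0 0 + p 1 0) / D]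
    have hg : ∀ i, p i i * g i + p i (1 - i) * g (1 - i) = g i - 1 := by
      refine Fin.forall_fin_two.2 ⟨?_, ?_⟩
      · simp only [sub_zero, g, Matrix.cons_val_zero, Matrix.cons_val_one]
        field_simp
        rw [hDdef]; ring
      · simp only [sub_self, g, Matrix.cons_val_zero, Matrix.cons_val_one]
        field_simp
        rw [hDdef]; ring
    have hg0 : ∀ i, 0 < g i := by
      refine Fin.forall_fin_two.2 ⟨?_, ?_⟩ <;>
        simp only [g, Matrix.cons_val_zero, Matrix.cons_val_one] <;> positivity
    have hg1 : ∀ i, 1 ≤ g i := fun i => by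
      have := hg i
      have := mul_nonneg (hp i i) (hg0 i).le
      have := mul_nonneg (hp i (1 - i)) (hg0 (1 - i)).le
      linarith
    have hα0 : ∀ i, 0 < (![α₁, α₂] : Fin 2 → ℝ) i := Fin.forall_fin_two.2 ⟨hα₁, hα₂⟩
    have hinc : ∀ i, SubadditiveIncrement (1 - (1 - p i i) / (![α₁, α₂] : Fin 2 → ℝ) i)
        (p i (1 - i) / (![α₁, α₂] : Fin 2 → ℝ) (1 - i)) :=
      Fin.forall_fin_two.2 ⟨by simpa using hs₁, by simpa using hs₂⟩
    have hα1 : ∀ i, (![α₁, α₂] : Fin 2 → ℝ) i ≤ 1 := Fin.forall_fin_two.2 ⟨hα₁', hα₂'⟩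
    generalize (![α₁, α₂] : Fin 2 → ℝ) = α at hα0 hα1 hinc
    have hH : 0 < H := hm.trans_le
      ((hc 0 T ⟨hT, le_rfl⟩).2.1.trans (hc 0 T ⟨hT, le_rfl⟩).2.2)
    have hg01 : 0 < g 0 + g 1 := add_pos (hg0 0) (hg0 1)
    set c := m / (g 0 + g 1) with hcdef
    have hc0 : 0 < c := div_pos hm hg01
    have hcg : ∀ i, g i * c ≤ m := by
      intro i
      have h1 : g i ≤ g 0 + g 1 := by
        have := hg0 0
        have := hg0 1
        fin_cases i <;> simp only [Fin.zero_eta, Fin.mk_one] <;> linarith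
      calc g i * c ≤ (g 0 + g 1) * c := by gcongr
        _ = m := mul_div_cancel₀ _ hg01.ne'
    have hlow := rpow_le_of_sublinear hp hm hc hu hpos hg1 hg hc0 hcg
    have hupp := le_rpow_add_of_sublinear hp hT hm hc hu hv hpos hg1 hg hα0 hα1 hinc
    set q : Fin 2 → ℝ := fun i => (1 + (H / c) ^ (α i * g i)) ^ (1 / α i)
    have hq1 : ∀ i, 1 ≤ q i := fun i => Real.one_le_rpow
      (by have : 0 ≤ (H / c) ^ (α i * g i) := by positivity
          linarith) (one_div_pos.2 (hα0 i)).le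
    have hqm : ∀ i, q i ≤ max (q 0) (q 1) := fun i => by fin_cases i <;> simp
    have hlam : 1 ≤ max (q 0) (q 1) := (hq1 0).trans (hqm 0)
    refine le_of_le_rpow_mul hp hm.le hc hu hv hg1 hg hlam fun i t ht x => ?_
    have hqg : q i ≤ max (q 0) (q 1) ^ g i :=
      (hqm i).trans (Real.self_le_rpow_of_one_le hlam (hg1 i))
    rcases ht.1.eq_or_lt with rfl | ht0
    · rw [hv.initial i x, ← hu.initial i x]
      have h1 : 0 ≤ u i 0 x := by
        obtain ⟨M, hM⟩ := hu.nonnegBounded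
        exact (hM i 0 ht x).1
      exact le_mul_of_one_le_left h1 ((hq1 i).trans hqg)
    · have hU := hpos.pos i ⟨ht0, ht.2⟩ x
      have h1 : (H * t) ^ (α i * g i) ≤ (H / c) ^ (α i * g i) * u i t x ^ α i := by
        have h2 := Real.rpow_le_rpow (by positivity) (hlow i t ⟨ht0, ht.2⟩ x) (hα0 i).le
        rw [← Real.rpow_mul (by positivity), mul_comm (g i)] at h2
        calc (H * t) ^ (α i * g i) = (H / c) ^ (α i * g i) * (c * t) ^ (α i * g i) := by
              rw [← Real.mul_rpow (by positivity) (by positivity)]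
              congr 1; field_simp
          _ ≤ _ := by gcongr
      have h3 : u i t x ^ α i + (H * t) ^ (α i * g i) ≤
          (1 + (H / c) ^ (α i * g i)) * u i t x ^ α i := by linarith
      have h4 := Real.rpow_le_rpow (by positivity) h3 (one_div_pos.2 (hα0 i)).le
      rw [Real.mul_rpow (x := 1 + _) (by positivity) (by positivity), ← Real.rpow_mul hU.le,
        mul_one_div_cancel (hα0 i).ne', Real.rpow_one] at h4
      exact (hupp i t ht x).trans (h4.trans (by gcongr))
  · obtain ⟨α₁, α₂, hα₁, hα₁', hα₂, hα₂', hs₁, hs₂⟩ := exists_exponents_linear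
      (by linarith [hp 0 0]) (by linarith [hp 1 1]) (hp 0 1) (hp 1 0) hsub
    exact le_of_linearIncrement hp hT hm.le hc hu hv hpos (α := ![α₁, α₂])
      (Fin.forall_fin_two.2 ⟨hα₁, hα₂⟩) (Fin.forall_fin_two.2 ⟨hα₁', hα₂'⟩)
      (Fin.forall_fin_two.2 ⟨by simpa using hs₁, by simpa using hs₂⟩)

end Uniqueness

/-! ### Existence of a mild solution -/

section EvolveOrder

variable {K k : ℝ → ℝ} {m M M₀ : ℝ} {φ : EuclideanSpace ℝ (Fin n) → ℝ}
  {f f₁ : ℝ → EuclideanSpace ℝ (Fin n) → ℝ}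

lemma heatMean_le_evolve (hf : ∀ s x, 0 ≤ f s x) {t : ℝ} (ht : 0 ≤ t) (x : 𝔼) :
    heatMean (K t - K 0) φ x ≤ evolve K 0 φ f t x :=
  le_add_of_nonneg_right
    (intervalIntegral.integral_nonneg ht fun s _ => heatMean_nonneg (hf s) _ _)

lemma evolve_mono (hK : Continuous K) (hf : StronglyMeasurable (Function.uncurry f))
    (hf₁ : StronglyMeasurable (Function.uncurry f₁)) (hM : ∀ s x, ‖f s x‖ ≤ M)
    (hM₁ : ∀ s x, ‖f₁ s x‖ ≤ M) (h : ∀ s x, f s x ≤ f₁ s x) {t : ℝ} (ht : 0 ≤ t) (x : 𝔼) :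
    evolve K 0 φ f t x ≤ evolve K 0 φ f₁ t x :=
  (add_le_add_iff_left _).2 (intervalIntegral.integral_mono ht
    (intervalIntegrable_heatMean_time hK hf hM _ _ _ _)
    (intervalIntegrable_heatMean_time hK hf₁ hM₁ _ _ _ _) fun s =>
      heatMean_mono (stronglyMeasurable_slice hf s) (stronglyMeasurable_slice hf₁ s) (hM s) (hM₁ s)
        (h s) _ _)

lemma tendsto_evolve (hK : Continuous K) {F : ℕ → ℝ → EuclideanSpace ℝ (Fin n) → ℝ}
    (hF : ∀ j, StronglyMeasurable (Function.uncurry (F j))) (hM : ∀ j s x, ‖F j s x‖ ≤ M)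
    (h : ∀ s x, Tendsto (fun j => F j s x) atTop (𝓝 (f s x))) (t : ℝ) (x : 𝔼) :
    Tendsto (fun j => evolve K 0 φ (F j) t x) atTop (𝓝 (evolve K 0 φ f t x)) := by
  refine tendsto_const_nhds.add
    (intervalIntegral.tendsto_integral_filter_of_dominated_convergence (fun _ => M)
      (Eventually.of_forall fun j =>
        (stronglyMeasurable_heatMean_time hK (hF j) _ _).aestronglyMeasurable)
      (Eventually.of_forall fun j => ae_of_all _ fun s _ => norm_heatMean_le (hM j s) _ _)
      intervalIntegrable_const (ae_of_all _ fun s _ => ?_))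
  refine tendsto_integral_of_dominated_convergence (fun z => unitKernel z * M) (fun j => ?_)
    (integrable_unitKernel.mul_const M)
    (fun j => ae_of_all _ fun z => norm_unitKernel_smul_le (hM j s _) z)
    (ae_of_all _ fun z => (h s _).const_smul _)
  exact (integrable_unitKernel_smul
    ((stronglyMeasurable_slice (hF j) s).comp_measurable (by fun_prop)) fun z =>
      hM j s (x - √(K t - K s) • z)).aestronglyMeasurable

lemma continuous_clampTime_evolve {T : ℝ} (hT : 0 ≤ T) (hK : IsTimeChange K k m)
    (hφ : Continuous φ) (hM₀ : ∀ x, ‖φ x‖ ≤ M₀) (hf : StronglyMeasurable (Function.uncurry f))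
    (hM : ∀ s x, ‖f s x‖ ≤ M) :
    Continuous (Function.uncurry (clampTime hT (evolve K 0 φ f))) :=
  (continuousOn_evolve (τ := 0) hK.continuous hK.pos hK.slope_le hφ hM₀ hf hM).comp_continuous
    (f := fun q : ℝ × 𝔼 => ((projIcc 0 T hT q.1 : ℝ), q.2)) (by fun_prop)
    fun q => ⟨(clampTime_mem hT q.1).1, trivial⟩

end EvolveOrder

/-- The reaction term `h_i(s) u_i ^ p_ii u_j ^ p_ij` of the `i`-th equation. -/
def source {n : ℕ} (h : Fin 2 → ℝ → ℝ) (p : Fin 2 → Fin 2 → ℝ)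
    (u : Fin 2 → ℝ → EuclideanSpace ℝ (Fin n) → ℝ) (i : Fin 2) (s : ℝ)
    (x : EuclideanSpace ℝ (Fin n)) : ℝ :=
  h i s * reaction p u i s x

section Source

variable {h : Fin 2 → ℝ → ℝ} {p : Fin 2 → Fin 2 → ℝ}
  {u v : Fin 2 → ℝ → EuclideanSpace ℝ (Fin n) → ℝ} {M H : ℝ}

lemma stronglyMeasurable_source (hh : ∀ i, Continuous (h i))
    (hu : ∀ i, StronglyMeasurable (Function.uncurry (u i))) (i : Fin 2) :
    StronglyMeasurable (Function.uncurry (source h p u i)) := by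
  refine Measurable.stronglyMeasurable ?_
  exact ((hh i).measurable.comp measurable_fst).mul
    (((hu i).measurable.pow_const _).mul ((hu (1 - i)).measurable.pow_const _))

lemma source_nonneg (hh0 : ∀ i t, 0 ≤ h i t) (hu : ∀ i t x, 0 ≤ u i t x) (i : Fin 2) (t : ℝ)
    (x : 𝔼) : 0 ≤ source h p u i t x :=
  mul_nonneg (hh0 i t) (reaction_nonneg (fun i => hu i t x) i)

lemma source_mono (hp : ∀ i j, 0 ≤ p i j) (hh0 : ∀ i t, 0 ≤ h i t) (hu : ∀ i t x, 0 ≤ u i t x)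
    (huv : ∀ i t x, u i t x ≤ v i t x) (i : Fin 2) (t : ℝ) (x : 𝔼) :
    source h p u i t x ≤ source h p v i t x :=
  mul_le_mul_of_nonneg_left (reaction_le_reaction hp (fun i => hu i t x) (fun i => huv i t x) i)
    (hh0 i t)

/-- An upper bound for `source` on pairs with values in `[0, M]`. -/
def sourceBound (H : ℝ) (p : Fin 2 → Fin 2 → ℝ) (M : ℝ) : ℝ :=
  H * (M ^ p 0 0 * M ^ p 0 1 + M ^ p 1 1 * M ^ p 1 0)

lemma norm_source_le (hp : ∀ i j, 0 ≤ p i j) (hh0 : ∀ i t, 0 ≤ h i t) (hhH : ∀ i t, h i t ≤ H)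
    (hu : ∀ i t x, 0 ≤ u i t x) (huM : ∀ i t x, u i t x ≤ M) (i : Fin 2) (t : ℝ) (x : 𝔼) :
    ‖source h p u i t x‖ ≤ sourceBound H p M := by
  rw [Real.norm_of_nonneg (source_nonneg hh0 hu i t x)]
  have hM : 0 ≤ M := (hu i t x).trans (huM i t x)
  have h1 : reaction p u i t x ≤ M ^ p i i * M ^ p i (1 - i) :=
    reaction_le_reaction hp (v := fun _ _ _ => M) (fun i => hu i t x) (fun i => huM i t x) i
  have h2 : M ^ p i i * M ^ p i (1 - i) ≤ M ^ p 0 0 * M ^ p 0 1 + M ^ p 1 1 * M ^ p 1 0 := by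
    have : 0 ≤ M ^ p 0 0 * M ^ p 0 1 := by positivity
    have : 0 ≤ M ^ p 1 1 * M ^ p 1 0 := by positivity
    fin_cases i <;> simp <;> linarith
  have h3 := reaction_nonneg (p := p) (fun i => hu i t x) i
  exact mul_le_mul (hhH i t) (h1.trans h2) h3 ((hh0 i t).trans (hhH i t))

end Source

section Existence

variable {K k h : Fin 2 → ℝ → ℝ} {p : Fin 2 → Fin 2 → ℝ}
  {φ : Fin 2 → EuclideanSpace ℝ (Fin n) → ℝ} {T m M M₀ H : ℝ}

/-- One step of the monotone iteration for the integral system. -/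
def mildStep {n : ℕ} {T : ℝ} (hT : 0 ≤ T) (K h : Fin 2 → ℝ → ℝ) (p : Fin 2 → Fin 2 → ℝ)
    (φ : Fin 2 → EuclideanSpace ℝ (Fin n) → ℝ) (u : Fin 2 → ℝ → EuclideanSpace ℝ (Fin n) → ℝ)
    (i : Fin 2) : ℝ → EuclideanSpace ℝ (Fin n) → ℝ :=
  clampTime hT (evolve (K i) 0 (φ i) (source h p u i))

/-- The integral system is solved by the decreasing limit of the iterates of a constant
supersolution `M`. -/
theorem exists_evolve_fixedPoint (hT : 0 ≤ T) (hK : ∀ i, IsTimeChange (K i) (k i) m)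
    (hh : ∀ i, Continuous (h i)) (hh0 : ∀ i t, 0 ≤ h i t) (hhH : ∀ i t, h i t ≤ H)
    (hp : ∀ i j, 0 ≤ p i j) (hφ : ∀ i, Continuous (φ i)) (hφ0 : ∀ i x, 0 ≤ φ i x)
    (hφM : ∀ i x, φ i x ≤ M₀) (hM0 : 0 ≤ M)
    (hM : M₀ + sourceBound H p M * T ≤ M) :
    ∃ u : Fin 2 → ℝ → 𝔼 → ℝ, (∀ i, StronglyMeasurable (Function.uncurry (u i))) ∧
      (∀ i t x, 0 ≤ u i t x) ∧ (∀ i t x, u i t x ≤ M) ∧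
      ∀ i, ∀ t ∈ Icc 0 T, ∀ x, u i t x = evolve (K i) 0 (φ i) (source h p u i) t x := by
  have hφn : ∀ i x, ‖φ i x‖ ≤ M₀ := fun i x => by
    rw [Real.norm_of_nonneg (hφ0 i x)]; exact hφM i x
  have hM₀ : 0 ≤ M₀ := (hφ0 0 0).trans (hφM 0 0)
  have hH : 0 ≤ H := (hh0 0 0).trans (hhH 0 0)
  -- Properties preserved by the iteration.
  let Good : (Fin 2 → ℝ → 𝔼 → ℝ) → Prop := fun u =>
    (∀ i, StronglyMeasurable (Function.uncurry (u i))) ∧ (∀ i t x, 0 ≤ u i t x) ∧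
      ∀ i t x, u i t x ≤ M
  have hstep : ∀ u, Good u → Good (mildStep hT K h p φ u) := by
    rintro u ⟨hum, hu0, huM⟩
    have hs := norm_source_le hp hh0 hhH hu0 huM
    refine ⟨fun i => (continuous_clampTime_evolve hT (hK i) (hφ i) (hφn i)
      (stronglyMeasurable_source hh hum i) (hs i)).stronglyMeasurable, fun i t x => ?_,
      fun i t x => ?_⟩
    · exact (heatMean_nonneg (hφ0 i) _ _).trans
        (heatMean_le_evolve (source_nonneg hh0 hu0 i) (clampTime_mem hT t).1 x)
    · have hB : 0 ≤ sourceBound H p M := (norm_nonneg _).trans (hs i t x)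
      have h1 := norm_evolve_le (K := K i) (hφn i) (hs i) (clampTime_mem hT t).1 x
      refine (Real.le_norm_self _).trans (h1.trans (le_trans ?_ hM))
      have := (clampTime_mem hT t).2
      rw [sub_zero]
      gcongr
  have hstep_mono : ∀ u v, Good u → Good v → (∀ i t x, u i t x ≤ v i t x) →
      ∀ i t x, mildStep hT K h p φ u i t x ≤ mildStep hT K h p φ v i t x := by
    intro u v hu hv huv i t x
    exact evolve_mono (hK i).continuous (stronglyMeasurable_source hh hu.1 i)
      (stronglyMeasurable_source hh hv.1 i) (norm_source_le hp hh0 hhH hu.2.1 hu.2.2 i)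
      (norm_source_le hp hh0 hhH hv.2.1 hv.2.2 i) (source_mono hp hh0 hu.2.1 huv i)
      (clampTime_mem hT t).1 x
  set U : ℕ → Fin 2 → ℝ → 𝔼 → ℝ := fun j => (mildStep hT K h p φ)^[j] fun _ _ _ => M with hU
  have hUs : ∀ j, U (j + 1) = mildStep hT K h p φ (U j) := fun j =>
    Function.iterate_succ_apply' _ _ _
  have hgood : ∀ j, Good (U j) := by
    intro j
    induction j with
    | zero => exact ⟨fun i => stronglyMeasurable_const, fun _ _ _ => hM0, fun _ _ _ => le_rfl⟩
    | succ j ih => rw [hUs]; exact hstep _ ih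
  have hanti : ∀ i t x, Antitone fun j => U j i t x := by
    have h1 : ∀ j i t x, U (j + 1) i t x ≤ U j i t x := by
      intro j
      induction j with
      | zero => exact fun i t x => (hgood 1).2.2 i t x
      | succ j ih =>
        intro i t x
        rw [hUs (j + 1)]
        conv_rhs => rw [hUs j]
        exact hstep_mono _ _ (hgood _) (hgood _) ih i t x
    exact fun i t x => antitone_nat_of_succ_le fun j => h1 j i t x
  set u : Fin 2 → ℝ → 𝔼 → ℝ := fun i t x => ⨅ j, U j i t x
  have hlim : ∀ i t x, Tendsto (fun j => U j i t x) atTop (𝓝 (u i t x)) := fun i t x =>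
    tendsto_atTop_ciInf (hanti i t x) ⟨0, by rintro _ ⟨j, rfl⟩; exact (hgood j).2.1 i t x⟩
  refine ⟨u, fun i => ?_, fun i t x => ge_of_tendsto' (hlim i t x) fun j => (hgood j).2.1 i t x,
    fun i t x => le_of_tendsto' (hlim i t x) fun j => (hgood j).2.2 i t x, fun i t ht x => ?_⟩
  · exact stronglyMeasurable_of_tendsto atTop (fun j => (hgood j).1 i)
      (tendsto_pi_nhds.2 fun q => hlim i q.1 q.2)
  · have h1 := tendsto_evolve (K := K i) (φ := φ i) (hK i).continuous
      (fun j => stronglyMeasurable_source (p := p) hh (hgood j).1 i)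
      (fun j => norm_source_le hp hh0 hhH (hgood j).2.1 (hgood j).2.2 i)
      (f := source h p u i) (fun s x =>
        (((hlim i s x).rpow_const (Or.inr (hp _ _))).mul
          ((hlim (1 - i) s x).rpow_const (Or.inr (hp _ _)))).const_mul _) t x
    refine tendsto_nhds_unique ((hlim i t x).comp (tendsto_add_atTop_nat 1)) (h1.congr fun j => ?_)
    simp only [Function.comp_apply, hUs, mildStep, clampTime_of_mem hT _ ht]

end Existence

/-! ### Mild solutions are positive and classical -/

section Regularity

variable {K k h : Fin 2 → ℝ → ℝ} {p : Fin 2 → Fin 2 → ℝ}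
  {φ : Fin 2 → EuclideanSpace ℝ (Fin n) → ℝ} {T m M M₀ H : ℝ}
  {u v w : Fin 2 → ℝ → EuclideanSpace ℝ (Fin n) → ℝ}

/-- The spatial derivative of `source`, given those of the components. -/
def sourceGrad {n : ℕ} (h : Fin 2 → ℝ → ℝ) (p : Fin 2 → Fin 2 → ℝ)
    (u : Fin 2 → ℝ → EuclideanSpace ℝ (Fin n) → ℝ)
    (u' : Fin 2 → ℝ → EuclideanSpace ℝ (Fin n) → EuclideanSpace ℝ (Fin n) →L[ℝ] ℝ) (i : Fin 2)
    (s : ℝ) (x : EuclideanSpace ℝ (Fin n)) : EuclideanSpace ℝ (Fin n) →L[ℝ] ℝ :=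
  (h i s * (u i s x ^ p i i * (p i (1 - i) * u (1 - i) s x ^ (p i (1 - i) - 1)))) • u' (1 - i) s x +
    (h i s * (u (1 - i) s x ^ p i (1 - i) * (p i i * u i s x ^ (p i i - 1)))) • u' i s x

/-- The reaction terms of a positive mild solution are differentiable in space at positive times,
although the powers are singular at zero. -/
lemma isRegularSource_source (hK : ∀ i, IsTimeChange (K i) (k i) m) (hh : ∀ i, Continuous (h i))
    (hh0 : ∀ i t, 0 ≤ h i t) (hhH : ∀ i t, h i t ≤ H) (hp : ∀ i j, 0 ≤ p i j)
    (hφ : ∀ i, Continuous (φ i)) (hφM : ∀ i x, ‖φ i x‖ ≤ M₀)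
    (hum : ∀ i, StronglyMeasurable (Function.uncurry (u i))) (hu0 : ∀ i t x, 0 ≤ u i t x)
    (huM : ∀ i t x, u i t x ≤ M) (hpos : PositiveBelow T u)
    (hu : ∀ i, ∀ t ∈ Icc 0 T, ∀ x, u i t x = evolve (K i) 0 (φ i) (source h p u i) t x)
    (i : Fin 2) :
    IsRegularSource T (sourceBound H p M) (source h p u i)
      (sourceGrad h p u (fun i => evolveGrad (K i) 0 (φ i) (source h p u i)) i) := by
  have hs := norm_source_le hp hh0 hhH hu0 huM
  have hsm := stronglyMeasurable_source (p := p) hh hum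
  have huc : ∀ i, ContinuousOn (fun q : ℝ × 𝔼 => u i q.1 q.2) (Ioc 0 T ×ˢ univ) := fun i =>
    ((continuousOn_evolve (τ := 0) (hK i).continuous (hK i).pos (hK i).slope_le (hφ i) (hφM i)
      (hsm i) (hs i)).mono (prod_mono (fun t ht => ht.1.le) subset_rfl)).congr
      fun q hq => hu i q.1 (Ioc_subset_Icc_self hq.1) q.2
  have hgc : ∀ i, ContinuousOn (fun q : ℝ × 𝔼 =>
      evolveGrad (K i) 0 (φ i) (source h p u i) q.1 q.2) (Ioc 0 T ×ˢ univ) := fun i =>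
    (continuousOn_evolveGrad (hK i).continuous (hK i).pos (hK i).slope_le
      (hφ i).stronglyMeasurable (hφM i) (hsm i) (hs i)).mono
      (prod_mono (fun t ht => ht.1) subset_rfl)
  have hud : ∀ i, ∀ t ∈ Ioc 0 T, ∀ x, HasFDerivAt (u i t)
      (evolveGrad (K i) 0 (φ i) (source h p u i) t x) x := fun i t ht x => by
    rw [show u i t = evolve (K i) 0 (φ i) (source h p u i) t from
      funext fun x => hu i t (Ioc_subset_Icc_self ht) x]
    exact hasFDerivAt_evolve (hK i).continuous (hK i).pos (hK i).slope_le
      (hφ i).stronglyMeasurable (hφM i) (hsm i) (hs i) ht.1 x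
  have hrc : ∀ i q, ContinuousOn (fun z : ℝ × 𝔼 => u i z.1 z.2 ^ (q : ℝ)) (Ioc 0 T ×ˢ univ) :=
    fun i q => (huc i).rpow_const fun z hz => Or.inl (hpos.pos i hz.1 z.2).ne'
  have hhc : ContinuousOn (fun z : ℝ × 𝔼 => h i z.1) (Ioc 0 T ×ˢ univ) :=
    ((hh i).comp continuous_fst).continuousOn
  refine ⟨hsm i, hs i, hhc.mul ((hrc _ _).mul (hrc _ _)), fun s hs x => ?_, ?_, fun τ hτ => ?_⟩
  · have h1 := ((hud i s hs x).rpow_const (p := p i i) (Or.inl (hpos.pos i hs x).ne')).mul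
      ((hud (1 - i) s hs x).rpow_const (p := p i (1 - i)) (Or.inl (hpos.pos (1 - i) hs x).ne'))
    refine (h1.const_mul (h i s)).congr_fderiv ?_
    simp only [sourceGrad, smul_add, smul_smul]
  · have h1 := (hhc.mul ((hrc i (p i i)).mul ((continuousOn_const (c := p i (1 - i))).mul
      (hrc (1 - i) (p i (1 - i) - 1))))).smul (hgc (1 - i))
    have h2 := (hhc.mul ((hrc (1 - i) (p i (1 - i))).mul ((continuousOn_const (c := p i i)).mul
      (hrc i (p i i - 1))))).smul (hgc i)
    exact h1.add h2
  · obtain ⟨δ, hδ, hδu⟩ := hpos τ hτ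
    choose C hC using fun i => exists_norm_evolveGrad_le (τ := 0) (hK i).pos (hK i).slope_le (hφM i)
      (hs i) hτ.1 T
    have hM : 0 ≤ M := (hu0 0 0 0).trans (huM 0 0 0)
    set B : ℝ → ℝ := fun q => δ ^ q + M ^ q with hB
    have hB0 : ∀ q, 0 ≤ B q := fun q => by positivity
    refine ⟨H * (B (p i i) * (p i (1 - i) * B (p i (1 - i) - 1))) * C (1 - i) +
      H * (B (p i (1 - i)) * (p i i * B (p i i - 1))) * C i,
      fun s hs x => (norm_add_le _ _).trans ?_⟩
    have hBu : ∀ j q, u j s x ^ q ≤ B q := fun j q =>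
      rpow_le_rpow_add_rpow hδ (hδu j s hs x) (huM j s x) q
    have hu1 : ∀ j q, 0 ≤ u j s x ^ (q : ℝ) := fun j q => Real.rpow_nonneg (hu0 j s x) q
    have hp1 := hp i i
    have hp2 := hp i (1 - i)
    have hh1 := hh0 i s
    have hh2 := hhH i s
    have hH : 0 ≤ H := hh1.trans hh2
    have u1 := hu1 i (p i i)
    have u2 := hu1 i (p i i - 1)
    have u3 := hu1 (1 - i) (p i (1 - i))
    have u4 := hu1 (1 - i) (p i (1 - i) - 1)
    have b1 := hB0 (p i i)
    have b2 := hB0 (p i i - 1)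
    have b3 := hB0 (p i (1 - i))
    have b4 := hB0 (p i (1 - i) - 1)
    have c1 := hC i s hs x
    have c2 := hC (1 - i) s hs x
    rw [norm_smul, norm_smul, Real.norm_of_nonneg (by positivity),
      Real.norm_of_nonneg (by positivity)]
    refine add_le_add (mul_le_mul ?_ c2 (norm_nonneg _) (by positivity))
      (mul_le_mul ?_ c1 (norm_nonneg _) (by positivity))
    · exact mul_le_mul hh2 (mul_le_mul (hBu _ _) (mul_le_mul_of_nonneg_left (hBu _ _) hp2)
        (by positivity) b1) (by positivity) hH
    · exact mul_le_mul hh2 (mul_le_mul (hBu _ _) (mul_le_mul_of_nonneg_left (hBu _ _) hp1)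
        (by positivity) b3) (by positivity) hH

/-- A positive fixed point of the integral system is a classical solution. -/
theorem isClassicalSolution_evolve (hK : ∀ i, IsTimeChange (K i) (k i) m)
    (hh : ∀ i, Continuous (h i))
    (hh0 : ∀ i t, 0 ≤ h i t) (hhH : ∀ i t, h i t ≤ H) (hp : ∀ i j, 0 ≤ p i j)
    (hφ : ∀ i, Continuous (φ i)) (hφM : ∀ i x, ‖φ i x‖ ≤ M₀)
    (hum : ∀ i, StronglyMeasurable (Function.uncurry (u i))) (hu0 : ∀ i t x, 0 ≤ u i t x)
    (huM : ∀ i t x, u i t x ≤ M) (hpos : PositiveBelow T u)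
    (hu : ∀ i, ∀ t ∈ Icc 0 T, ∀ x, u i t x = evolve (K i) 0 (φ i) (source h p u i) t x) :
    IsClassicalSolution k h p φ T fun i => evolve (K i) 0 (φ i) (source h p u i) := by
  have hreg := isRegularSource_source hK hh hh0 hhH hp hφ hφM hum hu0 huM hpos hu
  refine ⟨⟨M, fun i t ht x => ?_⟩, fun i => ?_, fun i => ?_, fun i t ht x => ?_, fun i x => ?_⟩
  · change 0 ≤ evolve (K i) 0 (φ i) (source h p u i) t x ∧
      evolve (K i) 0 (φ i) (source h p u i) t x ≤ M
    rw [← hu i t ht x]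
    exact ⟨hu0 i t x, huM i t x⟩
  · exact (continuousOn_evolve (τ := 0) (hK i).continuous (hK i).pos (hK i).slope_le (hφ i) (hφM i)
      (hreg i).stronglyMeasurable (hreg i).norm_le).mono (prod_mono (fun t ht => ht.1) subset_rfl)
  · exact (isC12_evolve (hK i) (hφ i) (hφM i) (hreg i)).1
  · rw [(isC12_evolve (hK i) (hφ i) (hφM i) (hreg i)).2 t ht x]
    simp only [source, reaction]
    rw [← hu _ t (Ioc_subset_Icc_self ht), ← hu _ t (Ioc_subset_Icc_self ht)]
  · rw [evolve_self]

/-- The heat flow of initial data which are bounded below by a positive constant far out is bounded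
below at positive times. -/
lemma exists_pos_le_heatMean_time (hn : 1 ≤ n) (hK : ∀ i, IsTimeChange (K i) (k i) m)
    (hφ : ∀ i, Continuous (φ i)) (hφ0 : ∀ i x, 0 ≤ φ i x) (hφM : ∀ i x, ‖φ i x‖ ≤ M₀)
    (hfar : ∀ i, ∃ b > 0, ∃ R, ∀ x, R ≤ ‖x‖ → b ≤ φ i x) {τ : ℝ} (hτ : 0 < τ) :
    ∃ δ > 0, ∀ i t, τ ≤ t → ∀ x, δ ≤ heatMean (K i t - K i 0) (φ i) x := by
  have h1 : ∀ i, ∃ δ > 0, ∀ σ, m * τ ≤ σ → ∀ x, δ ≤ heatMean σ (φ i) x := fun i => by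
    obtain ⟨b, hb, R, hR⟩ := hfar i
    exact exists_pos_le_heatMean hn (hφ i).stronglyMeasurable (hφM i) (hφ0 i) hb hR
      (mul_pos (hK i).pos hτ)
  choose δ hδ hδ' using h1
  refine ⟨min (δ 0) (δ 1), lt_min (hδ 0) (hδ 1), fun i t ht x => ?_⟩
  have h2 : m * τ ≤ K i t - K i 0 := by
    have := (hK i).slope_le 0 t (hτ.le.trans ht)
    have := mul_le_mul_of_nonneg_left ht (hK i).pos.le
    linarith
  refine le_trans ?_ (hδ' i _ h2 x)
  fin_cases i <;> simp

lemma isRegularSource_zero : IsRegularSource (n := n) T 0 (fun _ _ => 0) (fun _ _ => 0) :=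
  ⟨stronglyMeasurable_const, fun _ _ => by simp, continuousOn_const,
    fun _ _ _ => hasFDerivAt_const _ _, continuousOn_const, fun _ _ => ⟨0, by simp⟩⟩

/-- Classical solutions dominate the heat flow of their initial data, and are therefore positive. -/
lemma IsClassicalSolution.positiveBelow {κ : ℝ} (hn : 1 ≤ n)
    (hK : ∀ i, IsTimeChange (K i) (k i) m) (hm : 0 ≤ m) (hc : CoeffBounds k h 0 T κ m H)
    (hφ : ∀ i, Continuous (φ i)) (hφ0 : ∀ i x, 0 ≤ φ i x) (hφM : ∀ i x, ‖φ i x‖ ≤ M₀)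
    (hfar : ∀ i, ∃ b > 0, ∃ R, ∀ x, R ≤ ‖x‖ → b ≤ φ i x)
    (hu : IsClassicalSolution k h p φ T u) : PositiveBelow T u := by
  obtain ⟨M, hM0, hM⟩ := hu.exists_bound
  have hflow := fun i => isC12_evolve (T := T) (hK i) (hφ i) (hφM i) isRegularSource_zero
  have hle : ∀ i, ∀ t ∈ Icc 0 T, ∀ x, evolve (K i) 0 (φ i) (fun _ _ => 0) t x ≤ u i t x := by
    refine le_of_comparison (v := fun i => evolve (K i) 0 (φ i) (fun _ _ => 0)) (u := u)
      (ρ := fun _ _ _ => 1) (L := 0) (B := M₀)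
      (dv := fun i t x => k i t *
        Laplacian.laplacian (evolve (K i) 0 (φ i) (fun _ _ => 0) t) x + 0)
      (dz := fun i t x => k i t * Laplacian.laplacian (u i t) x + h i t * reaction p u i t x)
      (fun i t ht => (hc i t ht).1.1) (fun i t ht => (hc i t ht).1.2) (fun i => ?_)
      (fun i => hu.continuousOn i) (fun i t ht x => ?_) (fun i x => ?_)
      (fun i t ht => (hflow i).1.contDiff_space t ht)
      (fun i t ht => (hu.isC12 i).contDiff_space t ht) (fun i t ht x => ?_)
      (fun i t ht x => hu.hasDerivWithinAt i ht x) (fun i t ht x y => by linarith)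
      (fun i t ht x _ _ => ?_)
    · exact (continuousOn_evolve (τ := 0) (hK i).continuous (hK i).pos (hK i).slope_le (hφ i)
        (hφM i) stronglyMeasurable_const (M := 0) (fun _ _ => by simp)).mono
        (prod_mono (fun t ht => ht.1) subset_rfl)
    · have h1 := norm_evolve_le (K := K i) (f := fun _ _ => (0 : ℝ)) (M := 0) (hφM i)
        (fun _ _ => by simp) ht.1 x
      have h2 := (hM i t ht x).1
      have h3 := Real.le_norm_self (evolve (K i) 0 (φ i) (fun _ _ => (0 : ℝ)) t x)
      linarith
    · rw [evolve_self, hu.initial i x]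
    · have h1 := (hflow i).1.hasDerivWithinAt ht x
      rwa [(hflow i).2 t ht x] at h1
    · have h1 := reaction_nonneg (p := p) (fun i => (hM i t (Ioc_subset_Icc_self ht) x).1) i
      have h2 := mul_nonneg (hm.trans (hc i t ht).2.1) h1
      linarith
  intro τ hτ
  obtain ⟨δ, hδ, h⟩ := exists_pos_le_heatMean_time hn hK hφ hφ0 hφM hfar hτ.1
  exact ⟨δ, hδ, fun i t ht x => (h i t ht.1 x).trans
    ((heatMean_le_evolve (fun _ _ => le_rfl) (hτ.1.le.trans ht.1) x).trans
      (hle i t ⟨hτ.1.le.trans ht.1, ht.2⟩ x))⟩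

/-- Fixed points of the integral system dominate the heat flow of the initial data. -/
lemma positiveBelow_of_eq_evolve (hn : 1 ≤ n) (hK : ∀ i, IsTimeChange (K i) (k i) m)
    (hh0 : ∀ i t, 0 ≤ h i t)
    (hφ : ∀ i, Continuous (φ i)) (hφ0 : ∀ i x, 0 ≤ φ i x) (hφM : ∀ i x, ‖φ i x‖ ≤ M₀)
    (hfar : ∀ i, ∃ b > 0, ∃ R, ∀ x, R ≤ ‖x‖ → b ≤ φ i x) (hu0 : ∀ i t x, 0 ≤ u i t x)
    (hu : ∀ i, ∀ t ∈ Icc 0 T, ∀ x, u i t x = evolve (K i) 0 (φ i) (source h p u i) t x) :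
    PositiveBelow T u := by
  intro τ hτ
  obtain ⟨δ, hδ, h⟩ := exists_pos_le_heatMean_time hn hK hφ hφ0 hφM hfar hτ.1
  refine ⟨δ, hδ, fun i t ht x => (h i t ht.1 x).trans ?_⟩
  rw [hu i t ⟨hτ.1.le.trans ht.1, ht.2⟩ x]
  exact heatMean_le_evolve (source_nonneg hh0 hu0 i) (hτ.1.le.trans ht.1) x

/-- The right-hand side of the integral system, in terms of `evolve`. -/
lemma evolution_add_integral_eq_evolve (hK : ∀ i, IsTimeChange (K i) (k i) m)
    (huv : ∀ i, ∀ t ∈ Icc 0 T, ∀ x, u i t x = v i t x) (i : Fin 2) {t : ℝ} (ht : t ∈ Icc 0 T)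
    (x : 𝔼) :
    evolution (k i) 0 t (φ i) x +
        ∫ s in (0 : ℝ)..t, h i s * evolution (k i) s t (reaction p u i s) x =
      evolve (K i) 0 (φ i) (source h p v i) t x := by
  have hev : ∀ {s}, s ≤ t → ∀ g : 𝔼 → ℝ, evolution (k i) s t g = heatMean (K i t - K i s) g := by
    intro s hs g
    have h1 : ∫ r in s..t, k i r = K i t - K i s :=
      intervalIntegral.integral_eq_sub_of_hasDerivAt (fun r _ => (hK i).hasDerivAt r)
        ((hK i).continuous_diffusivity.intervalIntegrable _ _)
    rw [evolution, h1, heatSemigroup_eq_heatMean (sub_nonneg.2 ((hK i).strictMono.monotone hs))]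
  unfold evolve duhamel
  rw [hev ht.1]
  congr 1
  refine intervalIntegral.integral_congr fun s hs => ?_
  rw [uIcc_of_le ht.1] at hs
  rw [hev hs.2]
  have h2 : source h p v i s = fun x => h i s * reaction p u i s x := by
    ext x
    simp only [source, reaction]
    rw [huv _ s ⟨hs.1, hs.2.trans ht.2⟩, huv _ s ⟨hs.1, hs.2.trans ht.2⟩]
  rw [h2]
  unfold heatMean
  rw [← integral_const_mul]
  simp only [smul_eq_mul]
  congr 1
  ext z
  ring

end Regularity

section Congr

variable {k k' h h' : Fin 2 → ℝ → ℝ} {p : Fin 2 → Fin 2 → ℝ}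
  {φ : Fin 2 → EuclideanSpace ℝ (Fin n) → ℝ} {T : ℝ}
  {u : Fin 2 → ℝ → EuclideanSpace ℝ (Fin n) → ℝ}

lemma IsClassicalSolution.congr_coeff (hu : IsClassicalSolution k h p φ T u)
    (hk : ∀ i, ∀ t ∈ Icc 0 T, k' i t = k i t) (hh : ∀ i, ∀ t ∈ Icc 0 T, h' i t = h i t) :
    IsClassicalSolution k' h' p φ T u :=
  ⟨hu.nonnegBounded, hu.continuousOn, hu.isC12, fun i t ht x => by
    rw [hu.equation i t ht x, hk i t (Ioc_subset_Icc_self ht), hh i t (Ioc_subset_Icc_self ht)],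
    hu.initial⟩

lemma IsMildSolution.congr_coeff (hu : IsMildSolution k h p φ T u)
    (hk : ∀ i, ∀ t ∈ Icc 0 T, k' i t = k i t) (hh : ∀ i, ∀ t ∈ Icc 0 T, h' i t = h i t) :
    IsMildSolution k' h' p φ T u := by
  refine ⟨hu.nonnegBounded, hu.measurable, fun i t ht x => ?_⟩
  have hev : ∀ s ∈ Icc 0 t, ∀ g : 𝔼 → ℝ, evolution (k' i) s t g = evolution (k i) s t g := by
    intro s hs g
    unfold evolution
    congr 1
    refine intervalIntegral.integral_congr fun r hr => ?_
    rw [uIcc_of_le hs.2] at hr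
    exact hk i r ⟨hs.1.trans hr.1, hr.2.trans ht.2⟩
  rw [hu.equation i t ht x, hev 0 ⟨le_rfl, ht.1⟩]
  congr 1
  refine intervalIntegral.integral_congr fun s hs => ?_
  rw [uIcc_of_le ht.1] at hs
  rw [hev s hs, hh i s ⟨hs.1, hs.2.trans ht.2⟩]

end Congr

/-- A positive continuous function on `[0, ∞)`, frozen after time one, is bounded between positive
constants. -/
lemma exists_bounds_clampTime {f : ℝ → ℝ} (hf : ContinuousOn f (Ici 0))
    (h0 : ∀ t, 0 ≤ t → 0 < f t) :
    Continuous (clampTime zero_le_one f) ∧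
      ∃ a > 0, ∃ b, ∀ t, a ≤ clampTime zero_le_one f t ∧ clampTime zero_le_one f t ≤ b := by
  have hc : ContinuousOn f (Icc 0 1) := hf.mono fun t ht => ht.1
  obtain ⟨s, hs, hsmin⟩ := isCompact_Icc.exists_isMinOn ⟨0, left_mem_Icc.2 zero_le_one⟩ hc
  obtain ⟨r, hr, hrmax⟩ := isCompact_Icc.exists_isMaxOn ⟨0, left_mem_Icc.2 zero_le_one⟩ hc
  exact ⟨hc.comp_continuous (by fun_prop) fun t => clampTime_mem zero_le_one t, f s, h0 s hs.1, f r,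
    fun t => ⟨hsmin (clampTime_mem zero_le_one t), hrmax (clampTime_mem zero_le_one t)⟩⟩

/-! ### Well-posedness -/

/-- Well-posedness when the coefficients are bounded between positive constants on `ℝ` and `T` is so
small that a constant `M` is a supersolution of the integral system. -/
theorem exists_unique_solution {K k h : Fin 2 → ℝ → ℝ} {p : Fin 2 → Fin 2 → ℝ}
    {φ : Fin 2 → EuclideanSpace ℝ (Fin n) → ℝ} {T m κ M M₀ H : ℝ} (hn : 1 ≤ n) (hT : 0 < T)
    (hK : ∀ i, IsTimeChange (K i) (k i) m) (hkκ : ∀ i t, k i t ≤ κ) (hh : ∀ i, Continuous (h i))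
    (hhm : ∀ i t, m ≤ h i t) (hhH : ∀ i t, h i t ≤ H) (hp : ∀ i j, 0 ≤ p i j)
    (hφ : ∀ i, Continuous (φ i)) (hφ0 : ∀ i x, 0 ≤ φ i x) (hφM : ∀ i x, φ i x ≤ M₀)
    (hfar : ∀ i, ∃ b > 0, ∃ R, ∀ x, R ≤ ‖x‖ → b ≤ φ i x) (hM0 : 0 ≤ M)
    (hM : M₀ + sourceBound H p M * T ≤ M) :
    ∃ u : Fin 2 → ℝ → EuclideanSpace ℝ (Fin n) → ℝ,
      IsClassicalSolution k h p φ T u ∧ IsMildSolution k h p φ T u ∧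
      (∀ i, ∀ t ∈ Ioc 0 T, ∀ x, 0 < u i t x) ∧
      (∀ v, IsClassicalSolution k h p φ T v → ∀ i, ∀ t ∈ Icc 0 T, ∀ x, v i t x = u i t x) ∧
      (∀ v, IsMildSolution k h p φ T v → ∀ i, ∀ t ∈ Icc 0 T, ∀ x, v i t x = u i t x) := by
  have hm : 0 < m := (hK 0).pos
  have hh0 : ∀ i t, 0 ≤ h i t := fun i t => hm.le.trans (hhm i t)
  have hφn : ∀ i x, ‖φ i x‖ ≤ M₀ := fun i x => by
    rw [Real.norm_of_nonneg (hφ0 i x)]; exact hφM i x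
  have hc : CoeffBounds k h 0 T κ m H := fun i t _ =>
    ⟨⟨hm.le.trans ((hK i).lower t), hkκ i t⟩, hhm i t, hhH i t⟩
  have hpos : ∀ v, IsClassicalSolution k h p φ T v → PositiveBelow T v := fun v hv =>
    hv.positiveBelow hn hK hm.le hc hφ hφ0 hφn hfar
  have huniq : ∀ u v, IsClassicalSolution k h p φ T u → IsClassicalSolution k h p φ T v →
      ∀ i, ∀ t ∈ Icc 0 T, ∀ x, v i t x = u i t x := fun u v hu hv i t ht x =>
    le_antisymm (hu.le hp hT hm hc hv (hpos u hu) i t ht x)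
      (hv.le hp hT hm hc hu (hpos v hv) i t ht x)
  obtain ⟨w, hwm, hw0, hwM, hw⟩ := exists_evolve_fixedPoint hT.le hK hh hh0 hhH hp hφ hφ0 hφM hM0 hM
  have hcl := isClassicalSolution_evolve hK hh hh0 hhH hp hφ hφn hwm hw0 hwM
    (positiveBelow_of_eq_evolve hn hK hh0 hφ hφ0 hφn hfar hw0 hw) hw
  refine ⟨_, hcl, ⟨hcl.nonnegBounded, fun i => ?_, fun i t ht x => ?_⟩,
    fun i t ht x => (hpos _ hcl).pos i ht x, fun v hv => huniq _ v hcl hv,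
    fun v hv i t ht x => ?_⟩
  · exact ((hcl.continuousOn i).comp_continuous
      (f := fun z : Icc (0 : ℝ) T × 𝔼 => ((z.1 : ℝ), z.2)) (by fun_prop)
      fun z => ⟨z.1.2, trivial⟩).measurable
  · exact (evolution_add_integral_eq_evolve hK (fun i t ht x => (hw i t ht x).symm) i ht x).symm
  · -- Freezing a mild solution outside `[0, T]` gives a fixed point defined for all times.
    set z : Fin 2 → ℝ → 𝔼 → ℝ := fun i => clampTime hT.le (v i)
    have hvz : ∀ i, ∀ t ∈ Icc 0 T, ∀ x, v i t x = z i t x := fun i t ht x => by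
      simp only [z, clampTime_of_mem hT.le _ ht]
    obtain ⟨N, hN⟩ := hv.nonnegBounded
    have hzm : ∀ i, StronglyMeasurable (Function.uncurry (z i)) := fun i =>
      ((hv.measurable i).comp (g := fun z : Icc (0 : ℝ) T × 𝔼 => v i z.1 z.2)
        (f := fun q : ℝ × 𝔼 => (projIcc 0 T hT.le q.1, q.2))
        (by fun_prop : Continuous _).measurable).stronglyMeasurable
    have hz : ∀ i, ∀ t ∈ Icc 0 T, ∀ x,
        z i t x = evolve (K i) 0 (φ i) (source h p z i) t x := fun i t ht x => by
      rw [← hvz i t ht x, hv.equation i t ht x, evolution_add_integral_eq_evolve hK hvz i ht x]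
    have hz0 : ∀ i t x, 0 ≤ z i t x := fun i t x => (hN i _ (clampTime_mem hT.le t) x).1
    have hzcl := isClassicalSolution_evolve hK hh hh0 hhH hp hφ hφn hzm hz0
      (fun i t x => (hN i _ (clampTime_mem hT.le t) x).2)
      (positiveBelow_of_eq_evolve hn hK hh0 hφ hφ0 hφn hfar hz0 hz) hz
    rw [← huniq _ _ hcl hzcl i t ht x, hvz i t ht x, hz i t ht x]

/-- Coefficients frozen after time one are bounded between common positive constants. -/
lemma exists_common_bounds_clampTime {h k : Fin 2 → ℝ → ℝ}
    (hh_cont : ∀ i, ContinuousOn (h i) (Ici 0)) (hh_pos : ∀ i, ∀ t, 0 ≤ t → 0 < h i t)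
    (hk_cont : ∀ i, ContinuousOn (k i) (Ici 0)) (hk_pos : ∀ i, ∀ t, 0 ≤ t → 0 < k i t) :
    ∃ m > 0, ∃ H, ∀ i t,
      (m ≤ clampTime zero_le_one (h i) t ∧ clampTime zero_le_one (h i) t ≤ H) ∧
      (m ≤ clampTime zero_le_one (k i) t ∧ clampTime zero_le_one (k i) t ≤ H) := by
  choose a ha b hab using fun i => (exists_bounds_clampTime (hh_cont i) (hh_pos i)).2
  choose a' ha' b' hab' using fun i => (exists_bounds_clampTime (hk_cont i) (hk_pos i)).2
  refine ⟨min (min (a 0) (a 1)) (min (a' 0) (a' 1)),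
    lt_min (lt_min (ha 0) (ha 1)) (lt_min (ha' 0) (ha' 1)),
    max (max (b 0) (b 1)) (max (b' 0) (b' 1)), fun i t => ?_⟩
  have h1 := hab i t
  have h2 := hab' i t
  fin_cases i <;> simp_all

lemma exists_pos_le_of_tendsto_supNorm {φ : EuclideanSpace ℝ (Fin n) → ℝ}
    (hlim : Tendsto φ (Bornology.cobounded (EuclideanSpace ℝ (Fin n))) (𝓝 (supNorm φ)))
    (hpos : 0 < supNorm φ) : ∃ b > 0, ∃ R, ∀ x, R ≤ ‖x‖ → b ≤ φ x := by
  have h1 := hlim.eventually (lt_mem_nhds (half_lt_self hpos))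
  rw [← comap_norm_atTop, eventually_comap, eventually_atTop] at h1
  obtain ⟨R, hR⟩ := h1
  exact ⟨supNorm φ / 2, half_pos hpos, R, fun x hx => (hR _ hx x rfl).le⟩

end

end HeatSystem

theorem theorem2p2 (n : ℕ) (hn : 1 ≤ n)
    (φ : Fin 2 → EuclideanSpace ℝ (Fin n) → ℝ)
    (hφ_cont : ∀ i, Continuous (φ i))
    (hφ_nonneg : ∀ i x, 0 ≤ φ i x)
    (hφ_bdd : ∀ i, ∃ M : ℝ, ∀ x, φ i x ≤ M)
    (hφ_lim : ∀ i, Tendsto (φ i) (Bornology.cobounded (EuclideanSpace ℝ (Fin n)))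
      (𝓝 (HeatSystem.supNorm (φ i))))
    (hφ_pos : ∀ i, 0 < HeatSystem.supNorm (φ i))
    (h k : Fin 2 → ℝ → ℝ)
    (hh_cont : ∀ i, ContinuousOn (h i) (Ici 0))
    (hh_pos : ∀ i, ∀ t, 0 ≤ t → 0 < h i t)
    (hk_cont : ∀ i, ContinuousOn (k i) (Ici 0))
    (hk_pos : ∀ i, ∀ t, 0 ≤ t → 0 < k i t)
    (p : Fin 2 → Fin 2 → ℝ)
    (hp : ∀ i j, 0 ≤ p i j) :
    ∃ T : ℝ, 0 < T ∧ ∃ u : Fin 2 → ℝ → EuclideanSpace ℝ (Fin n) → ℝ,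
      HeatSystem.IsClassicalSolution k h p φ T u ∧
      HeatSystem.IsMildSolution k h p φ T u ∧
      (∀ i, ∀ t ∈ Ioc 0 T, ∀ x, 0 < u i t x) ∧
      (∀ v, HeatSystem.IsClassicalSolution k h p φ T v →
        ∀ i, ∀ t ∈ Icc 0 T, ∀ x, v i t x = u i t x) ∧
      (∀ v, HeatSystem.IsMildSolution k h p φ T v →
        ∀ i, ∀ t ∈ Icc 0 T, ∀ x, v i t x = u i t x) := by
  obtain ⟨m, hm, H, hmH⟩ :=
    HeatSystem.exists_common_bounds_clampTime hh_cont hh_pos hk_cont hk_pos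
  set h₁ : Fin 2 → ℝ → ℝ := fun i => HeatSystem.clampTime zero_le_one (h i)
  set k₁ : Fin 2 → ℝ → ℝ := fun i => HeatSystem.clampTime zero_le_one (k i)
  have hk₁ : ∀ i, Continuous (k₁ i) := fun i =>
    (HeatSystem.exists_bounds_clampTime (hk_cont i) (hk_pos i)).1
  have hK : ∀ i, HeatSystem.IsTimeChange (fun t => ∫ r in (0 : ℝ)..t, k₁ i r) (k₁ i) m := fun i =>
    ⟨hk₁ i, hm, fun t => (hmH i t).2.1, fun t =>
      intervalIntegral.integral_hasDerivAt_right ((hk₁ i).intervalIntegrable _ _)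
        ((hk₁ i).stronglyMeasurableAtFilter _ _) (hk₁ i).continuousAt⟩
  choose N hN using hφ_bdd
  set M₀ := max (N 0) (N 1) with hM₀
  have hφM : ∀ i x, φ i x ≤ M₀ := fun i x => (hN i x).trans (by fin_cases i <;> simp [hM₀])
  have hM₀0 : 0 ≤ M₀ := (hφ_nonneg 0 0).trans (hφM 0 0)
  have hH : 0 ≤ H := hm.le.trans ((hmH 0 0).1.1.trans (hmH 0 0).1.2)
  have hB : 0 ≤ HeatSystem.sourceBound H p (M₀ + 1) := by
    unfold HeatSystem.sourceBound; positivity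
  -- The time span on which the constant `M₀ + 1` is a supersolution.
  obtain ⟨T, hT, hT1, hBT⟩ : ∃ T : ℝ, 0 < T ∧ T ≤ 1 ∧
      HeatSystem.sourceBound H p (M₀ + 1) * T ≤ 1 := by
    refine ⟨1 / (HeatSystem.sourceBound H p (M₀ + 1) + 1), by positivity, ?_, ?_⟩
    · rw [div_le_one (by positivity)]; linarith
    · rw [mul_one_div, div_le_one (by positivity)]; linarith
  have hkk : ∀ i, ∀ t ∈ Icc 0 T, k₁ i t = k i t := fun i t ht =>
    HeatSystem.clampTime_of_mem zero_le_one (k i) ⟨ht.1, ht.2.trans hT1⟩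
  have hhh : ∀ i, ∀ t ∈ Icc 0 T, h₁ i t = h i t := fun i t ht =>
    HeatSystem.clampTime_of_mem zero_le_one (h i) ⟨ht.1, ht.2.trans hT1⟩
  have hkk' := fun i t ht => (hkk i t ht).symm
  have hhh' := fun i t ht => (hhh i t ht).symm
  obtain ⟨u, hcl, hmild, hpos, huc, hum⟩ := HeatSystem.exists_unique_solution hn hT hK
    (fun i t => (hmH i t).2.2)
    (fun i => (HeatSystem.exists_bounds_clampTime (hh_cont i) (hh_pos i)).1)
    (fun i t => (hmH i t).1.1) (fun i t => (hmH i t).1.2) hp hφ_cont hφ_nonneg hφM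
    (fun i => HeatSystem.exists_pos_le_of_tendsto_supNorm (hφ_lim i) (hφ_pos i))
    (by positivity : 0 ≤ M₀ + 1) (by linarith)
  exact ⟨T, hT, u, hcl.congr_coeff hkk' hhh', hmild.congr_coeff hkk' hhh', hpos,
    fun v hv => huc v (hv.congr_coeff hkk hhh), fun v hv => hum v (hv.congr_coeff hkk hhh)⟩
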